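/- Let $\mathbb D\subseteq\mathbb R^2$ be the closed unit disk and let $\Sigma=\overline{pq}\subseteq\mathbb D$ be a line segment that is computable as a compact set (some algorithm outputs, on input $l\in\mathbb N$, a finite union of closed rational balls at Hausdorff distance at most $2^{-l}$ from $\Sigma$). For $C^1$ vector fields $f$ on $\mathbb D$ (restrictions to $\mathbb D$ of $C^1$ vector fields on $\mathbb R^2$) pointing inwards along $\partial\mathbb D$, suppose that $\Sigma$ is a cross-section for a periodic orbit $\gamma\subseteq\mathbb D$ of $x'=f(x)$, i.e. $f(x)$ is not parallel to $\Sigma$ for any $x\in\Sigma$ and $\Sigma\cap\gamma\neq\emptyset$, and that the Poincaré map $P:\Sigma\to\Sigma$ is defined at all points: for every $x\in\Sigma$ the trajectory $\phi_t(x)$ returns to $\Sigma$ at some time $t>0$; let $\tau(x)>0$ be the first such time and $P(x)=\phi_{\tau(x)}(x)$. Then $P$ and its derivative $DP$ are computable from $f$, uniformly in $f$. That is, for such $f$ the map $P$ is differentiable along $\Sigma$, and for each $x\in\Sigma$ it extends to the points $y\in\mathbb D$ near $x$ by $y\mapsto\phi_{\theta(y)}(y)$, with $\theta$ continuous at $x$,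 $\theta(x)=\tau(x)$ and $\phi_{\theta(y)}(y)$ on the line through $p$ and $q$; this extension agrees with $P$ on $\Sigma$ near $x$ and is differentiable at $x$ (relative to $\mathbb D$), and $DP(x)$ denotes its $2\times2$ Jacobian, whose restriction to the direction of $\Sigma$ is the derivative of $P:\Sigma\to\Sigma$. Moreover there is a single oracle algorithm, depending only on $\Sigma$, that for every such $f$, every $x\in\Sigma$ and every $n\in\mathbb N$, given as oracles any $C^1$-name of $f$ and any name of $x$, outputs rational vectors within $2^{-n}$ of $P(x)$ and of the two columns of $DP(x)$. Here a $C^1$-name of $f$ is a sequence $(P_l)_{l\in\mathbb N}$ of polynomial vector fields with rational coefficients such that $\max_{x\in\mathbb D}\|f(x)-P_l(x)\|\le 2^{-l}$ and $\max_{x\in\mathbb D}\|Df(x)-DP_l(x)\|\le 2^{-l}$ for all $l$, and a name of $x$ is a sequence $(r_l)_{l\in\mathbb N}$ of rational points with $\|x-r_l\|\le2^{-l}$ for all $l$. -/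

import Mathlib

open Set Filter Topology

noncomputable section

/-- The Euclidean plane. -/
abbrev Plane : Type := EuclideanSpace ℝ (Fin 2)

/-- The closed unit disk `𝔻`. -/
def unitDisk : Set Plane := Metric.closedBall 0 1

/-! ### Finite codes for rational objects -/

/-- The triple `(a, b, c)` of natural numbers codes the rational number `(a - b) / (c + 1)`. -/
abbrev RatCode : Type := ℕ × ℕ × ℕ

def RatCode.val (c : RatCode) : ℝ := ((c.1 : ℝ) - (c.2.1 : ℝ)) / ((c.2.2 : ℝ) + 1)

/-- Codes of points (or vectors) of the plane with rational coordinates. -/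
abbrev PtCode : Type := RatCode × RatCode

def PtCode.val (c : PtCode) : Plane := !₂[RatCode.val c.1, RatCode.val c.2]

/-- Codes of polynomials in two variables with rational coefficients: finite lists of monomials
`(i, j, c)`, standing for `c * x₀ ^ i * x₁ ^ j`. -/
abbrev PolyCode : Type := List (ℕ × ℕ × RatCode)

def PolyCode.eval (L : PolyCode) (x : Plane) : ℝ :=
  (L.map fun m => RatCode.val m.2.2 * x 0 ^ m.1 * x 1 ^ m.2.1).sum

/-- Codes of polynomial vector fields on the plane with rational coefficients. -/
abbrev FieldCode : Type := PolyCode × PolyCode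

def FieldCode.eval (c : FieldCode) (x : Plane) : Plane :=
  !₂[PolyCode.eval c.1 x, PolyCode.eval c.2 x]

/-- Codes of closed balls with rational centre and rational radius. -/
abbrev BallCode : Type := PtCode × RatCode

def BallCode.toSet (b : BallCode) : Set Plane :=
  Metric.closedBall (PtCode.val b.1) (RatCode.val b.2)

/-! ### Names -/

/-- `X` is a name of the point `x`: the `l`-th entry is a rational point within `2⁻ˡ` of `x`. -/
def IsPointName (x : Plane) (X : ℕ → PtCode) : Prop :=
  ∀ l : ℕ, ‖x - PtCode.val (X l)‖ ≤ (1 / 2 : ℝ) ^ l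

/-- `F` is a `C¹`-name of the vector field `f` on the unit disk: the `l`-th entry is a polynomial
field with rational coefficients whose `C¹`-distance to `f` on the disk is at most `2⁻ˡ`. -/
def IsC1Name (f : Plane → Plane) (F : ℕ → FieldCode) : Prop :=
  ∀ l : ℕ, ∀ x ∈ unitDisk,
    ‖f x - FieldCode.eval (F l) x‖ ≤ (1 / 2 : ℝ) ^ l ∧
    ‖fderiv ℝ f x - fderiv ℝ (FieldCode.eval (F l)) x‖ ≤ (1 / 2 : ℝ) ^ l

/-- A compact subset of the plane is computable if some algorithm outputs, on input `l`, a finite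
list of rational closed balls whose union has Hausdorff distance at most `2⁻ˡ` to the set. -/
def IsComputableCompact (C : Set Plane) : Prop :=
  IsCompact C ∧ ∃ g : ℕ → List BallCode, Computable g ∧
    ∀ l : ℕ, Metric.hausdorffEDist C (⋃ b ∈ g l, BallCode.toSet b)
      ≤ ENNReal.ofReal ((1 / 2 : ℝ) ^ l)

/-! ### Oracle algorithms

An algorithm with two oracles `F : ℕ → α` and `X : ℕ → β` and a numerical input `n` is given by a
(classically) computable function `M`. At stage `k` it has read the first `k` entries of either
oracle, and it either stops with an output `M _ _ n = some v` or goes on (`none`). -/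

/-- The algorithm `M` is computable in the classical sense, on its finite arguments. -/
def IsOracleAlgorithm {α β γ : Type} [Primcodable α] [Primcodable β] [Primcodable γ]
    (M : List α → List β → ℕ → Option γ) : Prop :=
  Computable fun a : List α × List β × ℕ => M a.1 a.2.1 a.2.2

/-- With the oracles `F`, `X` and on input `n`, the algorithm `M` stops and outputs `v`. -/
def OracleOutputs {α β γ : Type} (M : List α → List β → ℕ → Option γ)
    (F : ℕ → α) (X : ℕ → β) (n : ℕ) (v : γ) : Prop :=
  ∃ k : ℕ, M ((List.range k).map F) ((List.range k).map X) n = some v ∧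
    ∀ j < k, M ((List.range j).map F) ((List.range j).map X) n = none

/-! ### Dynamics on the disk -/

/-- Restrictions to the disk of `C¹` vector fields of the plane that point inwards along the
boundary of the disk. -/
def IsInwardC1Field (f : Plane → Plane) : Prop :=
  ContDiff ℝ 1 f ∧ ∀ x : Plane, ‖x‖ = 1 → inner ℝ (f x) x < 0

/-- `u` solves `u' = f(u)`, `u(0) = y` for all times `t ≥ 0`, within the disk. -/
def IsForwardSolution (f : Plane → Plane) (y : Plane) (u : ℝ → Plane) : Prop :=
  u 0 = y ∧ ∀ t : ℝ, 0 ≤ t → u t ∈ unitDisk ∧ HasDerivWithinAt u (f (u t)) (Ici 0) t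

/-- `γ` is a periodic orbit in the disk (equilibria are not periodic orbits). -/
def IsPeriodicOrbit (f : Plane → Plane) (γ : Set Plane) : Prop :=
  ∃ (u : ℝ → Plane) (T : ℝ), 0 < T ∧
    (∀ t : ℝ, u t ∈ unitDisk ∧ HasDerivAt u (f (u t)) t) ∧
    (∀ t : ℝ, u (t + T) = u t) ∧ (∃ t : ℝ, u t ≠ u 0) ∧ γ = range u

/-- The segment `[p, q]` is a cross-section for the periodic orbit `γ`: it lies in the disk, it is
transversal to the vector field at each of its points, and it meets `γ`. -/
def IsCrossSection (f : Plane → Plane) (p q : Plane) (γ : Set Plane) : Prop :=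
  segment ℝ p q ⊆ unitDisk ∧
  (∀ x ∈ segment ℝ p q, LinearIndependent ℝ ![f x, q - p]) ∧
  (segment ℝ p q ∩ γ).Nonempty

/-- The trajectory of `x` is in `S` at the time `τ > 0`, at the point `y`, and at no time strictly
between `0` and `τ`. -/
def IsFirstReturn (f : Plane → Plane) (S : Set Plane) (x y : Plane) (τ : ℝ) : Prop :=
  0 < τ ∧ y ∈ S ∧ ∃ u : ℝ → Plane, IsForwardSolution f x u ∧ u τ = y ∧
    ∀ s ∈ Ioo 0 τ, u s ∉ S

/-- `P` is the Poincaré (first return) map of `S`, and it is defined at every point of `S`. -/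
def IsPoincareMap (f : Plane → Plane) (S : Set Plane) (P : Plane → Plane) : Prop :=
  ∀ x ∈ S, ∃ τ : ℝ, IsFirstReturn f S x (P x) τ

/-- `A` is the Jacobian at `x` of the Poincaré map `P` of the segment `[p, q]`, where `P` is
extended to points `y` of the disk near `x` in the usual way: `y` is sent to the point
`φ(θ(y), y)` of the line through `p` and `q`, where `φ` is the flow and `θ` is continuous at `x`
and equal there to the time of first return of `x`. The germ at `x` of the extension is unique,
and it agrees with `P` on the segment. -/
def IsPoincareJacobian (f : Plane → Plane) (p q : Plane) (P : Plane → Plane) (x : Plane)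
    (A : Plane →L[ℝ] Plane) : Prop :=
  ∃ (Q : Plane → Plane) (θ : Plane → ℝ),
    IsFirstReturn f (segment ℝ p q) x (P x) (θ x) ∧
    ContinuousWithinAt θ unitDisk x ∧
    (∀ᶠ y in 𝓝[unitDisk] x, 0 < θ y ∧ Q y ∈ affineSpan ℝ ({p, q} : Set Plane) ∧
      ∃ u : ℝ → Plane, IsForwardSolution f y u ∧ u (θ y) = Q y) ∧
    (∀ᶠ y in 𝓝[segment ℝ p q] x, Q y = P y) ∧
    HasFDerivWithinAt Q A unitDisk x

end

/-!
Write `v = q - p` for the direction of the segment and `Φ` for the flow. Multiplied by a bump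
function, the field becomes bounded and Lipschitz on the whole plane without changing on the disk;
the disk is forward invariant since the field points inwards on its boundary
(`IsInwardC1Field.exists_isDiskFlow`).

**The first return is a transversal crossing, even at the end points.** Where the trajectory of a
point of the segment returns, it crosses the line through `p` and `q` transversally, so trajectories
of nearby points of the segment cross the line too. If the return point is `p` or `q`, the crossing
might slip off the segment. This cannot happen when the Poincaré map is defined everywhere: the arc
of the trajectory up to such a crossing, closed up along the line, would separate the plane, and the
trajectory would be trapped on the side from which the segment is inaccessible
(`IsDiskFlow.not_exit`, `IsDiskFlow.mem_segment_of_crossing`). Instead of the Jordan curve theorem,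
the proof uses the integral that defines winding numbers: it is locally constant off the closed curve
and jumps across the segment (`planar_trapping`).

**The Jacobian.** The time of crossing is an implicit function of the initial point, whence the
extension of the Poincaré map to neighbouring points of the disk and its derivative `A`. The values
of `A` are multiples of `v`, and Liouville's formula for the variational equation
(`wedge_eq_exp_integral_mul`) gives them in closed form (`poincareDeriv`,
`IsDiskFlow.isPoincareJacobian`): if `τ` is the return time and `y` the point of return of `x`, then
`A w = exp (∫₀^τ div f (Φ x t) dt) * det (f x, w) / det (f y, v) • v`.
No solution of the variational equation has to be computed; only the values of `f` and the divergence
of `f` enter, and a `C¹`-name approximates these uniformly on the disk.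

**The algorithm.** It searches through all finite certificates of rational data
(`Certificate.search`) and stops at the first valid one. A certificate contains an inexact Euler
polygon. Its trajectory stays in an explicit tube about the polygon; it is transversal to `v` in an
initial and in a final phase, and in the phase between them each vertex comes with a linear
functional separating it from the segment. In the final phase the polygon changes sides of the line,
so the trajectory crosses it exactly once, and by the above this crossing is the first return.
The integral of the divergence is approximated by a Riemann sum over the polygon, and its exponential
is enclosed by rational numbers through `(1 + a) ^ r ≤ exp (r * a)` for `-1 ≤ a` and
`exp (r * a) * (1 - a) ^ r ≤ 1` for `a ≤ 1`. Validity (`Certificate.IsValid`) is a finite list of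
inequalities between rational numbers, and primitive recursive (`Certificate.primrecPred_isValid`).
A valid certificate yields correct approximations (`Certificate.IsValid.sound`), and the search
terminates because data close enough to the trajectory form a valid certificate
(`Certificate.exists_isClose`, `Certificate.IsClose.isValid`).

The end points of the segment, which the certificates refer to, are computable because each of their
coordinates is the maximum or minimum of that coordinate on the segment
(`exists_computable_endpoint`); which of the two it is depends only on the segment.
-/

noncomputable section

/-! ### Primitive recursive arithmetic of the codes -/

attribute [fun_prop] Primrec Primrec.id Primrec.const Primrec.comp Primrec.pair

namespace Primrec

variable {α β γ σ : Type} [Primcodable α] [Primcodable β] [Primcodable γ] [Primcodable σ]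

@[fun_prop]
theorem fst_comp {f : γ → α × β} (hf : Primrec f) : Primrec fun x => (f x).1 := Primrec.fst.comp hf

@[fun_prop]
theorem snd_comp {f : γ → α × β} (hf : Primrec f) : Primrec fun x => (f x).2 := Primrec.snd.comp hf

@[fun_prop]
theorem add_comp {f g : γ → ℕ} (hf : Primrec f) (hg : Primrec g) :
    Primrec fun x => f x + g x := Primrec.nat_add.comp hf hg

@[fun_prop]
theorem mul_comp {f g : γ → ℕ} (hf : Primrec f) (hg : Primrec g) :
    Primrec fun x => f x * g x := Primrec.nat_mul.comp hf hg

@[fun_prop]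
theorem sub_comp {f g : γ → ℕ} (hf : Primrec f) (hg : Primrec g) :
    Primrec fun x => f x - g x := Primrec.nat_sub.comp hf hg

@[fun_prop]
theorem getD_comp {f : γ → List α} {g : γ → ℕ} {d : α} (hf : Primrec f) (hg : Primrec g) :
    Primrec fun x => (f x).getD (g x) d := (Primrec.list_getD d).comp hf hg

theorem foldr_comp {f : α → List β} {g : α → σ} {h : α → β → σ → σ} (hf : Primrec f)
    (hg : Primrec g) (hh : Primrec fun x : α × β × σ => h x.1 x.2.1 x.2.2) :
    Primrec fun a => (f a).foldr (fun b s => h a b s) (g a) :=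
  Primrec.list_foldr (h := fun a x => h a x.1 x.2) hf hg hh

theorem rec_comp {f : α → ℕ} {g : α → σ} {h : α → ℕ → σ → σ} (hf : Primrec f)
    (hg : Primrec g) (hh : Primrec fun x : α × ℕ × σ => h x.1 x.2.1 x.2.2) :
    Primrec fun a => (Nat.rec (g a) (fun n s => h a n s) (f a) : σ) :=
  Primrec.nat_rec' (h := fun a x => h a x.1 x.2) hf hg hh

end Primrec

namespace RatCode

/-- The code of a natural number. -/
def ofNat (n : ℕ) : RatCode := (n, 0, 0)

/-- The code of `1 / (n + 1)`. -/
def unitFrac (n : ℕ) : RatCode := (1, 0, n)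

def add (a b : RatCode) : RatCode :=
  (a.1 * (b.2.2 + 1) + b.1 * (a.2.2 + 1), a.2.1 * (b.2.2 + 1) + b.2.1 * (a.2.2 + 1),
    a.2.2 * b.2.2 + a.2.2 + b.2.2)

def neg (a : RatCode) : RatCode := (a.2.1, a.1, a.2.2)

def sub (a b : RatCode) : RatCode := add a (neg b)

def mul (a b : RatCode) : RatCode :=
  (a.1 * b.1 + a.2.1 * b.2.1, a.1 * b.2.1 + a.2.1 * b.1, a.2.2 * b.2.2 + a.2.2 + b.2.2)

def abs (a : RatCode) : RatCode := ((a.1 - a.2.1) + (a.2.1 - a.1), 0, a.2.2)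

def pow (a : RatCode) (n : ℕ) : RatCode := Nat.rec (ofNat 1) (fun _ s => mul s a) n

/-- The order of the coded rational numbers, as a relation between the codes. -/
def le (a b : RatCode) : Prop :=
  a.1 * (b.2.2 + 1) + b.2.1 * (a.2.2 + 1) ≤ b.1 * (a.2.2 + 1) + a.2.1 * (b.2.2 + 1)

instance (a b : RatCode) : Decidable (le a b) := by unfold le; infer_instance

/-- `∑ i < n, f i`. -/
def sumTo (f : ℕ → RatCode) (n : ℕ) : RatCode := Nat.rec (ofNat 0) (fun i s => add s (f i)) n

section val

variable (a b : RatCode) (n : ℕ)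

@[simp] theorem val_ofNat : (ofNat n).val = n := by simp [ofNat, RatCode.val]

@[simp] theorem val_unitFrac : (unitFrac n).val = 1 / ((n : ℝ) + 1) := by
  simp [unitFrac, RatCode.val]

@[simp] theorem val_add : (add a b).val = a.val + b.val := by
  have h1 : (a.2.2 : ℝ) + 1 ≠ 0 := by positivity
  have h2 : (b.2.2 : ℝ) + 1 ≠ 0 := by positivity
  have h3 : (a.2.2 : ℝ) * b.2.2 + a.2.2 + b.2.2 + 1 ≠ 0 := by positivity
  simp only [add, RatCode.val]; push_cast; field_simp; ring

@[simp] theorem val_neg : (neg a).val = -a.val := by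
  simp only [neg, RatCode.val]; ring

@[simp] theorem val_sub : (sub a b).val = a.val - b.val := by simp [sub, sub_eq_add_neg]

@[simp] theorem val_mul : (mul a b).val = a.val * b.val := by
  have h1 : (a.2.2 : ℝ) + 1 ≠ 0 := by positivity
  have h2 : (b.2.2 : ℝ) + 1 ≠ 0 := by positivity
  have h3 : (a.2.2 : ℝ) * b.2.2 + a.2.2 + b.2.2 + 1 ≠ 0 := by positivity
  simp only [mul, RatCode.val]; push_cast; field_simp; ring

@[simp] theorem val_abs : (abs a).val = |a.val| := by
  have h1 : (0 : ℝ) < (a.2.2 : ℝ) + 1 := by positivity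
  simp only [abs, RatCode.val, abs_div, abs_of_pos h1]
  congr 1
  rcases le_total a.1 a.2.1 with h | h
  · have h' : (a.1 : ℝ) ≤ a.2.1 := by exact_mod_cast h
    rw [abs_of_nonpos (by linarith), Nat.sub_eq_zero_of_le h]; push_cast [h]; ring
  · have h' : (a.2.1 : ℝ) ≤ a.1 := by exact_mod_cast h
    rw [abs_of_nonneg (by linarith), Nat.sub_eq_zero_of_le h]; push_cast [h]; ring

@[simp] theorem val_pow : (pow a n).val = a.val ^ n := by
  induction n with
  | zero => simp [pow]
  | succ n ih =>
    have h : pow a (n + 1) = mul (pow a n) a := rfl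
    rw [h, val_mul, ih, pow_succ]

theorem le_iff : le a b ↔ a.val ≤ b.val := by
  have h1 : (0 : ℝ) < (a.2.2 : ℝ) + 1 := by positivity
  have h2 : (0 : ℝ) < (b.2.2 : ℝ) + 1 := by positivity
  unfold le RatCode.val
  rw [div_le_div_iff₀ h1 h2, ← Nat.cast_le (α := ℝ)]
  push_cast
  constructor <;> intro h <;> linarith

@[simp] theorem val_sumTo (f : ℕ → RatCode) :
    (sumTo f n).val = ∑ i ∈ Finset.range n, (f i).val := by
  induction n with
  | zero => simp [sumTo]
  | succ n ih =>
    have h : sumTo f (n + 1) = add (sumTo f n) (f n) := rfl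
    rw [h, val_add, ih, Finset.sum_range_succ]

end val

section primrec

variable {γ : Type} [Primcodable γ] {f g : γ → RatCode}

@[fun_prop]
theorem primrec_ofNat {f : γ → ℕ} (hf : Primrec f) : Primrec fun x => ofNat (f x) := by
  unfold ofNat; fun_prop

@[fun_prop]
theorem primrec_unitFrac {f : γ → ℕ} (hf : Primrec f) : Primrec fun x => unitFrac (f x) := by
  unfold unitFrac; fun_prop

@[fun_prop]
theorem primrec_add (hf : Primrec f) (hg : Primrec g) : Primrec fun x => add (f x) (g x) := by
  unfold add; fun_prop

@[fun_prop]
theorem primrec_neg (hf : Primrec f) : Primrec fun x => neg (f x) := by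
  unfold neg; fun_prop

@[fun_prop]
theorem primrec_sub (hf : Primrec f) (hg : Primrec g) : Primrec fun x => sub (f x) (g x) := by
  unfold sub; fun_prop

@[fun_prop]
theorem primrec_mul (hf : Primrec f) (hg : Primrec g) : Primrec fun x => mul (f x) (g x) := by
  unfold mul; fun_prop

@[fun_prop]
theorem primrec_abs (hf : Primrec f) : Primrec fun x => abs (f x) := by
  unfold abs; fun_prop

@[fun_prop]
theorem primrec_pow {n : γ → ℕ} (hf : Primrec f) (hn : Primrec n) :
    Primrec fun x => pow (f x) (n x) :=
  Primrec.rec_comp (h := fun x _ s => mul s (f x)) hn (by fun_prop) (by fun_prop)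

theorem primrec_le (hf : Primrec f) (hg : Primrec g) : PrimrecPred fun x => le (f x) (g x) :=
  PrimrecRel.comp (f := fun x => (f x).1 * ((g x).2.2 + 1) + (g x).2.1 * ((f x).2.2 + 1))
    (g := fun x => (g x).1 * ((f x).2.2 + 1) + (f x).2.1 * ((g x).2.2 + 1))
    Primrec.nat_le (by fun_prop) (by fun_prop)

theorem primrec_sumTo {n : γ → ℕ} {f : γ → ℕ → RatCode} (hn : Primrec n)
    (hf : Primrec fun x : γ × ℕ => f x.1 x.2) : Primrec fun x => sumTo (f x) (n x) :=
  Primrec.rec_comp (h := fun x i s => add s (f x i)) hn (by fun_prop)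
    (primrec_add (by fun_prop)
      (hf.comp (g := fun x : γ × ℕ × RatCode => (x.1, x.2.1)) (by fun_prop)))

end primrec

end RatCode

/-! ### Polynomial codes -/

namespace PolyCode

/-- The value of a coded polynomial at a coded point. -/
def evalCode (L : PolyCode) (z : PtCode) : RatCode :=
  L.foldr (fun m s => ((m.2.2.mul (z.1.pow m.1)).mul (z.2.pow m.2.1)).add s) (RatCode.ofNat 0)

/-- `∑ |c| (1 + i + j)` over the monomials `c x₀ⁱ x₁ʲ`: a bound on the disk for the polynomial and
for its Lipschitz constant. -/
def bound (L : PolyCode) : RatCode :=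
  L.foldr (fun m s => (m.2.2.abs.mul (RatCode.ofNat (1 + m.1 + m.2.1))).add s) (RatCode.ofNat 0)

theorem val_evalCode (L : PolyCode) (z : PtCode) :
    (evalCode L z).val = PolyCode.eval L z.val := by
  induction L with
  | nil => simp [evalCode, PolyCode.eval]
  | cons m L ih =>
    have h : evalCode (m :: L) z
      = ((m.2.2.mul (z.1.pow m.1)).mul (z.2.pow m.2.1)).add (evalCode L z) := rfl
    rw [h, RatCode.val_add, ih]
    simp [PolyCode.eval, PtCode.val]

theorem bound_cons (m : ℕ × ℕ × RatCode) (L : PolyCode) :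
    (bound (m :: L)).val = |m.2.2.val| * (1 + m.1 + m.2.1) + (bound L).val := by
  have h : bound (m :: L) = (m.2.2.abs.mul (RatCode.ofNat (1 + m.1 + m.2.1))).add (bound L) := rfl
  rw [h, RatCode.val_add]; simp

theorem eval_cons (m : ℕ × ℕ × RatCode) (L : PolyCode) (x : Plane) :
    eval (m :: L) x = m.2.2.val * x 0 ^ m.1 * x 1 ^ m.2.1 + eval L x := by
  simp [PolyCode.eval]

theorem eval_append (L L' : PolyCode) (x : Plane) : eval (L ++ L') x = eval L x + eval L' x := by
  simp [PolyCode.eval]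

/-- The partial derivative with respect to the first variable. -/
def deriv₀ (L : PolyCode) : PolyCode :=
  L.map fun m => (m.1 - 1, m.2.1, m.2.2.mul (RatCode.ofNat m.1))

/-- The partial derivative with respect to the second variable. -/
def deriv₁ (L : PolyCode) : PolyCode :=
  L.map fun m => (m.1, m.2.1 - 1, m.2.2.mul (RatCode.ofNat m.2.1))

variable {γ : Type} [Primcodable γ]

@[fun_prop]
theorem primrec_evalCode {f : γ → PolyCode} {g : γ → PtCode} (hf : Primrec f) (hg : Primrec g) :
    Primrec fun x => evalCode (f x) (g x) :=
  Primrec.foldr_comp (g := fun _ => RatCode.ofNat 0)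
    (h := fun (x : γ) (m : ℕ × ℕ × RatCode) (s : RatCode) =>
      ((m.2.2.mul ((g x).1.pow m.1)).mul ((g x).2.pow m.2.1)).add s)
    hf (by fun_prop) (by fun_prop)

@[fun_prop]
theorem primrec_bound {f : γ → PolyCode} (hf : Primrec f) : Primrec fun x => bound (f x) :=
  Primrec.foldr_comp (g := fun _ => RatCode.ofNat 0)
    (h := fun (_ : γ) (m : ℕ × ℕ × RatCode) (s : RatCode) =>
      (m.2.2.abs.mul (RatCode.ofNat (1 + m.1 + m.2.1))).add s)
    hf (by fun_prop) (by fun_prop)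

@[fun_prop]
theorem primrec_deriv₀ {f : γ → PolyCode} (hf : Primrec f) : Primrec fun x => deriv₀ (f x) :=
  Primrec.list_map (g := fun _ m => (m.1 - 1, m.2.1, m.2.2.mul (RatCode.ofNat m.1))) hf
    (Primrec.to₂ (f := fun x : γ × (ℕ × ℕ × RatCode) =>
      (x.2.1 - 1, x.2.2.1, x.2.2.2.mul (RatCode.ofNat x.2.1))) (by fun_prop))

@[fun_prop]
theorem primrec_deriv₁ {f : γ → PolyCode} (hf : Primrec f) : Primrec fun x => deriv₁ (f x) :=
  Primrec.list_map (g := fun _ m => (m.1, m.2.1 - 1, m.2.2.mul (RatCode.ofNat m.2.1))) hf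
    (Primrec.to₂ (f := fun x : γ × (ℕ × ℕ × RatCode) =>
      (x.2.1, x.2.2.1 - 1, x.2.2.2.mul (RatCode.ofNat x.2.2.1))) (by fun_prop))

end PolyCode

namespace PtCode

def sub (a b : PtCode) : PtCode := (a.1.sub b.1, a.2.sub b.2)

def smul (r : RatCode) (a : PtCode) : PtCode := (r.mul a.1, r.mul a.2)

/-- The sum of the absolute values of the coordinates. -/
def norm₁ (a : PtCode) : RatCode := a.1.abs.add a.2.abs

/-- The determinant of the `2 × 2` matrix with columns `a` and `b`. -/
def det (a b : PtCode) : RatCode := (a.1.mul b.2).sub (a.2.mul b.1)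

/-- The inner product. -/
def dot (a b : PtCode) : RatCode := (a.1.mul b.1).add (a.2.mul b.2)

variable (a b : PtCode) (r : RatCode)

@[simp] theorem val_sub : (sub a b).val = a.val - b.val := by
  ext i; fin_cases i <;> simp [sub, PtCode.val]

@[simp] theorem val_smul : (smul r a).val = r.val • a.val := by
  ext i; fin_cases i <;> simp [smul, PtCode.val]

variable {γ : Type} [Primcodable γ] {f g : γ → PtCode}

@[fun_prop]
theorem primrec_sub (hf : Primrec f) (hg : Primrec g) : Primrec fun x => sub (f x) (g x) := by
  unfold sub; fun_prop

@[fun_prop]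
theorem primrec_smul {r : γ → RatCode} (hr : Primrec r) (hf : Primrec f) :
    Primrec fun x => smul (r x) (f x) := by
  unfold smul; fun_prop

@[fun_prop]
theorem primrec_norm₁ (hf : Primrec f) : Primrec fun x => norm₁ (f x) := by
  unfold norm₁; fun_prop

@[fun_prop]
theorem primrec_det (hf : Primrec f) (hg : Primrec g) : Primrec fun x => det (f x) (g x) := by
  unfold det; fun_prop

@[fun_prop]
theorem primrec_dot (hf : Primrec f) (hg : Primrec g) : Primrec fun x => dot (f x) (g x) := by
  unfold dot; fun_prop

end PtCode

namespace FieldCode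

/-- The value of a coded vector field at a coded point. -/
def evalCode (c : FieldCode) (z : PtCode) : PtCode := (c.1.evalCode z, c.2.evalCode z)

/-- The divergence of a coded vector field. -/
def div (c : FieldCode) : PolyCode := c.1.deriv₀ ++ c.2.deriv₁

theorem val_evalCode (c : FieldCode) (z : PtCode) :
    (evalCode c z).val = FieldCode.eval c z.val := by
  simp [evalCode, PtCode.val, FieldCode.eval, PolyCode.val_evalCode]

variable {γ : Type} [Primcodable γ]

@[fun_prop]
theorem primrec_evalCode {f : γ → FieldCode} {g : γ → PtCode} (hf : Primrec f) (hg : Primrec g) :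
    Primrec fun x => evalCode (f x) (g x) := by
  unfold evalCode; fun_prop

@[fun_prop]
theorem primrec_div {f : γ → FieldCode} (hf : Primrec f) : Primrec fun x => div (f x) :=
  Primrec.list_append.comp (by fun_prop) (by fun_prop)

end FieldCode

/-! ### Trapping in the plane -/

theorem eventually_sign_of_hasDerivAt_pos {g : ℝ → ℝ} {g' τ : ℝ} (hg : HasDerivAt g g' τ)
    (h0 : g τ = 0) (hpos : 0 < g') :
    ∀ᶠ t in 𝓝 τ, (τ < t → 0 < g t) ∧ (t < τ → g t < 0) := by
  have h := (hasDerivAt_iff_tendsto_slope.1 hg).eventually (lt_mem_nhds hpos)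
  rw [eventually_nhdsWithin_iff] at h
  filter_upwards [h] with t ht
  constructor
  · intro h1
    have h2 := ht (ne_of_gt h1)
    rw [slope_def_field, h0, sub_zero] at h2
    exact (div_pos_iff_of_pos_right (sub_pos.2 h1)).1 h2
  · intro h1
    have h2 := ht (ne_of_lt h1)
    rw [slope_def_field, h0, sub_zero] at h2
    by_contra hc
    exact absurd (div_nonpos_of_nonneg_of_nonpos (not_lt.1 hc) (sub_nonpos.2 h1.le)) (not_le.2 h2)

/-- Differentiating the Cauchy integral of the constant function `1` along a curve: the integrand
of the derivative has the primitive `-1 / (γ - z)`. -/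
theorem hasDerivAt_integral_deriv_div_sub {γ γ' : ℝ → ℂ} (hγ : ∀ t, HasDerivAt γ (γ' t) t)
    (hγ' : Continuous γ') {a b : ℝ} (hab : a ≤ b) {z : ℂ} (hz : ∀ t ∈ Icc a b, γ t ≠ z) :
    HasDerivAt (fun w => ∫ t in a..b, γ' t / (γ t - w)) (1 / (γ a - z) - 1 / (γ b - z)) z := by
  have hγc : Continuous γ := continuous_iff_continuousAt.2 fun t => (hγ t).continuousAt
  have hK : IsCompact (γ '' Icc a b) := isCompact_Icc.image hγc
  have hd : Disjoint (γ '' Icc a b) {z} := by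
    rw [disjoint_singleton_right]
    rintro ⟨t, ht, h⟩
    exact hz t ht h
  obtain ⟨δ, hδ, hdis⟩ := hd.exists_thickenings hK isClosed_singleton
  have hfar : ∀ w ∈ Metric.ball z (δ / 2), ∀ t ∈ Icc a b, δ / 2 ≤ ‖γ t - w‖ := by
    intro w hw t ht
    have h1 : δ ≤ ‖γ t - z‖ := by
      by_contra hc
      refine hdis.ne_of_mem (?_ : z ∈ _) (Metric.self_subset_thickening hδ _ (mem_singleton z)) rfl
      rw [Metric.mem_thickening_iff]
      exact ⟨γ t, mem_image_of_mem _ ht, by rw [dist_comm, dist_eq_norm]; exact not_le.1 hc⟩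
    have h2 : ‖w - z‖ < δ / 2 := by rw [← dist_eq_norm]; exact hw
    have h3 : ‖γ t - z‖ ≤ ‖γ t - w‖ + ‖w - z‖ := norm_sub_le_norm_sub_add_norm_sub _ _ _
    linarith
  obtain ⟨B, hB⟩ := (isCompact_Icc (a := a) (b := b)).exists_bound_of_continuousOn
    (hγ'.continuousOn)
  have hsub : uIoc a b ⊆ Icc a b := by rw [uIoc_of_le hab]; exact Ioc_subset_Icc_self
  have hcont : ∀ w ∈ Metric.ball z (δ / 2), ContinuousOn (fun t => γ' t / (γ t - w)) (Icc a b) := by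
    intro w hw
    refine hγ'.continuousOn.div (hγc.continuousOn.sub continuousOn_const) fun t ht h => ?_
    have := hfar w hw t ht
    rw [h, norm_zero] at this
    linarith
  have hz0 : z ∈ Metric.ball z (δ / 2) := Metric.mem_ball_self (by positivity)
  have hcont2 : ContinuousOn (fun t => γ' t / (γ t - z) ^ 2) (Icc a b) := by
    refine hγ'.continuousOn.div ((hγc.continuousOn.sub continuousOn_const).pow 2) fun t ht => ?_
    exact pow_ne_zero 2 (sub_ne_zero.2 (hz t ht))
  have key := intervalIntegral.hasDerivAt_integral_of_dominated_loc_of_deriv_le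
    (μ := MeasureTheory.volume) (F := fun w t => γ' t / (γ t - w))
    (F' := fun w t => γ' t / (γ t - w) ^ 2) (x₀ := z) (a := a) (b := b)
    (bound := fun _ => B / (δ / 2) ^ 2)
    (Metric.ball_mem_nhds z (show 0 < δ / 2 by positivity))
    (by
      filter_upwards [Metric.ball_mem_nhds z (show 0 < δ / 2 by positivity)] with w hw
      rw [uIoc_of_le hab]
      exact ((hcont w hw).mono Ioc_subset_Icc_self).aestronglyMeasurable measurableSet_Ioc)
    ((hcont z hz0).intervalIntegrable_of_Icc hab)
    (by
      rw [uIoc_of_le hab]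
      exact (hcont2.mono Ioc_subset_Icc_self).aestronglyMeasurable measurableSet_Ioc)
    (by
      refine Eventually.of_forall fun t ht w hw => ?_
      rw [norm_div, norm_pow]
      have h1 := hfar w hw t (hsub ht)
      have h2 := hB t (hsub ht)
      have h3 : 0 ≤ B := (norm_nonneg _).trans h2
      gcongr)
    (by simp)
    (by
      refine Eventually.of_forall fun t ht w hw => ?_
      have h1 := hfar w hw t (hsub ht)
      have hne : γ t - w ≠ 0 := fun h => by rw [h, norm_zero] at h1; linarith
      have h2 : HasDerivAt (fun w => γ t - w) (-1) w := by
        simpa using (hasDerivAt_id w).const_sub (γ t)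
      have h3 := ((hasDerivAt_const w (γ' t)).div h2 hne)
      refine h3.congr_deriv ?_
      ring)
  refine key.2.congr_deriv ?_
  have h4 : ∀ t ∈ uIcc a b, HasDerivAt (fun t => -(1 / (γ t - z))) (γ' t / (γ t - z) ^ 2) t := by
    intro t ht
    rw [uIcc_of_le hab] at ht
    have hne : γ t - z ≠ 0 := sub_ne_zero.2 (hz t ht)
    refine (((hasDerivAt_const t (1 : ℂ)).div ((hγ t).sub_const z) hne).neg).congr_deriv ?_
    ring
  rw [intervalIntegral.integral_eq_sub_of_hasDerivAt h4
    (hcont2.intervalIntegrable_of_Icc hab)]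
  ring

/-- The jump of the Cauchy integral of a real segment `[c, x]` across the segment: as the point above
the segment passes to the one below, the imaginary part changes by at least `π`. -/
theorem integral_inv_sub_jump {c x m s : ℝ} (hs : 0 < s) (h1 : s ≤ m - c) (h2 : s ≤ x - m) :
    Real.pi ≤ ((∫ r in c..x, (1 : ℂ) / ((r : ℂ) - (m + s * Complex.I)))
      - ∫ r in c..x, (1 : ℂ) / ((r : ℂ) - (m - s * Complex.I))).im := by
  have hne : ∀ r : ℝ, ((r : ℂ) - (m + s * Complex.I)) ≠ 0 := fun r h => by
    have := congrArg Complex.im h; simp at this; linarith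
  have hne' : ∀ r : ℝ, ((r : ℂ) - (m - s * Complex.I)) ≠ 0 := fun r h => by
    have := congrArg Complex.im h; simp at this; linarith
  have hpos : ∀ r : ℝ, (0 : ℝ) < (r - m) ^ 2 + s ^ 2 := fun r => by positivity
  have hi1 : IntervalIntegrable (fun r : ℝ => (1 : ℂ) / ((r : ℂ) - (m + s * Complex.I)))
      MeasureTheory.volume c x := by
    apply Continuous.intervalIntegrable
    exact continuous_const.div (by fun_prop) hne
  have hi2 : IntervalIntegrable (fun r : ℝ => (1 : ℂ) / ((r : ℂ) - (m - s * Complex.I)))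
      MeasureTheory.volume c x := by
    apply Continuous.intervalIntegrable
    exact continuous_const.div (by fun_prop) hne'
  rw [← intervalIntegral.integral_sub hi1 hi2]
  have heq : ∀ r : ℝ, (1 : ℂ) / ((r : ℂ) - (m + s * Complex.I))
      - 1 / ((r : ℂ) - (m - s * Complex.I))
      = ((2 * (s / ((r - m) ^ 2 + s ^ 2)) : ℝ) : ℂ) * Complex.I := by
    intro r
    have h3 : (((r : ℂ) - m) ^ 2 + (s : ℂ) ^ 2) ≠ 0 := by exact_mod_cast (hpos r).ne'
    rw [div_sub_div _ _ (hne r) (hne' r), div_eq_iff (mul_ne_zero (hne r) (hne' r))]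
    have h4 : ((r : ℂ) - (m + s * Complex.I)) * (r - (m - s * Complex.I))
        = ((r : ℂ) - m) ^ 2 + (s : ℂ) ^ 2 := by
      linear_combination (-(s : ℂ) ^ 2) * Complex.I_sq
    rw [h4]
    push_cast
    field_simp
    ring
  simp_rw [heq]
  rw [intervalIntegral.integral_mul_const, intervalIntegral.integral_ofReal]
  have hprim : ∀ r ∈ uIcc c x, HasDerivAt (fun r : ℝ => 2 * Real.arctan ((r - m) / s))
      (2 * (s / ((r - m) ^ 2 + s ^ 2))) r := by
    intro r _
    have h5 : HasDerivAt (fun r : ℝ => (r - m) / s) (1 / s) r :=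
      ((hasDerivAt_id r).sub_const m).div_const s
    refine ((h5.arctan).const_mul 2).congr_deriv ?_
    have := (hpos r).ne'
    have h6 : (1 : ℝ) + ((r - m) / s) ^ 2 ≠ 0 := by positivity
    field_simp
    ring
  rw [intervalIntegral.integral_eq_sub_of_hasDerivAt hprim]
  · simp only [Complex.mul_im, Complex.ofReal_re, Complex.I_im, Complex.ofReal_im, Complex.I_re,
      mul_one, mul_zero, add_zero]
    have h7 : Real.pi / 4 ≤ Real.arctan ((x - m) / s) := by
      rw [← Real.arctan_one]
      exact Real.arctan_strictMono.monotone ((one_le_div hs).2 h2)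
    have h8 : Real.arctan ((c - m) / s) ≤ -(Real.pi / 4) := by
      rw [← Real.arctan_one, ← Real.arctan_neg]
      apply Real.arctan_strictMono.monotone
      rw [div_le_iff₀ hs]
      linarith
    linarith
  · apply Continuous.intervalIntegrable
    exact continuous_const.mul (continuous_const.div (by fun_prop) fun r => (hpos r).ne')

/-- A closed curve made of an arc that leaves a real segment upwards at `x` and comes back from
below at its end point `c`, and of the segment `[c, x]`, separates the two sides of the segment.
Hence the continuation of the arc, which starts on the upper side, never meets the segment `[c, d]`
again: it could do so only from below. -/
theorem planar_trapping {U U' : ℝ → ℂ} {c x d T : ℝ}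
    (hU : ∀ t, HasDerivAt U (U' t) t) (hU' : Continuous U')
    (hT : 0 < T) (hcx : c < x) (hxd : x ≤ d) (h0 : U 0 = x) (hUT : U T = c)
    (htrans : ∀ t, 0 ≤ t → ∀ r ∈ Icc c d, U t = (r : ℂ) → 0 < (U' t).im)
    (hinj : ∀ s t, 0 ≤ s → s ≤ t → U s = U t → U (t - s) = U 0)
    (hfirst : ∀ t ∈ Ioo 0 T, ∀ r ∈ Icc c d, U t ≠ (r : ℂ)) :
    ∀ t, T < t → ∀ r ∈ Icc c d, U t ≠ (r : ℂ) := by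
  intro t1 ht1 r1 hr1 hUt1
  have hUc : Continuous U := continuous_iff_continuousAt.2 fun t => (hU t).continuousAt
  have him : ∀ t, HasDerivAt (fun t => (U t).im) (U' t).im t := fun t =>
    (Complex.imCLM.hasFDerivAt.comp_hasDerivAt t (hU t))
  have hsign : ∀ t, 0 ≤ t → ∀ r ∈ Icc c d, U t = (r : ℂ) →
      ∃ η > 0, ∀ s ∈ Ioo (t - η) (t + η), (t < s → 0 < (U s).im) ∧ (s < t → (U s).im < 0) := by
    intro t ht r hr hr'
    have := eventually_sign_of_hasDerivAt_pos (him t) (by simp [hr']) (htrans t ht r hr hr')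
    obtain ⟨η, hη, h⟩ := Metric.eventually_nhds_iff.1 this
    refine ⟨η, hη, fun s hs => h ?_⟩
    rw [Real.dist_eq, abs_lt]
    constructor <;> linarith [hs.1, hs.2]
  have hc : c ∈ Icc c d := ⟨le_rfl, by linarith⟩
  have hx : x ∈ Icc c d := ⟨hcx.le, hxd⟩
  obtain ⟨η0, hη0, hs0⟩ := hsign 0 le_rfl x hx h0
  obtain ⟨η1, hη1, hs1⟩ := hsign T hT.le c hc hUT
  -- the first time `t0 > T` on the segment
  have hseg : IsClosed ((fun r : ℝ => (r : ℂ)) '' Icc c d) :=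
    (isCompact_Icc.image Complex.continuous_ofReal).isClosed
  obtain ⟨t0, ht0, r0, hr0, hUt0, hmin⟩ : ∃ t0, T < t0 ∧ ∃ r0 ∈ Icc c d, U t0 = (r0 : ℂ) ∧
      ∀ t ∈ Ioo T t0, ∀ r ∈ Icc c d, U t ≠ (r : ℂ) := by
    have hS : IsCompact (Icc (T + η1 / 2) t1 ∩ U ⁻¹' ((fun r : ℝ => (r : ℂ)) '' Icc c d)) :=
      isCompact_Icc.inter_right (hseg.preimage hUc)
    have hafter : ∀ t ∈ Ioo T (T + η1), ∀ r ∈ Icc c d, U t ≠ (r : ℂ) := by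
      intro t ht r _ h
      have := (hs1 t ⟨by linarith [ht.1], ht.2⟩).1 ht.1
      rw [h] at this
      simp at this
    have hge : T + η1 / 2 ≤ t1 := by
      by_contra hcon
      exact hafter t1 ⟨ht1, by linarith⟩ r1 hr1 hUt1
    obtain ⟨t0, ht0S, hleast⟩ := hS.exists_isLeast ⟨t1, ⟨hge, le_rfl⟩, r1, hr1, hUt1.symm⟩
    obtain ⟨⟨ha, hb⟩, r0, hr0, hr0'⟩ := ht0S
    refine ⟨t0, by linarith, r0, hr0, hr0'.symm, fun t ht r hr h => ?_⟩
    rcases lt_or_ge t (T + η1) with h1 | h1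
    · exact hafter t ⟨ht.1, h1⟩ r hr h
    · exact absurd (hleast ⟨⟨by linarith, by linarith [ht.2]⟩, r, hr, h.symm⟩) (not_le.2 ht.2)
  -- it is not the end point `c`
  have hr0c : c < r0 := by
    refine lt_of_le_of_ne hr0.1 fun h => ?_
    have h1 : U (t0 - T) = U 0 := hinj T t0 hT.le ht0.le (by rw [hUT, hUt0, h])
    rw [h0] at h1
    rcases lt_trichotomy (t0 - T) T with h2 | h2 | h2
    · exact hfirst _ ⟨by linarith, h2⟩ x hx h1
    · rw [h2, hUT] at h1
      exact hcx.ne (by exact_mod_cast h1)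
    · exact hmin _ ⟨h2, by linarith⟩ x hx h1
  obtain ⟨η2, hη2, hs2⟩ := hsign t0 (by linarith) r0 hr0 hUt0
  obtain ⟨m, hcm, hmx, hmr⟩ : ∃ m, c < m ∧ m < x ∧ m < r0 := by
    obtain ⟨m, h1, h2⟩ := exists_between (lt_min hcx hr0c)
    exact ⟨m, h1, h2.trans_le (min_le_left _ _), h2.trans_le (min_le_right _ _)⟩
  -- the winding integral of the closed curve
  set A : ℂ → ℂ := fun z => ∫ t in (0 : ℝ)..T, U' t / (U t - z) with hA
  set S : ℂ → ℂ := fun z => ∫ r in c..x, (1 : ℂ) / ((r : ℂ) - z) with hSdef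
  have hderiv : ∀ z : ℂ, (∀ t ∈ Icc 0 T, U t ≠ z) → (∀ r ∈ Icc c x, (r : ℂ) ≠ z) →
      HasDerivAt (fun z => A z + S z) 0 z := by
    intro z h1 h2
    have h3 := hasDerivAt_integral_deriv_div_sub hU hU' hT.le h1
    have h4 := hasDerivAt_integral_deriv_div_sub (γ := fun r : ℝ => (r : ℂ)) (γ' := fun _ => 1)
      (fun r => Complex.ofRealCLM.hasDerivAt) continuous_const hcx.le h2
    refine (h3.add h4).congr_deriv ?_
    rw [h0, hUT]
    ring
  have hconst : ∀ K : Set ℂ, Convex ℝ K → (∀ z ∈ K, ∀ t ∈ Icc 0 T, U t ≠ z) →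
      (∀ z ∈ K, ∀ r ∈ Icc c x, (r : ℂ) ≠ z) → ∀ z ∈ K, ∀ w ∈ K, A z + S z = A w + S w := by
    intro K hK h1 h2 z hz w hw
    have := hK.norm_image_sub_le_of_norm_hasDerivWithin_le (f := fun z => A z + S z)
      (f' := fun _ => 0) (C := 0) (fun z hz => (hderiv z (h1 z hz) (h2 z hz)).hasDerivWithinAt)
      (fun _ _ => by simp) hw hz
    rw [zero_mul] at this
    exact sub_eq_zero.1 (norm_le_zero_iff.1 this)
  -- a strip above the left part of the segment
  have habove : ∃ ε > 0, ∀ z : ℂ, 0 < z.im → z.im < ε → c - ε < z.re → z.re ≤ m →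
      ∀ t ∈ Icc 0 T, U t ≠ z := by
    have hdis : Disjoint (U '' Icc 0 (T - η1 / 2)) ((fun r : ℝ => (r : ℂ)) '' Icc c m) := by
      rw [disjoint_left]
      rintro _ ⟨t, ht, rfl⟩ ⟨r, hr, h⟩
      have hr' : r ∈ Icc c d := ⟨hr.1, by linarith [hr.2]⟩
      rcases ht.1.eq_or_lt with h1 | h1
      · rw [← h1, h0] at h
        have : r = x := Complex.ofReal_injective h
        linarith [hr.2]
      · exact hfirst t ⟨h1, by linarith [ht.2]⟩ r hr' h.symm
    obtain ⟨δ, hδ, hd⟩ := hdis.exists_thickenings (isCompact_Icc.image hUc)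
      (isCompact_Icc.image Complex.continuous_ofReal).isClosed
    refine ⟨δ / 2, by positivity, fun z hz1 hz2 hz3 hz4 t ht h => ?_⟩
    rcases le_or_gt t (T - η1 / 2) with h1 | h1
    · refine hd.ne_of_mem
        (Metric.self_subset_thickening hδ _ (h ▸ mem_image_of_mem U ⟨ht.1, h1⟩)) (?_ : z ∈ _) rfl
      rw [Metric.mem_thickening_iff]
      refine ⟨(max c z.re : ℝ), ⟨_, ⟨le_max_left _ _, max_le hcm.le hz4⟩, rfl⟩, ?_⟩
      rw [dist_eq_norm]
      refine (Complex.norm_le_abs_re_add_abs_im _).trans_lt ?_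
      have h2 : |(z - (max c z.re : ℝ)).re| < δ / 2 := by
        simp only [Complex.sub_re, Complex.ofReal_re]
        rcases le_total c z.re with h3 | h3
        · rw [max_eq_right h3]; simpa using by positivity
        · rw [max_eq_left h3, abs_lt]; constructor <;> linarith
      have h3 : |(z - (max c z.re : ℝ)).im| < δ / 2 := by
        simp only [Complex.sub_im, Complex.ofReal_im, sub_zero]
        rw [abs_of_pos hz1]; exact hz2
      linarith
    · rcases ht.2.eq_or_lt with h2 | h2
      · rw [h2, hUT] at h
        rw [← h] at hz1
        simp at hz1
      · have := (hs1 t ⟨by linarith, by linarith⟩).2 h2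
        rw [h] at this
        linarith
  -- a strip below the right part of the segment
  have hbelow : ∃ ε > 0, ∀ z : ℂ, z.im < 0 → -ε < z.im → m ≤ z.re → z.re < d + ε →
      ∀ t ∈ Icc 0 T, U t ≠ z := by
    have hdis : Disjoint (U '' Icc (η0 / 2) T) ((fun r : ℝ => (r : ℂ)) '' Icc m d) := by
      rw [disjoint_left]
      rintro _ ⟨t, ht, rfl⟩ ⟨r, hr, h⟩
      have hr' : r ∈ Icc c d := ⟨by linarith [hr.1], hr.2⟩
      rcases ht.2.eq_or_lt with h1 | h1
      · rw [h1, hUT] at h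
        have : r = c := Complex.ofReal_injective h
        linarith [hr.1]
      · exact hfirst t ⟨by linarith [ht.1], h1⟩ r hr' h.symm
    obtain ⟨δ, hδ, hd⟩ := hdis.exists_thickenings (isCompact_Icc.image hUc)
      (isCompact_Icc.image Complex.continuous_ofReal).isClosed
    refine ⟨δ / 2, by positivity, fun z hz1 hz2 hz3 hz4 t ht h => ?_⟩
    rcases le_or_gt (η0 / 2) t with h1 | h1
    · refine hd.ne_of_mem
        (Metric.self_subset_thickening hδ _ (h ▸ mem_image_of_mem U ⟨h1, ht.2⟩)) (?_ : z ∈ _) rfl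
      rw [Metric.mem_thickening_iff]
      refine ⟨(min d z.re : ℝ), ⟨_, ⟨le_min (by linarith) hz3, min_le_left _ _⟩, rfl⟩, ?_⟩
      rw [dist_eq_norm]
      refine (Complex.norm_le_abs_re_add_abs_im _).trans_lt ?_
      have h2 : |(z - (min d z.re : ℝ)).re| < δ / 2 := by
        simp only [Complex.sub_re, Complex.ofReal_re]
        rcases le_total d z.re with h3 | h3
        · rw [min_eq_left h3, abs_lt]; constructor <;> linarith
        · rw [min_eq_right h3]; simpa using by positivity
      have h3 : |(z - (min d z.re : ℝ)).im| < δ / 2 := by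
        simp only [Complex.sub_im, Complex.ofReal_im, sub_zero]
        rw [abs_of_neg hz1]; linarith
      linarith
    · rcases ht.1.eq_or_lt with h2 | h2
      · rw [← h2, h0] at h
        rw [← h] at hz1
        simp at hz1
      · have := (hs0 t ⟨by linarith, by linarith⟩).1 h2
        rw [h] at this
        linarith
  obtain ⟨ε1, hε1, hK1⟩ := habove
  obtain ⟨ε2, hε2, hK2⟩ := hbelow
  -- the integral is constant along the continuation of the arc, up to the time `t0`
  have hoff : ∀ t ∈ Ioo T t0, (∀ s ∈ Icc 0 T, U s ≠ U t) ∧ (∀ r ∈ Icc c x, (r : ℂ) ≠ U t) := by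
    intro t ht
    refine ⟨fun s hs h => ?_, fun r hr h => hmin t ht r ⟨hr.1, hr.2.trans hxd⟩ h.symm⟩
    have h1 := hinj s t hs.1 (hs.2.trans ht.1.le) h
    rw [h0] at h1
    have h2 : 0 < t - s := by linarith [hs.2, ht.1]
    rcases lt_trichotomy (t - s) T with h3 | h3 | h3
    · exact hfirst _ ⟨h2, h3⟩ x hx h1
    · rw [h3, hUT] at h1
      exact hcx.ne (by exact_mod_cast h1)
    · exact hmin _ ⟨h3, by linarith [hs.1, ht.2]⟩ x hx h1
  have hpath : ∀ s ∈ Ioo T t0, ∀ t ∈ Ioo T t0, A (U s) + S (U s) = A (U t) + S (U t) := by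
    intro s hs t ht
    have := (convex_Ioo T t0).norm_image_sub_le_of_norm_hasDerivWithin_le
      (f := fun t => A (U t) + S (U t)) (f' := fun _ => 0) (C := 0)
      (fun t ht => by
        have h1 := (hderiv (U t) (hoff t ht).1 (hoff t ht).2).comp t (hU t)
        rw [zero_mul] at h1
        exact h1.hasDerivWithinAt)
      (fun _ _ => by simp) ht hs
    rw [zero_mul] at this
    exact sub_eq_zero.1 (norm_le_zero_iff.1 this)
  -- the path enters both strips
  obtain ⟨s1, hs1m, hs1im, hs1im', hs1re, hs1re'⟩ : ∃ s ∈ Ioo T t0, 0 < (U s).im ∧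
      (U s).im < ε1 ∧ c - ε1 < (U s).re ∧ (U s).re ≤ m := by
    have h1 : ∀ᶠ s in 𝓝 T, (U s).im < ε1 ∧ c - ε1 < (U s).re ∧ (U s).re < m := by
      have hi : Tendsto (fun s => (U s).im) (𝓝 T) (𝓝 0) :=
        (Complex.continuous_im.comp hUc).tendsto' T 0 (by simp [hUT])
      have hr : Tendsto (fun s => (U s).re) (𝓝 T) (𝓝 c) :=
        (Complex.continuous_re.comp hUc).tendsto' T c (by simp [hUT])
      filter_upwards [hi.eventually (gt_mem_nhds hε1), hr.eventually (gt_mem_nhds hcm),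
        hr.eventually (lt_mem_nhds (show c - ε1 < c by linarith))] with s h1 h2 h3
      exact ⟨h1, h3, h2⟩
    obtain ⟨η, hη, h⟩ := Metric.eventually_nhds_iff.1 h1
    obtain ⟨s, hsT, hsmin⟩ := exists_between
      (show T < min t0 (min (T + η) (T + η1)) from lt_min ht0 (lt_min (by linarith) (by linarith)))
    obtain ⟨ha, hb, hc'⟩ := lt_min_iff.1 hsmin |>.imp_right lt_min_iff.1
    have h2 := h (show dist s T < η by rw [Real.dist_eq, abs_lt]; constructor <;> linarith)
    exact ⟨s, ⟨hsT, ha⟩, (hs1 s ⟨by linarith, hc'⟩).1 hsT, h2.1, h2.2.1, h2.2.2.le⟩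
  obtain ⟨s2, hs2m, hs2im, hs2im', hs2re, hs2re'⟩ : ∃ s ∈ Ioo T t0, (U s).im < 0 ∧
      -ε2 < (U s).im ∧ m ≤ (U s).re ∧ (U s).re < d + ε2 := by
    have h1 : ∀ᶠ s in 𝓝 t0, -ε2 < (U s).im ∧ m < (U s).re ∧ (U s).re < d + ε2 := by
      have hi : Tendsto (fun s => (U s).im) (𝓝 t0) (𝓝 0) :=
        (Complex.continuous_im.comp hUc).tendsto' t0 0 (by simp [hUt0])
      have hr : Tendsto (fun s => (U s).re) (𝓝 t0) (𝓝 r0) :=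
        (Complex.continuous_re.comp hUc).tendsto' t0 r0 (by simp [hUt0])
      filter_upwards [hi.eventually (lt_mem_nhds (show -ε2 < 0 by linarith)),
        hr.eventually (lt_mem_nhds hmr),
        hr.eventually (gt_mem_nhds (show r0 < d + ε2 by linarith [hr0.2]))] with s h1 h2 h3
      exact ⟨h1, h2, h3⟩
    obtain ⟨η, hη, h⟩ := Metric.eventually_nhds_iff.1 h1
    obtain ⟨s, hsmax, hst⟩ := exists_between
      (show max T (max (t0 - η) (t0 - η2)) < t0 from
        max_lt ht0 (max_lt (by linarith) (by linarith)))
    obtain ⟨ha, hb, hc'⟩ := max_lt_iff.1 hsmax |>.imp_right max_lt_iff.1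
    have h2 := h (show dist s t0 < η by rw [Real.dist_eq, abs_lt]; constructor <;> linarith)
    exact ⟨s, ⟨ha, hst⟩, (hs2 s ⟨hc', by linarith⟩).2 hst, h2.1, h2.2.1.le, h2.2.2⟩
  -- hence it takes the same values just above and just below the point `m`
  have hequal : ∀ s, 0 < s → s < ε1 → s < ε2 →
      A (m + s * Complex.I) + S (m + s * Complex.I)
        = A (m - s * Complex.I) + S (m - s * Complex.I) := by
    intro s hs hs1 hs2
    have hup := hconst {z : ℂ | 0 < z.im ∧ z.im < ε1 ∧ c - ε1 < z.re ∧ z.re ≤ m}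
      ((convex_halfSpace_im_gt 0).inter ((convex_halfSpace_im_lt ε1).inter
        ((convex_halfSpace_re_gt (c - ε1)).inter (convex_halfSpace_re_le m))))
      (fun z hz => hK1 z hz.1 hz.2.1 hz.2.2.1 hz.2.2.2)
      (fun z hz r _ h => by have := hz.1; rw [← h] at this; simp at this)
      (U s1) ⟨hs1im, hs1im', hs1re, hs1re'⟩ (m + s * Complex.I)
      ⟨by simpa using hs, by simpa using hs1, by simp; linarith, by simp⟩
    have hdown := hconst {z : ℂ | z.im < 0 ∧ -ε2 < z.im ∧ m ≤ z.re ∧ z.re < d + ε2}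
      ((convex_halfSpace_im_lt 0).inter ((convex_halfSpace_im_gt (-ε2)).inter
        ((convex_halfSpace_re_ge m).inter (convex_halfSpace_re_lt (d + ε2)))))
      (fun z hz => hK2 z hz.1 hz.2.1 hz.2.2.1 hz.2.2.2)
      (fun z hz r _ h => by have := hz.1; rw [← h] at this; simp at this)
      (U s2) ⟨hs2im, hs2im', hs2re, hs2re'⟩ (m - s * Complex.I)
      ⟨by simpa using hs, by simpa using hs2, by simp, by simp; linarith⟩
    rw [← hup, ← hdown]
    exact hpath s1 hs1m s2 hs2m
  -- which contradicts the jump of the integral over the segment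
  have hAc : ContinuousAt A m := by
    refine (hasDerivAt_integral_deriv_div_sub hU hU' hT.le fun t ht h => ?_).continuousAt
    have hm' : m ∈ Icc c d := ⟨hcm.le, by linarith⟩
    rcases ht.1.eq_or_lt with h1 | h1
    · rw [← h1, h0] at h
      exact hmx.ne' (by exact_mod_cast h)
    · rcases ht.2.eq_or_lt with h2 | h2
      · rw [h2, hUT] at h
        exact hcm.ne (by exact_mod_cast h)
      · exact hfirst t ⟨h1, h2⟩ m hm' h
  have hlim : Tendsto (fun s : ℝ => A (m + s * Complex.I) - A (m - s * Complex.I)) (𝓝 0) (𝓝 0) := by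
    have h1 : Tendsto (fun s : ℝ => (m : ℂ) + s * Complex.I) (𝓝 0) (𝓝 (m : ℂ)) := by
      have : Continuous (fun s : ℝ => (m : ℂ) + s * Complex.I) := by fun_prop
      simpa using this.tendsto 0
    have h2 : Tendsto (fun s : ℝ => (m : ℂ) - s * Complex.I) (𝓝 0) (𝓝 (m : ℂ)) := by
      have : Continuous (fun s : ℝ => (m : ℂ) - s * Complex.I) := by fun_prop
      simpa using this.tendsto 0
    simpa using (hAc.tendsto.comp h1).sub (hAc.tendsto.comp h2)
  obtain ⟨η, hη, hsmall⟩ := Metric.tendsto_nhds_nhds.1 hlim Real.pi Real.pi_pos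
  obtain ⟨s, hs, hsmin⟩ := exists_between
    (show 0 < min η (min (min ε1 ε2) (min (m - c) (x - m))) from
      lt_min hη (lt_min (lt_min hε1 hε2) (lt_min (by linarith) (by linarith))))
  simp only [lt_min_iff] at hsmin
  obtain ⟨ha, ⟨hb, hb'⟩, hc1, hc2⟩ := hsmin
  have h1 := integral_inv_sub_jump hs hc1.le hc2.le
  have h2 := hequal s hs hb hb'
  have h3 := hsmall (show dist s 0 < η by rw [Real.dist_eq, sub_zero, abs_of_pos hs]; exact ha)
  rw [dist_zero_right] at h3
  have h4 : S (m + s * Complex.I) - S (m - s * Complex.I)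
      = -(A (m + s * Complex.I) - A (m - s * Complex.I)) := by linear_combination h2
  have h5 := (le_abs_self _).trans
    (Complex.abs_im_le_norm (S (m + s * Complex.I) - S (m - s * Complex.I)))
  rw [h4, norm_neg, ← h4] at h5
  exact absurd (h1.trans h5) (not_le.2 h3)

/-! ### Flows of vector fields -/

section Flow

variable {E : Type*} [NormedAddCommGroup E] [NormedSpace ℝ E]

theorem exists_solution_of_lipschitz_of_bounded [CompleteSpace E] {v : ℝ → E → E} {K L : NNReal}
    (hK : ∀ t, LipschitzWith K (v t)) (hc : ∀ x, Continuous fun t => v t x)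
    (hL : ∀ t x, ‖v t x‖ ≤ L) (x₀ : E) :
    ∃ u : ℝ → E, u 0 = x₀ ∧ ∀ t, HasDerivAt u (v t (u t)) t := by
  have hex : ∀ n : ℕ, ∃ u : ℝ → E, u 0 = x₀ ∧
      ∀ t ∈ Ioo (-((n : ℝ) + 1)) ((n : ℝ) + 1), HasDerivAt u (v t (u t)) t := by
    intro n
    have hmem : (0 : ℝ) ∈ Icc (-((n : ℝ) + 1)) ((n : ℝ) + 1) := by
      constructor <;> linarith [(Nat.cast_nonneg n : (0 : ℝ) ≤ n)]
    have hP : IsPicardLindelof v (⟨0, hmem⟩ : Icc (-((n : ℝ) + 1)) ((n : ℝ) + 1)) x₀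
        (L * ((n : NNReal) + 1)) 0 L K :=
      { lipschitzOnWith := fun t _ => (hK t).lipschitzOnWith
        continuousOn := fun x _ => (hc x).continuousOn
        norm_le := fun t _ x _ => hL t x
        mul_max_le := by simp }
    obtain ⟨u, hu0, hu⟩ := hP.exists_eq_forall_mem_Icc_hasDerivWithinAt₀
    exact ⟨u, hu0, fun t ht => (hu t (Ioo_subset_Icc_self ht)).hasDerivAt (Icc_mem_nhds ht.1 ht.2)⟩
  choose u hu0 hu using hex
  have hagree : ∀ m n : ℕ, m ≤ n → EqOn (u m) (u n) (Ioo (-((m : ℝ) + 1)) ((m : ℝ) + 1)) := by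
    intro m n hmn
    have hmn' : (m : ℝ) ≤ n := by exact_mod_cast hmn
    have hm : (0 : ℝ) ≤ m := Nat.cast_nonneg m
    refine ODE_solution_unique_of_mem_Ioo (v := v) (K := K) (s := fun _ => univ) (t₀ := 0)
      (fun t _ => (hK t).lipschitzOnWith) ⟨by linarith, by linarith⟩
      (fun t ht => ⟨hu m t ht, mem_univ _⟩)
      (fun t ht => ⟨hu n t ⟨by linarith [ht.1], by linarith [ht.2]⟩, mem_univ _⟩) ?_
    rw [hu0, hu0]
  refine ⟨fun t => u ⌈|t|⌉₊ t, by simp [hu0], fun t => ?_⟩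
  have hnear : (fun s => u ⌈|s|⌉₊ s) =ᶠ[𝓝 t] u (⌈|t|⌉₊ + 1) := by
    have h1 : ∀ᶠ s in 𝓝 t, |s| < |t| + 1 :=
      (continuous_abs.tendsto t).eventually (gt_mem_nhds (by linarith))
    filter_upwards [h1] with s hs
    refine hagree _ _ ?_ ?_
    · refine Nat.ceil_le.2 ?_
      push_cast
      linarith [Nat.le_ceil |t|]
    · have := abs_le.1 (Nat.le_ceil |s|)
      constructor <;> linarith [this.1, this.2]
  have h2 : t ∈ Ioo (-(((⌈|t|⌉₊ + 1 : ℕ) : ℝ) + 1)) (((⌈|t|⌉₊ + 1 : ℕ) : ℝ) + 1) := by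
    have := abs_le.1 (Nat.le_ceil |t|)
    push_cast
    constructor <;> linarith [this.1, this.2]
  have h3 := (hu (⌈|t|⌉₊ + 1) t h2).congr_of_eventuallyEq hnear
  rwa [← hnear.eq_of_nhds] at h3

/-- Linear equations are solvable on every bounded interval: cutting the right hand side off outside
a large ball makes it bounded, and by Grönwall's inequality the solution stays in the ball. -/
theorem exists_linear_solution {F : Type*} [NormedAddCommGroup F] [NormedSpace ℝ F]
    [FiniteDimensional ℝ F] {A : ℝ → F →L[ℝ] F} (hA : Continuous A) {L : NNReal}
    (hL : ∀ t, ‖A t‖ ≤ L) (T : ℝ) (y₀ : F) :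
    ∃ y : ℝ → F, y 0 = y₀ ∧ ∀ t ∈ Icc 0 T, HasDerivAt y (A t (y t)) t := by
  have : CompleteSpace F := FiniteDimensional.complete ℝ F
  set R : ℝ := ‖y₀‖ * Real.exp (L * |T|) + 1 with hR
  have hR0 : 0 < R := by positivity
  let χ : ContDiffBump (0 : F) := ⟨R, R + 1, hR0, by linarith⟩
  set ρ : F → F := fun y => χ y • y with hρ
  have hρsupp : HasCompactSupport ρ := χ.hasCompactSupport.smul_right
  have hρsm : ContDiff ℝ 1 ρ := χ.contDiff.smul contDiff_id
  obtain ⟨C, hC⟩ := hρsm.lipschitzWith_of_hasCompactSupport hρsupp one_ne_zero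
  have hρle : ∀ y, ‖ρ y‖ ≤ ‖y‖ := fun y => by
    rw [hρ]
    simp only [norm_smul, Real.norm_eq_abs, abs_of_nonneg χ.nonneg]
    exact mul_le_of_le_one_left (norm_nonneg _) χ.le_one
  obtain ⟨B, hB⟩ := hρsupp.exists_bound_of_continuous hρsm.continuous
  have hB0 : 0 ≤ B := (norm_nonneg _).trans (hB 0)
  obtain ⟨y, hy0, hy⟩ := exists_solution_of_lipschitz_of_bounded (v := fun t y => A t (ρ y))
    (K := L * C) (L := L * B.toNNReal)
    (fun t => ((A t).lipschitz.weaken (show ‖A t‖₊ ≤ L from hL t)).comp hC)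
    (fun x => by fun_prop)
    (fun t x => ((A t).le_opNorm _).trans (by
      rw [NNReal.coe_mul, Real.coe_toNNReal B hB0]
      exact mul_le_mul (hL t) (hB x) (norm_nonneg _) L.2)) y₀
  refine ⟨y, hy0, fun t ht => ?_⟩
  have hyc : Continuous y := continuous_iff_continuousAt.2 fun t => (hy t).continuousAt
  have h1 := norm_le_gronwallBound_of_norm_deriv_right_le (f := y)
    (f' := fun t => A t (ρ (y t))) (δ := ‖y₀‖) (K := L) (ε := 0) (a := 0) (b := T) hyc.continuousOn
    (fun t _ => (hy t).hasDerivWithinAt) (by rw [hy0]) (fun t _ => by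
      rw [add_zero]
      exact ((A t).le_opNorm _).trans (mul_le_mul (hL t) (hρle _) (norm_nonneg _) L.2)) t ht
  rw [gronwallBound_ε0, sub_zero] at h1
  have h2 : y t ∈ Metric.closedBall (0 : F) χ.rIn := by
    rw [mem_closedBall_zero_iff]
    have h3 : Real.exp (L * t) ≤ Real.exp (L * |T|) :=
      Real.exp_le_exp.2 (mul_le_mul_of_nonneg_left (ht.2.trans (le_abs_self T)) L.2)
    have h4 := mul_le_mul_of_nonneg_left h3 (norm_nonneg y₀)
    exact (h1.trans h4).trans (show _ ≤ R by linarith)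
  have h3 := hy t
  simp only [hρ, χ.one_of_mem_closedBall h2, one_smul] at h3
  exact h3

/-- `Φ` is the flow of the vector field `g`. -/
structure IsFlow (g : E → E) (Φ : E → ℝ → E) : Prop where
  zero : ∀ x, Φ x 0 = x
  deriv : ∀ x t, HasDerivAt (Φ x) (g (Φ x t)) t

theorem exists_isFlow [CompleteSpace E] {g : E → E} {K L : NNReal} (hK : LipschitzWith K g)
    (hL : ∀ x, ‖g x‖ ≤ L) : ∃ Φ : E → ℝ → E, IsFlow g Φ := by
  have := fun x => exists_solution_of_lipschitz_of_bounded (v := fun _ => g) (fun _ => hK)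
    (fun _ => continuous_const) (fun _ => hL) x
  choose Φ h0 h1 using this
  exact ⟨Φ, h0, h1⟩

namespace IsFlow

variable {g : E → E} {Φ : E → ℝ → E} {K L : NNReal}

theorem reverse (h : IsFlow g Φ) : IsFlow (fun x => -g x) (fun x t => Φ x (-t)) where
  zero x := by simp [h.zero]
  deriv x t := by
    have : HasDerivAt (fun t => Φ x (-t)) _ t := (h.deriv x (-t)).scomp t (hasDerivAt_neg t)
    simpa using this

theorem continuous_time (h : IsFlow g Φ) (x : E) : Continuous (Φ x) :=
  continuous_iff_continuousAt.2 fun t => (h.deriv x t).continuousAt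

theorem eq_of_hasDerivAt (h : IsFlow g Φ) (hK : LipschitzWith K g) {u : ℝ → E}
    (hu : ∀ t, HasDerivAt u (g (u t)) t) : u = Φ (u 0) :=
  ODE_solution_unique_univ (v := fun _ => g) (s := fun _ => univ) (t₀ := 0) (K := K)
    (fun _ => hK.lipschitzOnWith) (fun t => ⟨hu t, mem_univ _⟩)
    (fun t => ⟨h.deriv _ t, mem_univ _⟩) (h.zero _).symm

theorem add (h : IsFlow g Φ) (hK : LipschitzWith K g) (x : E) (s t : ℝ) :
    Φ x (s + t) = Φ (Φ x s) t := by
  have h1 := h.eq_of_hasDerivAt hK (u := fun t => Φ x (s + t)) fun t =>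
    (h.deriv x (s + t)).comp_const_add s t
  have := congrFun h1 t
  simpa using this

/-- A solution that passes twice through the same point has been there before. -/
theorem eq_of_eq (h : IsFlow g Φ) (hK : LipschitzWith K g) {x : E} {s t : ℝ}
    (hst : Φ x s = Φ x t) : Φ x (t - s) = x := by
  rw [sub_eq_add_neg, h.add hK, ← hst, ← h.add hK, add_neg_cancel, h.zero]

theorem eqOn_of_hasDerivWithinAt (h : IsFlow g Φ) (hK : LipschitzWith K g) {u : ℝ → E}
    (hu : ∀ t, 0 ≤ t → HasDerivWithinAt u (g (u t)) (Ici 0) t) {t : ℝ} (ht : 0 ≤ t) :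
    u t = Φ (u 0) t :=
  ODE_solution_unique (v := fun _ => g) (a := 0) (b := t) (fun _ => hK)
    (fun s hs => (hu s hs.1).continuousWithinAt.mono Icc_subset_Ici_self)
    (fun s hs => (hu s hs.1).mono (Ici_subset_Ici.2 hs.1))
    (h.continuous_time _).continuousOn (fun s _ => (h.deriv _ s).hasDerivWithinAt)
    (h.zero _).symm ⟨ht, le_rfl⟩

theorem dist_le (h : IsFlow g Φ) (hK : LipschitzWith K g) (x y : E) {t : ℝ} (ht : 0 ≤ t) :
    dist (Φ x t) (Φ y t) ≤ dist x y * Real.exp (K * t) := by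
  have := dist_le_of_trajectories_ODE (v := fun _ => g) (a := 0) (b := t) (δ := dist x y)
    (fun _ => hK) (h.continuous_time x).continuousOn (fun s _ => (h.deriv x s).hasDerivWithinAt)
    (h.continuous_time y).continuousOn (fun s _ => (h.deriv y s).hasDerivWithinAt)
    (by rw [h.zero, h.zero]) t ⟨ht, le_rfl⟩
  rwa [sub_zero] at this

theorem lipschitzWith_time (h : IsFlow g Φ) (hL : ∀ x, ‖g x‖ ≤ L) (x : E) :
    LipschitzWith L (Φ x) :=
  lipschitzWith_of_nnnorm_deriv_le (fun t => (h.deriv x t).differentiableAt)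
    fun t => by rw [(h.deriv x t).deriv]; exact hL _

theorem continuous_uncurry (h : IsFlow g Φ) (hK : LipschitzWith K g) (hL : ∀ x, ‖g x‖ ≤ L) :
    Continuous fun z : E × ℝ => Φ z.1 z.2 := by
  have key : ∀ (g : E → E) (Φ : E → ℝ → E), LipschitzWith K g → IsFlow g Φ →
      ∀ t, 0 ≤ t → Continuous fun x => Φ x t := by
    intro g Φ hK h t ht
    refine (LipschitzWith.of_dist_le_mul (K := ⟨Real.exp (K * t), (Real.exp_pos _).le⟩)
      fun x y => ?_).continuous
    rw [mul_comm]
    exact h.dist_le hK x y ht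
  refine continuous_prod_of_continuous_lipschitzWith' (fun z : E × ℝ => Φ z.1 z.2) L
    (fun x => h.lipschitzWith_time hL x) fun t => ?_
  rcases le_total 0 t with ht | ht
  · exact key g Φ hK h t ht
  · have := key _ _ hK.neg h.reverse (-t) (by linarith)
    simpa using this

end IsFlow

end Flow

section Variation

variable {E : Type*} [NormedAddCommGroup E] [NormedSpace ℝ E]

/-- A map with a uniformly continuous derivative is differentiable uniformly. -/
theorem exists_uniform_linearization {F : Type*} [NormedAddCommGroup F] [NormedSpace ℝ F]
    {g : E → F} (hg : Differentiable ℝ g)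
    (hu : UniformContinuous (fderiv ℝ g)) {ε : ℝ} (hε : 0 < ε) :
    ∃ δ > 0, ∀ x w : E, ‖w - x‖ < δ → ‖g w - g x - fderiv ℝ g x (w - x)‖ ≤ ε * ‖w - x‖ := by
  obtain ⟨δ, hδ, h⟩ := Metric.uniformContinuous_iff.1 hu ε hε
  refine ⟨δ, hδ, fun x w hw => ?_⟩
  refine (convex_ball x δ).norm_image_sub_le_of_norm_fderiv_le' (𝕜 := ℝ) (f := g)
    (fun z _ => hg z) (fun z hz => ?_) (Metric.mem_ball_self hδ) ?_
  · have := h (show dist z x < δ from hz)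
    rw [dist_eq_norm] at this
    exact this.le
  · rw [Metric.mem_ball, dist_eq_norm]; exact hw

/-- The solution of the variational equation along a trajectory is the derivative of the flow with
respect to the initial point. -/
theorem IsFlow.exists_hasFDerivAt [FiniteDimensional ℝ E] {g : E → E} {Φ : E → ℝ → E} {K : NNReal}
    (h : IsFlow g Φ) (hK : LipschitzWith K g) (hK0 : 0 < K) (hg : ContDiff ℝ 1 g)
    (hu : UniformContinuous (fderiv ℝ g)) (x : E) (T : ℝ) :
    ∃ Y : ℝ → E →L[ℝ] E, Y 0 = ContinuousLinearMap.id ℝ E ∧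
      (∀ t ∈ Icc 0 T, HasDerivAt Y ((fderiv ℝ g (Φ x t)).comp (Y t)) t) ∧
      ∀ t ∈ Icc 0 T, HasFDerivAt (fun y => Φ y t) (Y t) x := by
  have hA : ∀ w, ‖fderiv ℝ g w‖ ≤ K := fun w => norm_fderiv_le_of_lipschitz ℝ hK
  have hAc : Continuous fun t => fderiv ℝ g (Φ x t) :=
    (hg.continuous_fderiv one_ne_zero).comp (h.continuous_time x)
  obtain ⟨Y, hY0, hY⟩ := exists_linear_solution (F := E →L[ℝ] E)
    (A := fun t => ContinuousLinearMap.compL ℝ E E E (fderiv ℝ g (Φ x t)))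
    (by fun_prop) (L := K) (fun t => by
      refine ContinuousLinearMap.opNorm_le_bound _ K.2 fun B => ?_
      exact (ContinuousLinearMap.opNorm_comp_le _ _).trans
        (mul_le_mul_of_nonneg_right (hA _) (norm_nonneg _))) T (ContinuousLinearMap.id ℝ E)
  refine ⟨Y, hY0, hY, fun τ hτ => ?_⟩
  have hYc : ContinuousOn Y (Icc 0 T) := fun t ht => (hY t ht).continuousAt.continuousWithinAt
  rw [hasFDerivAt_iff_isLittleO_nhds_zero, Asymptotics.isLittleO_iff]
  intro c hc
  set k : ℝ := (K : ℝ) with hk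
  have hk0 : 0 < k := hK0
  set G : ℝ := Real.exp (k * τ) * ((Real.exp (k * τ) - 1) / k) with hG
  have hG0 : 0 ≤ G := by
    have : 1 ≤ Real.exp (k * τ) := Real.one_le_exp (mul_nonneg hk0.le hτ.1)
    exact mul_nonneg (Real.exp_pos _).le (div_nonneg (by linarith) hk0.le)
  obtain ⟨δ, hδ, hlin⟩ := exists_uniform_linearization (hg.differentiable one_ne_zero) hu
    (ε := c / (G + 1)) (by positivity)
  have hnear : ∀ᶠ v : E in 𝓝 0, ‖v‖ * Real.exp (k * τ) < δ := by
    have : Tendsto (fun v : E => ‖v‖ * Real.exp (k * τ)) (𝓝 0) (𝓝 0) := by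
      have h1 : Continuous fun v : E => ‖v‖ * Real.exp (k * τ) := by fun_prop
      simpa using h1.tendsto 0
    exact this.eventually (gt_mem_nhds hδ)
  filter_upwards [hnear] with v hv
  have hdist : ∀ t ∈ Ico 0 τ, ‖Φ (x + v) t - Φ x t‖ ≤ ‖v‖ * Real.exp (k * τ) := by
    intro t ht
    have h1 := h.dist_le hK (x + v) x ht.1
    rw [dist_eq_norm, dist_eq_norm, add_sub_cancel_left] at h1
    refine h1.trans (mul_le_mul_of_nonneg_left ?_ (norm_nonneg _))
    exact Real.exp_le_exp.2 (mul_le_mul_of_nonneg_left ht.2.le hk0.le)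
  have key := dist_le_of_approx_trajectories_ODE
    (v := fun t w => fderiv ℝ g (Φ x t) w) (K := K) (a := 0) (b := τ)
    (f := fun t => Φ (x + v) t - Φ x t) (f' := fun t => g (Φ (x + v) t) - g (Φ x t))
    (g := fun t => Y t v) (g' := fun t => fderiv ℝ g (Φ x t) (Y t v))
    (εf := c / (G + 1) * (‖v‖ * Real.exp (k * τ))) (εg := 0) (δ := 0)
    (fun t => (fderiv ℝ g (Φ x t)).lipschitz.weaken (show ‖fderiv ℝ g (Φ x t)‖₊ ≤ K from hA _))
    ((h.continuous_time _).sub (h.continuous_time _)).continuousOn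
    (fun t _ => ((h.deriv _ t).sub (h.deriv _ t)).hasDerivWithinAt)
    (fun t ht => by
      rw [dist_eq_norm]
      refine (hlin _ _ ((hdist t ht).trans_lt hv)).trans ?_
      exact mul_le_mul_of_nonneg_left (hdist t ht) (by positivity))
    ((hYc.mono (Icc_subset_Icc_right hτ.2)).clm_apply continuousOn_const)
    (fun t ht => by
      have h1 := (hY t ⟨ht.1, ht.2.le.trans hτ.2⟩).clm_apply (hasDerivAt_const t v)
      simpa using h1.hasDerivWithinAt)
    (fun t _ => by rw [dist_self])
    (by simp [h.zero, hY0]) τ ⟨hτ.1, le_rfl⟩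
  rw [dist_eq_norm] at key
  refine key.trans ?_
  rw [gronwallBound_of_K_ne_0 hk0.ne']
  simp only [add_zero, sub_zero, zero_mul, zero_add]
  have h2 : c / (G + 1) * (‖v‖ * Real.exp (k * τ)) / k * (Real.exp (k * τ) - 1)
      = c * ‖v‖ * (G / (G + 1)) := by
    rw [hG]
    field_simp
  have h3 : G / (G + 1) ≤ 1 := (div_le_one (by positivity)).2 (by linarith)
  calc _ = c * ‖v‖ * (G / (G + 1)) := h2
    _ ≤ c * ‖v‖ := mul_le_of_le_one_right (by positivity) h3

/-- The flow is differentiable in time and initial point jointly. -/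
theorem IsFlow.hasFDerivAt_uncurry {g : E → E} {Φ : E → ℝ → E} (h : IsFlow g Φ)
    (hg : Continuous g) (hΦ : Continuous fun z : E × ℝ => Φ z.1 z.2) {x : E} {τ : ℝ}
    {Y : E →L[ℝ] E} (hY : HasFDerivAt (fun y => Φ y τ) Y x) :
    HasFDerivAt (fun z : E × ℝ => Φ z.1 z.2)
      (Y.comp (ContinuousLinearMap.fst ℝ E ℝ)
        + (ContinuousLinearMap.snd ℝ E ℝ).smulRight (g (Φ x τ))) (x, τ) := by
  have h1 : HasFDerivAt (fun z : E × ℝ => Φ z.1 τ) (Y.comp (ContinuousLinearMap.fst ℝ E ℝ))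
      (x, τ) :=
    HasFDerivAt.comp (f := Prod.fst) (g := fun y => Φ y τ) (x, τ) hY hasFDerivAt_fst
  have h2 : HasFDerivAt (fun z : E × ℝ => Φ z.1 z.2 - Φ z.1 τ)
      ((ContinuousLinearMap.snd ℝ E ℝ).smulRight (g (Φ x τ))) (x, τ) := by
    rw [hasFDerivAt_iff_isLittleO, Asymptotics.isLittleO_iff]
    intro c hc
    have hcont : ContinuousAt (fun z : E × ℝ => ‖g (Φ z.1 z.2) - g (Φ x τ)‖) (x, τ) := by
      have : Continuous fun z : E × ℝ => ‖g (Φ z.1 z.2) - g (Φ x τ)‖ := by fun_prop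
      exact this.continuousAt
    have hev : ∀ᶠ z : E × ℝ in 𝓝 (x, τ), ‖g (Φ z.1 z.2) - g (Φ x τ)‖ < c :=
      hcont.eventually (gt_mem_nhds (by simpa using hc))
    obtain ⟨δ, hδ, hball⟩ := Metric.eventually_nhds_iff_ball.1 hev
    filter_upwards [Metric.ball_mem_nhds (x, τ) hδ] with z hz
    rw [← ball_prod_same] at hz
    have hmv := (convex_ball τ δ).norm_image_sub_le_of_norm_hasDerivWithin_le
      (f := fun t => Φ z.1 t - t • g (Φ x τ)) (f' := fun t => g (Φ z.1 t) - g (Φ x τ)) (C := c)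
      (fun t _ => by
        have h3 : HasDerivAt (fun t => Φ z.1 t - t • g (Φ x τ)) _ t :=
          (h.deriv z.1 t).sub ((hasDerivAt_id t).smul_const (g (Φ x τ)))
        simpa using h3.hasDerivWithinAt)
      (fun t ht => (hball (z.1, t) (by rw [← ball_prod_same]; exact ⟨hz.1, ht⟩)).le)
      (Metric.mem_ball_self hδ) hz.2
    have h4 : ‖z.2 - τ‖ ≤ ‖z - (x, τ)‖ := norm_snd_le (z - (x, τ))
    refine le_trans (le_of_eq ?_) (hmv.trans (mul_le_mul_of_nonneg_left h4 hc.le))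
    congr 1
    simp [sub_smul]
    abel
  refine (h1.add h2).congr_of_eventuallyEq (Eventually.of_forall fun z => ?_)
  simp

end Variation

/-! ### The plane -/

/-- The determinant of the matrix with columns `a` and `b`. -/
def wedge (a b : Plane) : ℝ := a 0 * b 1 - a 1 * b 0

section Wedge

variable (a b c : Plane) (r : ℝ)

theorem wedge_add_left : wedge (a + b) c = wedge a c + wedge b c := by simp [wedge]; ring
theorem wedge_add_right : wedge a (b + c) = wedge a b + wedge a c := by simp [wedge]; ring
theorem wedge_sub_left : wedge (a - b) c = wedge a c - wedge b c := by simp [wedge]; ring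
theorem wedge_sub_right : wedge a (b - c) = wedge a b - wedge a c := by simp [wedge]; ring
theorem wedge_smul_left : wedge (r • a) b = r * wedge a b := by simp [wedge]; ring
theorem wedge_smul_right : wedge a (r • b) = r * wedge a b := by simp [wedge]; ring
theorem wedge_self : wedge a a = 0 := by simp [wedge]; ring
theorem wedge_neg_left : wedge (-a) b = -wedge a b := by simp [wedge]; ring
theorem wedge_comm : wedge a b = -wedge b a := by simp [wedge]; ring

theorem abs_wedge_le : |wedge a b| ≤ ‖a‖ * ‖b‖ := by
  rw [← sq_le_sq₀ (abs_nonneg _) (by positivity), sq_abs, mul_pow, EuclideanSpace.norm_sq_eq,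
    EuclideanSpace.norm_sq_eq]
  simp only [Fin.sum_univ_two, Real.norm_eq_abs, sq_abs, wedge]
  nlinarith [sq_nonneg (a 0 * b 0 + a 1 * b 1)]

/-- Cramer's rule. -/
theorem wedge_smul_eq : wedge a b • c = wedge c b • a + wedge a c • b := by
  ext i; fin_cases i <;> simp [wedge] <;> ring

@[fun_prop]
theorem Continuous.wedge {X : Type*} [TopologicalSpace X] {f g : X → Plane} (hf : Continuous f)
    (hg : Continuous g) : Continuous fun x => wedge (f x) (g x) := by
  unfold _root_.wedge; fun_prop

theorem linearIndependent_iff_wedge_ne_zero :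
    LinearIndependent ℝ ![a, b] ↔ wedge a b ≠ 0 := by
  rw [LinearIndependent.pair_iff]
  constructor
  · intro h h0
    have h1 := h (b 0) (-(a 0)) (by
      ext i; fin_cases i
      · simp; ring
      · simp; simp [wedge] at h0; linarith)
    have h2 := h (b 1) (-(a 1)) (by
      ext i; fin_cases i
      · simp; simp [wedge] at h0; linarith
      · simp; ring)
    have h3 := h 1 0 (by
      ext i; fin_cases i
      · simp; linarith [h1.2]
      · simp; linarith [h2.2])
    exact one_ne_zero h3.1
  · intro h s t hst
    have h1 : wedge (s • a + t • b) b = 0 := by rw [hst]; simp [wedge]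
    have h2 : wedge a (s • a + t • b) = 0 := by rw [hst]; simp [wedge]
    rw [wedge_add_left, wedge_smul_left, wedge_smul_left, wedge_self, mul_zero, add_zero] at h1
    rw [wedge_add_right, wedge_smul_right, wedge_smul_right, wedge_self, mul_zero, zero_add] at h2
    exact ⟨(mul_eq_zero.1 h1).resolve_right h, (mul_eq_zero.1 h2).resolve_right h⟩

end Wedge

theorem HasDerivAt.coord {u : ℝ → Plane} {u' : Plane} {t : ℝ} (hu : HasDerivAt u u' t)
    (i : Fin 2) : HasDerivAt (fun t => u t i) (u' i) t :=
  (EuclideanSpace.proj (𝕜 := ℝ) i).hasFDerivAt.comp_hasDerivAt t hu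

theorem HasDerivAt.wedge_right {u : ℝ → Plane} {u' : Plane} {t : ℝ} (a : Plane)
    (hu : HasDerivAt u u' t) : HasDerivAt (fun t => wedge a (u t)) (wedge a u') t := by
  exact ((hu.coord 1).const_mul (a 0)).sub ((hu.coord 0).const_mul (a 1))

theorem HasDerivAt.wedge {u v : ℝ → Plane} {u' v' : Plane} {t : ℝ}
    (hu : HasDerivAt u u' t) (hv : HasDerivAt v v' t) :
    HasDerivAt (fun t => wedge (u t) (v t)) (wedge u' (v t) + wedge (u t) v') t := by
  refine (((hu.coord 0).mul (hv.coord 1)).sub ((hu.coord 1).mul (hv.coord 0))).congr_deriv ?_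
  simp only [_root_.wedge]
  ring

/-- The standard basis vectors of the plane. -/
abbrev stdVec (i : Fin 2) : Plane := EuclideanSpace.single i 1

/-- The trace of an endomorphism of the plane. -/
def tr (A : Plane →L[ℝ] Plane) : ℝ := A (stdVec 0) 0 + A (stdVec 1) 1

/-- The divergence of a vector field of the plane. -/
def divergence (f : Plane → Plane) (x : Plane) : ℝ := tr (fderiv ℝ f x)

theorem plane_eq_add (a : Plane) : a = a 0 • stdVec 0 + a 1 • stdVec 1 := by
  ext i; fin_cases i <;> simp

theorem wedge_apply_add (A : Plane →L[ℝ] Plane) (a b : Plane) :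
    wedge (A a) b + wedge a (A b) = tr A * wedge a b := by
  have ha : A a = a 0 • A (stdVec 0) + a 1 • A (stdVec 1) := by
    conv_lhs => rw [plane_eq_add a]
    rw [map_add, map_smul, map_smul]
  have hb : A b = b 0 • A (stdVec 0) + b 1 • A (stdVec 1) := by
    conv_lhs => rw [plane_eq_add b]
    rw [map_add, map_smul, map_smul]
  rw [ha, hb]
  simp [wedge, tr]
  ring

theorem continuous_tr : Continuous tr := by
  unfold tr
  have h : ∀ (w : Plane) (i : Fin 2), Continuous fun A : Plane →L[ℝ] Plane => A w i := by
    intro w i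
    exact (EuclideanSpace.proj (𝕜 := ℝ) i).continuous.comp (by fun_prop)
  exact (h _ _).add (h _ _)

/-- **Liouville's formula** for the variational equation. -/
theorem wedge_eq_exp_integral_mul {A : ℝ → Plane →L[ℝ] Plane} (hA : Continuous A)
    {Y : ℝ → Plane →L[ℝ] Plane} {T : ℝ} (hY0 : Y 0 = ContinuousLinearMap.id ℝ Plane)
    (hY : ∀ t ∈ Icc 0 T, HasDerivAt Y ((A t).comp (Y t)) t) (hT : 0 ≤ T) (a b : Plane) :
    wedge (Y T a) (Y T b) = Real.exp (∫ t in (0 : ℝ)..T, tr (A t)) * wedge a b := by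
  have hc : Continuous fun t => tr (A t) := continuous_tr.comp hA
  have hI : ∀ t, HasDerivAt (fun t => ∫ s in (0 : ℝ)..t, tr (A s)) (tr (A t)) t := fun t =>
    intervalIntegral.integral_hasDerivAt_right (hc.intervalIntegrable _ _)
      (hc.stronglyMeasurableAtFilter _ _) hc.continuousAt
  have hYa : ∀ (a : Plane), ∀ t ∈ Icc 0 T, HasDerivAt (fun t => Y t a) (A t (Y t a)) t := by
    intro a t ht
    simpa using (hY t ht).clm_apply (hasDerivAt_const t a)
  have hd : ∀ t ∈ Icc 0 T, HasDerivWithinAt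
      (fun t => wedge (Y t a) (Y t b) * Real.exp (-∫ s in (0 : ℝ)..t, tr (A s))) 0 (Icc 0 T) t := by
    intro t ht
    refine (((hYa a t ht).wedge (hYa b t ht)).mul ((hI t).neg.exp)).hasDerivWithinAt.congr_deriv ?_
    rw [wedge_apply_add]
    ring
  have hconst := (convex_Icc 0 T).norm_image_sub_le_of_norm_hasDerivWithin_le (C := 0) hd
    (fun _ _ => by simp) ⟨le_rfl, hT⟩ ⟨hT, le_rfl⟩
  rw [zero_mul] at hconst
  have h1 := sub_eq_zero.1 (norm_le_zero_iff.1 hconst)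
  simp only [hY0, intervalIntegral.integral_same, neg_zero, Real.exp_zero, mul_one,
    ContinuousLinearMap.id_apply] at h1
  rw [← h1, Real.exp_neg]
  field_simp

/-! ### The flow on the disk -/

theorem convex_unitDisk : Convex ℝ unitDisk := convex_closedBall 0 1

theorem mem_unitDisk {x : Plane} : x ∈ unitDisk ↔ ‖x‖ ≤ 1 := mem_closedBall_zero_iff

/-- `Φ` is the flow of a `C¹` field `g` that is bounded and Lipschitz on the whole plane and agrees
with `f` near the unit disk; the disk is forward invariant. -/
structure IsDiskFlow (f g : Plane → Plane) (Φ : Plane → ℝ → Plane) (K L : NNReal) : Prop where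
  flow : IsFlow g Φ
  contDiff : ContDiff ℝ 1 g
  lip : LipschitzWith K g
  pos : 0 < K
  bound : ∀ x, ‖g x‖ ≤ L
  unif : UniformContinuous (fderiv ℝ g)
  eq : ∀ x ∈ unitDisk, g x = f x
  fderiv_eq : ∀ x ∈ unitDisk, fderiv ℝ g x = fderiv ℝ f x
  mem : ∀ x ∈ unitDisk, ∀ t, 0 ≤ t → Φ x t ∈ unitDisk

/-- The field is multiplied by a bump function to make it bounded and Lipschitz. Trajectories do not
leave the disk, as `‖Φ x t‖ ^ 2` has a negative derivative on the boundary. -/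
theorem IsInwardC1Field.exists_isDiskFlow {f : Plane → Plane} (hf : IsInwardC1Field f) :
    ∃ (g : Plane → Plane) (Φ : Plane → ℝ → Plane) (K L : NNReal), IsDiskFlow f g Φ K L := by
  let χ : ContDiffBump (0 : Plane) := ⟨2, 3, by norm_num, by norm_num⟩
  set g : Plane → Plane := fun x => χ x • f x with hg
  have hsupp : HasCompactSupport g := χ.hasCompactSupport.smul_right
  have hsm : ContDiff ℝ 1 g := χ.contDiff.smul hf.1
  obtain ⟨C, hC⟩ := hsm.lipschitzWith_of_hasCompactSupport hsupp one_ne_zero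
  obtain ⟨B, hB⟩ := hsupp.exists_bound_of_continuous hsm.continuous
  have hB' : ∀ x, ‖g x‖ ≤ B.toNNReal := fun x => (hB x).trans (Real.le_coe_toNNReal B)
  obtain ⟨Φ, hΦ⟩ := exists_isFlow hC hB'
  have heq : ∀ x ∈ unitDisk, g =ᶠ[𝓝 x] f := by
    intro x hx
    have : x ∈ Metric.ball (0 : Plane) χ.rIn := by
      rw [mem_ball_zero_iff]
      exact (mem_unitDisk.1 hx).trans_lt (show (1 : ℝ) < 2 by norm_num)
    filter_upwards [χ.eventuallyEq_one_of_mem_ball this] with y hy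
    simp [hg, hy]
  refine ⟨g, Φ, C + 1, B.toNNReal, ⟨hΦ, hsm, hC.weaken (by simp), by positivity, hB', ?_,
    fun x hx => (heq x hx).eq_of_nhds, fun x hx => (heq x hx).fderiv_eq, ?_⟩⟩
  · exact (hsm.continuous_fderiv one_ne_zero).uniformContinuous_of_tendsto_cocompact
      (hsupp.fderiv ℝ).is_zero_at_infty
  · intro x hx t ht
    have h1 : ∀ s, HasDerivAt (fun s => ‖Φ x s‖ ^ 2) (2 * inner ℝ (Φ x s) (g (Φ x s))) s :=
      fun s => (hΦ.deriv x s).norm_sq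
    have h2 := image_le_of_deriv_right_lt_deriv_boundary (f := fun s => ‖Φ x s‖ ^ 2)
      (f' := fun s => 2 * inner ℝ (Φ x s) (g (Φ x s))) (a := 0) (b := t) (B := fun _ => 1)
      (B' := fun _ => 0)
      (fun s _ => (h1 s).continuousAt.continuousWithinAt) (fun s _ => (h1 s).hasDerivWithinAt)
      (by
        simp only [hΦ.zero]
        exact pow_le_one₀ (norm_nonneg _) (mem_unitDisk.1 hx))
      (fun s => hasDerivAt_const s 1)
      (fun s _ h => by
        have h3 : ‖Φ x s‖ = 1 := by
          rwa [pow_eq_one_iff_of_nonneg (norm_nonneg _) two_ne_zero] at h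
        have h4 := hf.2 _ h3
        rw [(heq (Φ x s) (mem_unitDisk.2 h3.le)).eq_of_nhds, real_inner_comm]
        linarith) ⟨ht, le_rfl⟩
    rw [mem_unitDisk]
    exact (pow_le_one_iff_of_nonneg (norm_nonneg _) two_ne_zero).1 h2

theorem exists_mem_segment_iff {p q z : Plane} :
    z ∈ segment ℝ p q ↔ ∃ s ∈ Icc (0 : ℝ) 1, z = p + s • (q - p) := by
  rw [segment_eq_image']
  exact ⟨fun ⟨s, hs, h⟩ => ⟨s, hs, h.symm⟩, fun ⟨s, hs, h⟩ => ⟨s, hs, h.symm⟩⟩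

/-- A point is on the line through `p` in the direction `v` as soon as its component transversal to
`v` vanishes. -/
theorem exists_eq_add_smul_of_wedge_eq_zero {p v z : Plane} (hv : v ≠ 0) (h : wedge v (z - p) = 0) :
    ∃ r : ℝ, z = p + r • v := by
  obtain ⟨n, hn⟩ : ∃ n, wedge v n ≠ 0 := by
    by_contra! hcon
    apply hv
    have h0 := hcon (stdVec 0)
    have h1 := hcon (stdVec 1)
    simp [wedge] at h0 h1
    ext i; fin_cases i
    · simpa using h1
    · simpa using h0
  refine ⟨wedge (z - p) n / wedge v n, ?_⟩
  have h1 := wedge_smul_eq v n (z - p)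
  rw [h, zero_smul, add_zero] at h1
  have h2 : z - p = (wedge (z - p) n / wedge v n) • v := by
    rw [div_eq_inv_mul, mul_smul, ← h1, smul_smul, inv_mul_cancel₀ hn, one_smul]
  rw [← h2]
  abel

theorem wedge_line (p v : Plane) (r : ℝ) : wedge v (p + r • v - p) = 0 := by
  rw [add_sub_cancel_left, wedge_smul_right, wedge_self, mul_zero]

namespace IsDiskFlow

variable {f g : Plane → Plane} {Φ : Plane → ℝ → Plane} {K L : NNReal}

theorem continuous_field (h : IsDiskFlow f g Φ K L) : Continuous g := h.contDiff.continuous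

theorem continuous_uncurry (h : IsDiskFlow f g Φ K L) :
    Continuous fun z : Plane × ℝ => Φ z.1 z.2 := h.flow.continuous_uncurry h.lip h.bound

theorem isForwardSolution (h : IsDiskFlow f g Φ K L) {x : Plane} (hx : x ∈ unitDisk) :
    IsForwardSolution f x (Φ x) := by
  refine ⟨h.flow.zero x, fun t ht => ⟨h.mem x hx t ht, ?_⟩⟩
  rw [← h.eq _ (h.mem x hx t ht)]
  exact (h.flow.deriv x t).hasDerivWithinAt

theorem eq_of_isForwardSolution (h : IsDiskFlow f g Φ K L) {x : Plane} {u : ℝ → Plane}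
    (hu : IsForwardSolution f x u) {t : ℝ} (ht : 0 ≤ t) : u t = Φ x t := by
  rw [← hu.1]
  refine h.flow.eqOn_of_hasDerivWithinAt h.lip (fun s hs => ?_) ht
  rw [h.eq _ (hu.2 s hs).1]
  exact (hu.2 s hs).2

theorem isFirstReturn_iff (h : IsDiskFlow f g Φ K L) {S : Set Plane} {x y : Plane} {τ : ℝ}
    (hx : x ∈ unitDisk) :
    IsFirstReturn f S x y τ ↔ 0 < τ ∧ y ∈ S ∧ Φ x τ = y ∧ ∀ s ∈ Ioo 0 τ, Φ x s ∉ S := by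
  constructor
  · rintro ⟨h1, h2, u, hu, h3, h4⟩
    refine ⟨h1, h2, ?_, fun s hs => ?_⟩
    · rw [← h.eq_of_isForwardSolution hu h1.le, h3]
    · rw [← h.eq_of_isForwardSolution hu hs.1.le]
      exact h4 s hs
  · rintro ⟨h1, h2, h3, h4⟩
    exact ⟨h1, h2, Φ x, h.isForwardSolution hx, h3, h4⟩

theorem hasDerivAt_wedge (h : IsDiskFlow f g Φ K L) (v p x : Plane) (t : ℝ) :
    HasDerivAt (fun t => wedge v (Φ x t - p)) (wedge v (g (Φ x t))) t :=
  ((h.flow.deriv x t).sub_const p).wedge_right v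

/-- No trajectory from a point of the segment can leave through the part of the line beyond the end
point `p`, nor through `p` itself if it starts elsewhere: it would be trapped in a region whose
points do not return to the segment. -/
theorem not_exit (h : IsDiskFlow f g Φ K L) {p q : Plane}
    (hret : ∀ x ∈ segment ℝ p q, ∃ τ > 0, Φ x τ ∈ segment ℝ p q)
    {σ l s T : ℝ} (hs : s ∈ Icc (0 : ℝ) 1) (hl : l ≤ 0) (hls : l < s) (hT : 0 < T)
    (hΦT : Φ (p + s • (q - p)) T = p + l • (q - p))
    (hfirst : ∀ t ∈ Ioo 0 T, Φ (p + s • (q - p)) t ∉ segment ℝ p q)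
    (htrans : ∀ r ∈ Icc l 1, 0 < σ * wedge (q - p) (g (p + r • (q - p)))) : False := by
  set v := q - p with hv
  set x := p + s • v with hx
  set n := g x with hn
  have hxS : x ∈ segment ℝ p q := exists_mem_segment_iff.2 ⟨s, hs, rfl⟩
  have hn0 : σ * wedge v n ≠ 0 := (htrans s ⟨hls.le, hs.2⟩).ne'
  have hσ : σ ≠ 0 := left_ne_zero_of_mul hn0
  have hvn : wedge v n ≠ 0 := right_ne_zero_of_mul hn0
  have hv0 : v ≠ 0 := by
    rintro h0
    rw [h0] at hvn
    simp [wedge] at hvn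
  -- coordinates in which the line is the real axis, crossed upwards
  set U : ℝ → ℂ := fun t => ((wedge n (Φ x t - p) / wedge n v : ℝ) : ℂ)
    + ((σ * wedge v (Φ x t - p) : ℝ) : ℂ) * Complex.I with hU
  set U' : ℝ → ℂ := fun t => ((wedge n (g (Φ x t)) / wedge n v : ℝ) : ℂ)
    + ((σ * wedge v (g (Φ x t)) : ℝ) : ℂ) * Complex.I with hU'
  have hnv : wedge n v ≠ 0 := by rw [wedge_comm]; exact neg_ne_zero.2 hvn
  have hUd : ∀ t, HasDerivAt U (U' t) t := fun t =>
    ((h.hasDerivAt_wedge n p x t).div_const _).ofReal_comp.add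
      (((h.hasDerivAt_wedge v p x t).const_mul σ).ofReal_comp.mul_const _)
  have hUc : Continuous U' := by
    have hg := h.continuous_field
    have hΦ := h.flow.continuous_time x
    rw [hU']
    fun_prop
  have hUim : ∀ t, (U t).im = σ * wedge v (Φ x t - p) := fun t => by simp [hU]
  have hUre : ∀ t, (U t).re = wedge n (Φ x t - p) / wedge n v := fun t => by simp [hU]
  have hUiff : ∀ t (r : ℝ), U t = (r : ℂ) ↔ Φ x t = p + r • v := by
    intro t r
    constructor
    · intro h1
      have h2 := congrArg Complex.im h1
      have h3 := congrArg Complex.re h1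
      rw [hUim, Complex.ofReal_im] at h2
      rw [hUre, Complex.ofReal_re] at h3
      obtain ⟨r', hr'⟩ := exists_eq_add_smul_of_wedge_eq_zero hv0
        ((mul_eq_zero.1 h2).resolve_left hσ)
      rw [hr', add_sub_cancel_left, wedge_smul_right, mul_div_assoc, div_self hnv, mul_one] at h3
      rw [hr', h3]
    · intro h1
      apply Complex.ext
      · rw [hUre, h1, add_sub_cancel_left, wedge_smul_right, mul_div_assoc, div_self hnv, mul_one,
          Complex.ofReal_re]
      · rw [hUim, h1, wedge_line, mul_zero, Complex.ofReal_im]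
  have hU0 : U 0 = (s : ℂ) := (hUiff 0 s).2 (h.flow.zero x)
  have hUtrans : ∀ t, ∀ r ∈ Icc l 1, U t = (r : ℂ) → 0 < (U' t).im := by
    intro t r hr h1
    have := htrans r hr
    rw [← (hUiff t r).1 h1] at this
    simpa [hU'] using this
  -- the first time on the extended segment
  obtain ⟨T', hT', hT'T, l', hl', hUT', hmin⟩ : ∃ T' > 0, T' ≤ T ∧ ∃ l' ∈ Icc l 1,
      U T' = (l' : ℂ) ∧ ∀ t ∈ Ioo 0 T', ∀ r ∈ Icc l 1, U t ≠ (r : ℂ) := by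
    have hsign := eventually_sign_of_hasDerivAt_pos (g := fun t => (U t).im)
      (Complex.imCLM.hasFDerivAt.comp_hasDerivAt 0 (hUd 0)) (by simp [hU0])
      (hUtrans 0 s ⟨hls.le, hs.2⟩ hU0)
    obtain ⟨η, hη, hsg⟩ := Metric.eventually_nhds_iff.1 hsign
    have hafter : ∀ t ∈ Ioo 0 η, ∀ r ∈ Icc l 1, U t ≠ (r : ℂ) := by
      intro t ht r _ h1
      have h2 := (hsg (show dist t 0 < η by
        rw [Real.dist_eq, sub_zero, abs_of_pos ht.1]; exact ht.2)).1 ht.1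
      rw [h1] at h2
      simp at h2
    have hl1 : l ∈ Icc l 1 := ⟨le_rfl, by linarith⟩
    have hUT : U T = (l : ℂ) := (hUiff T l).2 hΦT
    have hge : η / 2 ≤ T := by
      by_contra hcon
      exact hafter T ⟨hT, by linarith⟩ l hl1 hUT
    have hcl : IsClosed ((fun r : ℝ => (r : ℂ)) '' Icc l 1) :=
      (isCompact_Icc.image Complex.continuous_ofReal).isClosed
    have hUcont : Continuous U := continuous_iff_continuousAt.2 fun t => (hUd t).continuousAt
    have hS : IsCompact (Icc (η / 2) T ∩ U ⁻¹' ((fun r : ℝ => (r : ℂ)) '' Icc l 1)) :=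
      isCompact_Icc.inter_right (hcl.preimage hUcont)
    obtain ⟨T', hT'S, hleast⟩ := hS.exists_isLeast ⟨T, ⟨hge, le_rfl⟩, l, hl1, hUT.symm⟩
    obtain ⟨⟨ha, hb⟩, l', hl', hl''⟩ := hT'S
    refine ⟨T', by linarith, hb, l', hl', hl''.symm, fun t ht r hr h1 => ?_⟩
    rcases lt_or_ge t η with h2 | h2
    · exact hafter t ⟨ht.1, h2⟩ r hr h1
    · exact absurd (hleast ⟨⟨by linarith, by linarith [ht.2]⟩, r, hr, h1.symm⟩) (not_le.2 ht.2)
  have hΦT' := (hUiff T' l').1 hUT'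
  have hl'0 : l' ≤ 0 ∧ l' < s := by
    rcases hT'T.eq_or_lt with h1 | h1
    · have h2 : U T' = (l : ℂ) := by rw [h1]; exact (hUiff T l).2 hΦT
      rw [hUT'] at h2
      have h3 : l' = l := Complex.ofReal_injective h2
      rw [h3]; exact ⟨hl, hls⟩
    · have h2 := hfirst T' ⟨hT', h1⟩
      rw [hΦT', exists_mem_segment_iff] at h2
      have h3 : l' < 0 := by
        by_contra h4
        exact h2 ⟨l', ⟨not_lt.1 h4, hl'.2⟩, rfl⟩
      exact ⟨h3.le, by linarith [hs.1]⟩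
  have htrap := planar_trapping hUd hUc hT' hl'0.2 hs.2 hU0 hUT'
    (fun t _ r hr => hUtrans t r ⟨hl'.1.trans hr.1, hr.2⟩)
    (fun t1 t2 _ _ h1 => by
      have h2 : Φ x t1 = Φ x t2 := by
        have h3 := congrArg Complex.im h1
        have h4 := congrArg Complex.re h1
        rw [hUim, hUim] at h3
        rw [hUre, hUre, div_left_inj' hnv] at h4
        have h5 := mul_left_cancel₀ hσ h3
        have h6 := wedge_smul_eq n v (Φ x t1 - p)
        have h7 := wedge_smul_eq n v (Φ x t2 - p)
        rw [h4, wedge_comm (Φ x t1 - p) v, h5, ← wedge_comm (Φ x t2 - p) v] at h6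
        exact sub_left_injective (smul_right_injective _ hnv (h6.trans h7.symm))
      rw [hU0]
      exact (hUiff _ s).2 (h.flow.eq_of_eq h.lip h2))
    (fun t ht r hr => hmin t ht r ⟨hl'.1.trans hr.1, hr.2⟩)
  have hno : ∀ t, T' < t → Φ x t ∉ segment ℝ p q := by
    intro t ht hmem
    obtain ⟨r, hr, h1⟩ := exists_mem_segment_iff.1 hmem
    exact htrap t ht r ⟨hl'0.1.trans hr.1, hr.2⟩ ((hUiff t r).2 h1)
  rcases hl'0.1.eq_or_lt with h0 | h0
  · rw [h0, zero_smul, add_zero] at hΦT'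
    obtain ⟨τ, hτ, h1⟩ := hret p (left_mem_segment ℝ p q)
    have h2 : Φ x (T' + τ) = Φ p τ := by rw [h.flow.add h.lip, hΦT']
    exact hno (T' + τ) (by linarith) (h2 ▸ h1)
  · obtain ⟨τ, hτ, h1⟩ := hret x hxS
    obtain ⟨r, hr, h2⟩ := exists_mem_segment_iff.1 h1
    have h3 := (hUiff τ r).2 h2
    have hr' : r ∈ Icc l 1 := ⟨by linarith [hr.1], hr.2⟩
    rcases lt_trichotomy τ T' with h4 | h4 | h4
    · exact hmin τ ⟨hτ, h4⟩ r hr' h3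
    · rw [h4, hUT'] at h3
      have : l' = r := Complex.ofReal_injective h3
      linarith [hr.1]
    · exact hno τ h4 h1

/-- A trajectory from a point of the segment that crosses the line, for the first time, near the
segment crosses the segment itself. -/
theorem mem_segment_of_crossing (h : IsDiskFlow f g Φ K L) {p q : Plane}
    (hret : ∀ x ∈ segment ℝ p q, ∃ τ > 0, Φ x τ ∈ segment ℝ p q)
    (hne : ∀ x ∈ segment ℝ p q, wedge (q - p) (g x) ≠ 0)
    {x e : Plane} {σ T : ℝ} (hx : x ∈ segment ℝ p q) (hT : 0 < T)
    (hline : wedge (q - p) (Φ x T - p) = 0) (he : e ∈ segment ℝ p q)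
    (hfirst : ∀ t ∈ Ioo 0 T, Φ x t ∉ segment ℝ p q)
    (htrans : ∀ w ∈ segment ℝ (Φ x T) e, 0 < σ * wedge (q - p) (g w)) :
    Φ x T ∈ segment ℝ p q := by
  have hv0 : q - p ≠ 0 := by
    intro h0
    have := hne x hx
    rw [h0] at this
    simp [wedge] at this
  obtain ⟨l, hl⟩ := exists_eq_add_smul_of_wedge_eq_zero hv0 hline
  obtain ⟨s, hs, hxs⟩ := exists_mem_segment_iff.1 hx
  obtain ⟨ε, hε, heε⟩ := exists_mem_segment_iff.1 he
  -- the sign is constant on the segment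
  have hpos : ∀ r ∈ Icc (0 : ℝ) 1, 0 < σ * wedge (q - p) (g (p + r • (q - p))) := by
    have hσ : σ ≠ 0 := left_ne_zero_of_mul (htrans e (right_mem_segment ℝ _ _)).ne'
    have hc : Continuous fun r : ℝ => σ * wedge (q - p) (g (p + r • (q - p))) := by
      have hg := h.continuous_field
      fun_prop
    intro r hr
    by_contra hcon
    have h0 : 0 < σ * wedge (q - p) (g (p + ε • (q - p))) := by
      rw [← heε]; exact htrans e (right_mem_segment ℝ _ _)
    obtain ⟨r', hr', h1⟩ := (isPreconnected_Icc (a := (0 : ℝ)) (b := 1)).intermediate_value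
      hr hε hc.continuousOn ⟨not_lt.1 hcon, h0.le⟩
    exact mul_ne_zero hσ (hne _ (exists_mem_segment_iff.2 ⟨r', hr', rfl⟩)) h1
  have hbetween : ∀ r, (l ≤ r ∧ r ≤ ε) ∨ (ε ≤ r ∧ r ≤ l) →
      0 < σ * wedge (q - p) (g (p + r • (q - p))) := by
    intro r hr
    apply htrans
    have h1 : r ∈ segment ℝ l ε := by
      rw [segment_eq_uIcc, mem_uIcc]; exact hr
    obtain ⟨a, b, ha, hb, hab, h2⟩ := h1
    refine ⟨a, b, ha, hb, hab, ?_⟩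
    have h3 : b = 1 - a := by linarith
    rw [hl, heε, ← h2, h3]
    simp only [smul_eq_mul]
    module
  rw [hl, exists_mem_segment_iff]
  refine ⟨l, ⟨?_, ?_⟩, rfl⟩
  · by_contra hcon
    rw [not_le] at hcon
    refine h.not_exit hret (σ := σ) hs hcon.le (by linarith [hs.1]) hT (hxs ▸ hl)
      (hxs ▸ hfirst) fun r hr => ?_
    rcases le_total 0 r with h1 | h1
    · exact hpos r ⟨h1, hr.2⟩
    · exact hbetween r (Or.inl ⟨hr.1, h1.trans hε.1⟩)
  · by_contra hcon
    rw [not_le] at hcon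
    have hflip : ∀ r : ℝ, q + r • (p - q) = p + (1 - r) • (q - p) := fun r => by module
    rw [segment_symm] at hret hfirst
    refine h.not_exit (p := q) (q := p) hret (σ := -σ) (l := 1 - l) (s := 1 - s) (T := T)
      ⟨by linarith [hs.2], by linarith [hs.1]⟩ (by linarith) (by linarith [hs.2]) hT ?_ ?_ ?_
    · rw [hflip, hflip, sub_sub_cancel, sub_sub_cancel, ← hxs, hl]
    · rw [hflip, sub_sub_cancel, ← hxs]; exact hfirst
    · intro r hr
      rw [hflip, ← neg_sub q p, wedge_neg_left, neg_mul_neg]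
      rcases le_total r 0 with h1 | h1
      · exact hbetween _ (Or.inr ⟨by linarith [hε.2], by linarith [hr.1]⟩)
      · exact hpos _ ⟨by linarith [hr.2], by linarith⟩

theorem strictMonoOn_wedge (h : IsDiskFlow f g Φ K L) {p v x : Plane} {σ b T : ℝ}
    (hC : ∀ t ∈ Icc b T, 0 < σ * wedge v (g (Φ x t))) :
    StrictMonoOn (fun t => σ * wedge v (Φ x t - p)) (Icc b T) := by
  have hd : ∀ t, HasDerivAt (fun t => σ * wedge v (Φ x t - p)) (σ * wedge v (g (Φ x t))) t :=
    fun t => (h.hasDerivAt_wedge v p x t).const_mul σ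
  refine strictMonoOn_of_deriv_pos (convex_Icc b T)
    (fun t _ => (hd t).continuousAt.continuousWithinAt) fun t ht => ?_
  rw [(hd t).deriv]
  exact hC t (interior_subset ht)

theorem exists_unique_crossing (h : IsDiskFlow f g Φ K L) {p v x : Plane} {σ b T : ℝ} (hbT : b ≤ T)
    (hC : ∀ t ∈ Icc b T, 0 < σ * wedge v (g (Φ x t)))
    (hb : σ * wedge v (Φ x b - p) < 0) (hT : 0 < σ * wedge v (Φ x T - p)) :
    ∃ θ ∈ Ioo b T, wedge v (Φ x θ - p) = 0 ∧
      ∀ t ∈ Icc b T, wedge v (Φ x t - p) = 0 → t = θ := by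
  have hσ : σ ≠ 0 := left_ne_zero_of_mul hb.ne
  have hc : Continuous fun t => σ * wedge v (Φ x t - p) := by
    have := h.flow.continuous_time x
    fun_prop
  obtain ⟨θ, hθ, hθ0⟩ := intermediate_value_Ioo hbT hc.continuousOn ⟨hb, hT⟩
  refine ⟨θ, hθ, (mul_eq_zero.1 hθ0).resolve_left hσ, fun t ht ht0 => ?_⟩
  refine (h.strictMonoOn_wedge (p := p) hC).injOn ht (Ioo_subset_Icc_self hθ) ?_
  rw [ht0, mul_zero]
  exact hθ0.symm

/-- A trajectory that leaves the segment transversally, then stays away from it, and finally crosses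
the line transversally, does not meet the segment before the crossing. -/
theorem not_mem_segment_of_lt_crossing (h : IsDiskFlow f g Φ K L) {p q x : Plane} {σ a b T θ : ℝ}
    (hx : wedge (q - p) (x - p) = 0) (ha : 0 ≤ a)
    (hA : ∀ t ∈ Icc 0 a, 0 < σ * wedge (q - p) (g (Φ x t)))
    (hB : ∀ t ∈ Icc a b, Φ x t ∉ segment ℝ p q)
    (hC : ∀ t ∈ Icc b T, 0 < σ * wedge (q - p) (g (Φ x t)))
    (hθ : θ ∈ Ioo b T) (hθ0 : wedge (q - p) (Φ x θ - p) = 0) :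
    ∀ t ∈ Ioo 0 θ, Φ x t ∉ segment ℝ p q := by
  intro t ht hmem
  have h0 : wedge (q - p) (Φ x t - p) = 0 := by
    obtain ⟨s, _, hs⟩ := exists_mem_segment_iff.1 hmem
    rw [hs, wedge_line]
  rcases le_total t a with h1 | h1
  · have h2 := h.strictMonoOn_wedge (p := p) hA ⟨le_rfl, ha⟩ ⟨ht.1.le, h1⟩ ht.1
    simp only [h0, h.flow.zero, hx, mul_zero, lt_self_iff_false] at h2
  · rcases le_total t b with h2 | h2
    · exact hB t ⟨h1, h2⟩ hmem
    · have h3 := h.strictMonoOn_wedge (p := p) hC ⟨h2, (ht.2.trans hθ.2).le⟩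
        (Ioo_subset_Icc_self hθ) ht.2
      simp only [h0, hθ0, mul_zero, lt_self_iff_false] at h3

end IsDiskFlow

/-! ### The Jacobian of the Poincaré map -/

/-- Implicit differentiation at a point: no continuity of the derivatives is required once the
implicit function is known to be continuous. -/
theorem hasFDerivAt_of_implicit {E : Type*} [NormedAddCommGroup E] [NormedSpace ℝ E]
    {G : E × ℝ → ℝ} {B : E →L[ℝ] ℝ} {α τ : ℝ} {x : E} {θ : E → ℝ} (hα : α ≠ 0)
    (hG : HasFDerivAt G (B.comp (ContinuousLinearMap.fst ℝ E ℝ)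
      + α • ContinuousLinearMap.snd ℝ E ℝ) (x, τ))
    (hθ : ContinuousAt θ x) (hx : θ x = τ) (h0 : ∀ᶠ y in 𝓝 x, G (y, θ y) = G (x, τ)) :
    HasFDerivAt θ (-(α⁻¹ • B)) x := by
  rw [hasFDerivAt_iff_isLittleO, Asymptotics.isLittleO_iff]
  intro c hc
  set D : ℝ := 1 + |α|⁻¹ * ‖B‖ with hD
  have hD0 : 0 < D := by positivity
  set c' : ℝ := min (1 / 2) (c / (2 * D)) with hc'
  have hc'0 : 0 < c' := by positivity
  have hα' : 0 < |α| := abs_pos.2 hα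
  rw [hasFDerivAt_iff_isLittleO, Asymptotics.isLittleO_iff] at hG
  have h1 := hG (show 0 < |α| * c' by positivity)
  have htend : Tendsto (fun y => (y, θ y)) (𝓝 x) (𝓝 (x, τ)) := by
    have := (continuousAt_id (x := x)).prodMk hθ
    rw [ContinuousAt, id, hx] at this
    exact this
  filter_upwards [htend.eventually h1, h0] with y hy hy0
  rw [hy0, sub_self, zero_sub, norm_neg] at hy
  set r : ℝ := θ y - τ + α⁻¹ * B (y - x) with hr
  have h2 : α * r = B (y - x) + α * (θ y - τ) := by
    rw [hr]; field_simp; ring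
  have h3 : |α| * |r| ≤ |α| * c' * ‖((y, θ y) : E × ℝ) - (x, τ)‖ := by
    rw [← abs_mul, h2]
    simpa using hy
  have h4 : |r| ≤ c' * ‖((y, θ y) : E × ℝ) - (x, τ)‖ := by
    rw [mul_assoc] at h3
    exact le_of_mul_le_mul_left h3 hα'
  have h5 : |θ y - τ| ≤ |r| + |α|⁻¹ * ‖B‖ * ‖y - x‖ := by
    have h6 : θ y - τ = r - α⁻¹ * B (y - x) := by rw [hr]; ring
    rw [h6]
    refine (abs_sub _ _).trans (add_le_add le_rfl ?_)
    rw [abs_mul, abs_inv, mul_assoc]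
    exact mul_le_mul_of_nonneg_left (B.le_opNorm _) (by positivity)
  have h6 : ‖((y, θ y) : E × ℝ) - (x, τ)‖ ≤ D * ‖y - x‖ + |r| := by
    rw [Prod.mk_sub_mk, Prod.norm_def]
    refine max_le ?_ ?_
    · have : 0 ≤ |α|⁻¹ * ‖B‖ * ‖y - x‖ := by positivity
      have h7 := abs_nonneg r
      simp only [hD, add_mul, one_mul]
      linarith
    · simp only [Real.norm_eq_abs, hD, add_mul, one_mul]
      have := norm_nonneg (y - x)
      linarith
  have h7 : |r| ≤ c' * (D * ‖y - x‖) + 1 / 2 * |r| := by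
    have h8 := mul_le_mul_of_nonneg_left h6 hc'0.le
    have h9 : c' * |r| ≤ 1 / 2 * |r| :=
      mul_le_mul_of_nonneg_right (min_le_left _ _) (abs_nonneg _)
    rw [mul_add] at h8
    linarith
  have h8 : c' * (D * ‖y - x‖) ≤ c / 2 * ‖y - x‖ := by
    have h9 : c' * D ≤ c / 2 := by
      calc c' * D ≤ c / (2 * D) * D := mul_le_mul_of_nonneg_right (min_le_right _ _) hD0.le
        _ = c / 2 := by field_simp
    rw [← mul_assoc]
    exact mul_le_mul_of_nonneg_right h9 (norm_nonneg _)
  have h9 : θ y - θ x - (-(α⁻¹ • B)) (y - x) = r := by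
    rw [hx, hr]; simp
  rw [h9, Real.norm_eq_abs]
  linarith

/-- `wedge a` as a linear form. -/
def wedgeCLM (a : Plane) : Plane →L[ℝ] ℝ :=
  a 0 • EuclideanSpace.proj (𝕜 := ℝ) 1 - a 1 • EuclideanSpace.proj (𝕜 := ℝ) 0

@[simp] theorem wedgeCLM_apply (a b : Plane) : wedgeCLM a b = wedge a b := by
  simp [wedgeCLM, wedge]

/-- The derivative at `x` of the Poincaré map of a line of direction `v`, for the return time `τ`:
by Liouville's formula it is determined by the divergence along the trajectory. -/
def poincareDeriv (f : Plane → Plane) (Φ : Plane → ℝ → Plane) (v x : Plane) (τ : ℝ) :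
    Plane →L[ℝ] Plane :=
  ((Real.exp (∫ t in (0 : ℝ)..τ, divergence f (Φ x t)) / wedge (f (Φ x τ)) v) •
    wedgeCLM (f x)).smulRight v

theorem poincareDeriv_apply (f : Plane → Plane) (Φ : Plane → ℝ → Plane) (v x w : Plane) (τ : ℝ) :
    poincareDeriv f Φ v x τ w = (Real.exp (∫ t in (0 : ℝ)..τ, divergence f (Φ x t))
      / wedge (f (Φ x τ)) v * wedge (f x) w) • v := by
  simp [poincareDeriv]

namespace IsDiskFlow

variable {f g : Plane → Plane} {Φ : Plane → ℝ → Plane} {K L : NNReal}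

theorem return_time_unique {S : Set Plane} {x : Plane} {τ τ' : ℝ} (h1 : 0 < τ) (h2 : Φ x τ ∈ S)
    (h3 : ∀ s ∈ Ioo 0 τ, Φ x s ∉ S) (h1' : 0 < τ') (h2' : Φ x τ' ∈ S)
    (h3' : ∀ s ∈ Ioo 0 τ', Φ x s ∉ S) : τ = τ' := by
  rcases lt_trichotomy τ τ' with h | h | h
  · exact absurd h2 (h3' τ ⟨h1, h⟩)
  · exact h
  · exact absurd h2' (h3 τ' ⟨h1', h⟩)

/-- The field crosses the segment from the same side at all points. -/
theorem sign_const (h : IsDiskFlow f g Φ K L) {p q : Plane}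
    (hne : ∀ x ∈ segment ℝ p q, wedge (q - p) (g x) ≠ 0) {σ : ℝ} {z w : Plane}
    (hz : z ∈ segment ℝ p q) (hw : w ∈ segment ℝ p q) (hpos : 0 < σ * wedge (q - p) (g z)) :
    0 < σ * wedge (q - p) (g w) := by
  have hσ : σ ≠ 0 := left_ne_zero_of_mul hpos.ne'
  have hc : Continuous fun w => σ * wedge (q - p) (g w) := by
    have hg := h.continuous_field
    fun_prop
  by_contra hcon
  obtain ⟨r, hr, h1⟩ := (convex_segment (𝕜 := ℝ) p q).isPreconnected.intermediate_value
    hw hz hc.continuousOn ⟨not_lt.1 hcon, hpos.le⟩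
  exact mul_ne_zero hσ (hne _ hr) h1

/-- Derivative of the flow in the direction of the field. -/
theorem fderiv_flow_apply_field (h : IsDiskFlow f g Φ K L) {x : Plane} {τ : ℝ}
    {Y : Plane →L[ℝ] Plane} (hY : HasFDerivAt (fun y => Φ y τ) Y x) : Y (g x) = g (Φ x τ) := by
  have h1 : HasDerivAt (Φ x) (g x) 0 := by
    have := h.flow.deriv x 0
    rwa [h.flow.zero] at this
  have h2 : HasFDerivAt (fun y => Φ y τ) Y (Φ x 0) := by rwa [h.flow.zero]
  have h3 : HasDerivAt (fun s => Φ (Φ x s) τ) (Y (g x)) 0 := h2.comp_hasDerivAt 0 h1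
  have h4 : HasDerivAt (fun s => Φ x (s + τ)) (g (Φ x (0 + τ))) 0 :=
    (h.flow.deriv x (0 + τ)).comp_add_const 0 τ
  have h5 : (fun s => Φ (Φ x s) τ) = fun s => Φ x (s + τ) := by
    funext s
    rw [h.flow.add h.lip]
  rw [h5] at h3
  have := h3.unique h4
  rwa [zero_add] at this

theorem divergence_eq (h : IsDiskFlow f g Φ K L) {x : Plane} (hx : x ∈ unitDisk) :
    tr (fderiv ℝ g x) = divergence f x := by rw [h.fderiv_eq x hx]; rfl

/-- The time of the transversal crossing near `τ` is an implicit function of the initial point, also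
at the end points of the segment. On the segment, the crossing point near `P x` lies on the segment
by `mem_segment_of_crossing`, and it is the first return by `not_mem_segment_of_lt_crossing`. -/
theorem isPoincareJacobian (h : IsDiskFlow f g Φ K L) {p q : Plane} {P : Plane → Plane}
    (hpq : segment ℝ p q ⊆ unitDisk) (hP : IsPoincareMap f (segment ℝ p q) P)
    (hne : ∀ x ∈ segment ℝ p q, wedge (q - p) (g x) ≠ 0) {x : Plane} {τ : ℝ}
    (hx : x ∈ segment ℝ p q) (hτ : IsFirstReturn f (segment ℝ p q) x (P x) τ) :
    HasFDerivWithinAt P (poincareDeriv f Φ (q - p) x τ) (segment ℝ p q) x ∧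
      IsPoincareJacobian f p q P x (poincareDeriv f Φ (q - p) x τ) := by
  have hret : ∀ x ∈ segment ℝ p q, ∃ τ > 0, Φ x τ ∈ segment ℝ p q := by
    intro y hy
    obtain ⟨τ, hτ⟩ := hP y hy
    rw [h.isFirstReturn_iff (hpq hy)] at hτ
    exact ⟨τ, hτ.1, hτ.2.2.1 ▸ hτ.2.1⟩
  have hτ' := hτ
  rw [h.isFirstReturn_iff (hpq hx)] at hτ'
  obtain ⟨hτ0, hPx, hΦτ, hfirst⟩ := hτ'
  set v := q - p with hv
  set c := P x with hc
  have hxd := hpq hx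
  have hcd := hpq hPx
  have hv0 : v ≠ 0 := by
    intro h0
    have := hne x hx
    rw [h0] at this
    simp [wedge] at this
  have hgc := h.continuous_field
  have hΦc := h.continuous_uncurry
  set σ : ℝ := wedge v (g c) with hσ
  have hσc : 0 < σ * wedge v (g c) := mul_self_pos.2 (hne c hPx)
  have hσx : 0 < σ * wedge v (g x) := h.sign_const hne hPx hx hσc
  have hlx : wedge v (x - p) = 0 := by
    obtain ⟨s, _, hs⟩ := exists_mem_segment_iff.1 hx
    rw [hs, wedge_line]
  have hlc : wedge v (c - p) = 0 := by
    obtain ⟨s, _, hs⟩ := exists_mem_segment_iff.1 hPx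
    rw [hs, wedge_line]
  have hcG : Continuous fun z : Plane × ℝ => σ * wedge v (g (Φ z.1 z.2)) := by fun_prop
  have hcF : Continuous fun z : Plane × ℝ => σ * wedge v (Φ z.1 z.2 - p) := by fun_prop
  have hcx : Continuous (Φ x) := h.flow.continuous_time x
  -- transversality near the two ends of the trajectory
  obtain ⟨η1, hη1, hA1⟩ : ∃ η > 0, ∀ t, |t| < η → 0 < σ * wedge v (g (Φ x t)) := by
    have hc1 : Continuous fun t => σ * wedge v (g (Φ x t)) := by fun_prop
    have : ∀ᶠ t in 𝓝 (0 : ℝ), 0 < σ * wedge v (g (Φ x t)) :=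
      hc1.continuousAt.eventually (lt_mem_nhds (by simpa only [h.flow.zero] using hσx))
    obtain ⟨η, hη, h1⟩ := Metric.eventually_nhds_iff.1 this
    exact ⟨η, hη, fun t ht => h1 (by rwa [Real.dist_eq, sub_zero])⟩
  obtain ⟨η2, hη2, hC1⟩ : ∃ η > 0, ∀ t, |t - τ| < η → 0 < σ * wedge v (g (Φ x t)) := by
    have hc1 : Continuous fun t => σ * wedge v (g (Φ x t)) := by fun_prop
    have : ∀ᶠ t in 𝓝 τ, 0 < σ * wedge v (g (Φ x t)) :=
      hc1.continuousAt.eventually (lt_mem_nhds (by simpa only [hΦτ] using hσc))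
    obtain ⟨η, hη, h1⟩ := Metric.eventually_nhds_iff.1 this
    exact ⟨η, hη, fun t ht => h1 (by rwa [Real.dist_eq])⟩
  obtain ⟨δ, hδ, hball⟩ : ∃ δ > 0, ∀ w ∈ Metric.ball c δ, 0 < σ * wedge v (g w) := by
    have hc1 : Continuous fun w => σ * wedge v (g w) := by fun_prop
    exact Metric.eventually_nhds_iff_ball.1 (hc1.continuousAt.eventually (lt_mem_nhds hσc))
  set a : ℝ := min (η1 / 2) (τ / 4) with ha
  set b : ℝ := max (τ - η2 / 2) (τ / 2) with hb
  set T : ℝ := τ + η2 / 2 with hT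
  have ha0 : 0 < a := by positivity
  have hab : a ≤ b := (min_le_right _ _).trans (le_trans (by linarith) (le_max_right _ _))
  have hbτ : b < τ := max_lt (by linarith) (by linarith)
  have hτT : τ < T := by linarith
  have hA : ∀ t ∈ Icc 0 a, 0 < σ * wedge v (g (Φ x t)) := fun t ht => hA1 t (by
    rw [abs_of_nonneg ht.1]
    linarith [ht.2, min_le_left (η1 / 2) (τ / 4)])
  have hB : ∀ t ∈ Icc a b, Φ x t ∉ segment ℝ p q := fun t ht =>
    hfirst t ⟨ha0.trans_le ht.1, ht.2.trans_lt hbτ⟩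
  have hC : ∀ t ∈ Icc b T, 0 < σ * wedge v (g (Φ x t)) := fun t ht => hC1 t (by
    rw [abs_lt]
    constructor <;> linarith [ht.1, ht.2, le_max_left (τ - η2 / 2) (τ / 2)])
  have hmono := h.strictMonoOn_wedge (p := p) hC
  have hzero : σ * wedge v (Φ x τ - p) = 0 := by rw [hΦτ, hlc, mul_zero]
  have hneg : ∀ t, b ≤ t → t < τ → σ * wedge v (Φ x t - p) < 0 := fun t h1 h2 => by
    have := hmono ⟨h1, (h2.trans hτT).le⟩ ⟨hbτ.le, hτT.le⟩ h2
    simp only at this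
    rwa [hzero] at this
  have hposi : ∀ t, τ < t → t ≤ T → 0 < σ * wedge v (Φ x t - p) := fun t h1 h2 => by
    have := hmono ⟨hbτ.le, hτT.le⟩ ⟨(hbτ.trans h1).le, h2⟩ h1
    simp only at this
    rwa [hzero] at this
  -- all of this persists for neighbouring points
  have hAe : ∀ᶠ y in 𝓝 x, ∀ t ∈ Icc 0 a, 0 < σ * wedge v (g (Φ y t)) :=
    isCompact_Icc.eventually_forall_of_forall_eventually fun t ht =>
      hcG.continuousAt.eventually (lt_mem_nhds (hA t ht))
  have hCe : ∀ᶠ y in 𝓝 x, ∀ t ∈ Icc b T, 0 < σ * wedge v (g (Φ y t)) :=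
    isCompact_Icc.eventually_forall_of_forall_eventually fun t ht =>
      hcG.continuousAt.eventually (lt_mem_nhds (hC t ht))
  have hBe : ∀ᶠ y in 𝓝 x, ∀ t ∈ Icc a b, Φ y t ∉ segment ℝ p q := by
    have hcl : IsClosed (segment ℝ p q) := by
      rw [segment_eq_image']
      exact (isCompact_Icc.image (by fun_prop)).isClosed
    exact isCompact_Icc.eventually_forall_of_forall_eventually fun t ht =>
      (hΦc.continuousAt (x := (x, t))).eventually
        (hcl.isOpen_compl.mem_nhds (show Φ x t ∈ (segment ℝ p q)ᶜ from hB t ht))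
  have hFe : ∀ b', b ≤ b' → b' < τ → ∀ᶠ y in 𝓝 x, σ * wedge v (Φ y b' - p) < 0 :=
    fun b' h1 h2 => (Continuous.continuousAt (hcF.comp (by fun_prop :
      Continuous fun y : Plane => (y, b')))).eventually (gt_mem_nhds (hneg b' h1 h2))
  have hFe' : ∀ T', τ < T' → T' ≤ T → ∀ᶠ y in 𝓝 x, 0 < σ * wedge v (Φ y T' - p) :=
    fun T' h1 h2 => (Continuous.continuousAt (hcF.comp (by fun_prop :
      Continuous fun y : Plane => (y, T')))).eventually (lt_mem_nhds (hposi T' h1 h2))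
  -- the time of crossing
  set R : Plane → ℝ → Prop := fun y t => t ∈ Ioo b T ∧ wedge v (Φ y t - p) = 0 ∧
    ∀ s ∈ Icc b T, wedge v (Φ y s - p) = 0 → s = t with hR
  set θ : Plane → ℝ := fun y => Classical.epsilon (R y) with hθdef
  have hθ : ∀ᶠ y in 𝓝 x, R y (θ y) := by
    filter_upwards [hCe, hFe b le_rfl hbτ, hFe' T hτT le_rfl] with y h1 h2 h3
    obtain ⟨t, ht, ht0, htu⟩ := h.exists_unique_crossing (hbτ.trans hτT).le h1 h2 h3
    exact Classical.epsilon_spec (p := R y) ⟨t, ht, ht0, htu⟩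
  have hθx : θ x = τ :=
    (hθ.self_of_nhds.2.2 τ ⟨hbτ.le, hτT.le⟩ (by rw [hΦτ, hlc])).symm
  have hθc : ContinuousAt θ x := by
    rw [Metric.continuousAt_iff']
    intro ε hε
    have hb' : max b (τ - ε / 2) < τ := max_lt hbτ (by linarith)
    have hT' : τ < min T (τ + ε / 2) := lt_min hτT (by linarith)
    filter_upwards [hθ, hCe, hFe _ (le_max_left _ _) hb', hFe' _ hT' (min_le_left _ _)]
      with y h0 h1 h2 h3
    obtain ⟨t, ht, ht0, -⟩ := h.exists_unique_crossing (hb'.trans hT').le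
      (fun t ht => h1 t ⟨(le_max_left _ _).trans ht.1, ht.2.trans (min_le_left _ _)⟩) h2 h3
    have h4 : t = θ y := h0.2.2 t ⟨(le_max_left _ _).trans ht.1.le,
      ht.2.le.trans (min_le_left _ _)⟩ ht0
    rw [hθx, ← h4, Real.dist_eq, abs_lt]
    have h5 := (le_max_right b (τ - ε / 2)).trans_lt ht.1
    have h6 := ht.2.trans_le (min_le_right T (τ + ε / 2))
    constructor <;> linarith
  -- its derivative and that of the extended map
  obtain ⟨Y, hY0, hYd, hYf⟩ := h.flow.exists_hasFDerivAt h.lip h.pos h.contDiff h.unif x τ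
  have hYτ := hYf τ ⟨hτ0.le, le_rfl⟩
  have hjoint := h.flow.hasFDerivAt_uncurry hgc hΦc hYτ
  rw [hΦτ] at hjoint
  have hα : wedge v (g c) ≠ 0 := hne c hPx
  have hGd : HasFDerivAt (fun z : Plane × ℝ => wedge v (Φ z.1 z.2 - p))
      (((wedgeCLM v).comp (Y τ)).comp (ContinuousLinearMap.fst ℝ Plane ℝ)
        + wedge v (g c) • ContinuousLinearMap.snd ℝ Plane ℝ) (x, τ) := by
    have h1 := (wedgeCLM v).hasFDerivAt.comp (x, τ) (hjoint.sub_const p)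
    have h2 : (wedgeCLM v ∘ fun z : Plane × ℝ => Φ z.1 z.2 - p)
        = fun z : Plane × ℝ => wedge v (Φ z.1 z.2 - p) := by
      funext z; simp
    rw [h2] at h1
    refine h1.congr_fderiv ?_
    ext z <;> simp [wedge]
  have hθd := hasFDerivAt_of_implicit hα hGd hθc hθx (by
    filter_upwards [hθ] with y hy
    simp only [hy.2.1, hΦτ, hlc])
  set Q : Plane → Plane := fun y => Φ y (θ y) with hQ
  have hQd : HasFDerivAt Q (poincareDeriv f Φ v x τ) x := by
    have h1 := (hasFDerivAt_id (𝕜 := ℝ) x).prodMk hθd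
    have h2 : (id x, θ x) = (x, τ) := by rw [hθx, id]
    rw [← h2] at hjoint
    have h3 := hjoint.comp x h1
    refine HasFDerivAt.congr_fderiv (f := Q) h3 ?_
    ext1 w
    have h4 : wedge (Y τ (g x)) (Y τ w)
        = Real.exp (∫ t in (0 : ℝ)..τ, tr (fderiv ℝ g (Φ x t))) * wedge (g x) w :=
      wedge_eq_exp_integral_mul
        ((h.contDiff.continuous_fderiv one_ne_zero).comp hcx) hY0 hYd hτ0.le _ _
    rw [h.fderiv_flow_apply_field hYτ, hΦτ] at h4
    have h5 : ∫ t in (0 : ℝ)..τ, tr (fderiv ℝ g (Φ x t))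
        = ∫ t in (0 : ℝ)..τ, divergence f (Φ x t) :=
      intervalIntegral.integral_congr fun t ht => by
        rw [uIcc_of_le hτ0.le] at ht
        exact h.divergence_eq (h.mem x hxd t ht.1)
    rw [h5, h.eq x hxd] at h4
    have h6 := wedge_smul_eq (g c) v (Y τ w)
    have h7 : wedge (g c) v ≠ 0 := by rw [wedge_comm]; exact neg_ne_zero.2 hα
    rw [poincareDeriv_apply, hΦτ, ← h.eq c hcd]
    simp only [ContinuousLinearMap.comp_apply, add_apply,
      ContinuousLinearMap.prod_apply, ContinuousLinearMap.coe_fst', ContinuousLinearMap.coe_id',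
      id, ContinuousLinearMap.smulRight_apply, ContinuousLinearMap.coe_snd',
      neg_apply, smul_apply, wedgeCLM_apply, smul_eq_mul]
    rw [wedge_comm v (g c), wedge_comm v (Y τ w)]
    refine smul_right_injective _ h7 ?_
    simp only [smul_add, smul_smul]
    rw [h6, h4]
    have h8 : wedge (g c) v * -((-wedge (g c) v)⁻¹ * -wedge (Y τ w) v) = -wedge (Y τ w) v := by
      field_simp
    have h9 : ∀ e : ℝ, wedge (g c) v * (e / wedge (g c) v * wedge (f x) w)
        = e * wedge (f x) w := fun e => by field_simp
    rw [h8, h9]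
    module
  -- the extension agrees with the Poincaré map on the segment
  have hQP : ∀ᶠ y in 𝓝[segment ℝ p q] x, Q y = P y := by
    have hQnear : ∀ᶠ y in 𝓝 x, Q y ∈ Metric.ball c δ := by
      have h1 : ContinuousAt Q x := hQd.continuousAt
      refine h1.eventually (Metric.isOpen_ball.mem_nhds ?_)
      have : Q x = c := by rw [hQ]; simp only [hθx, hΦτ]
      rw [this]
      exact Metric.mem_ball_self hδ
    filter_upwards [nhdsWithin_le_nhds hAe, nhdsWithin_le_nhds hBe, nhdsWithin_le_nhds hCe,
      nhdsWithin_le_nhds hθ, nhdsWithin_le_nhds hQnear, self_mem_nhdsWithin]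
      with y h1 h2 h3 h4 h5 hy
    have hly : wedge v (y - p) = 0 := by
      obtain ⟨s, _, hs⟩ := exists_mem_segment_iff.1 hy
      rw [hs, wedge_line]
    have hpos : 0 < θ y := (ha0.trans_le hab).trans h4.1.1
    have hno := h.not_mem_segment_of_lt_crossing hly ha0.le h1 h2 h3 h4.1 h4.2.1
    have hmem := h.mem_segment_of_crossing hret hne hy hpos h4.2.1 hPx hno (σ := σ)
      fun w hw => hball w ((convex_ball c δ).segment_subset h5 (Metric.mem_ball_self hδ) hw)
    obtain ⟨τ', hτ'⟩ := hP y hy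
    rw [h.isFirstReturn_iff (hpq hy)] at hτ'
    have := return_time_unique hpos hmem hno hτ'.1 (hτ'.2.2.1 ▸ hτ'.2.1) hτ'.2.2.2
    rw [hQ]
    simp only [this]
    exact hτ'.2.2.1
  refine ⟨?_, Q, θ, ?_, hθc.continuousWithinAt, ?_, hQP, hQd.hasFDerivWithinAt⟩
  · exact hQd.hasFDerivWithinAt.congr_of_eventuallyEq (hQP.mono fun y hy => hy.symm)
      (hQP.self_of_nhdsWithin hx).symm
  · rw [hθx]; exact hτ
  · filter_upwards [nhdsWithin_le_nhds hθ, self_mem_nhdsWithin] with y hy hyd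
    refine ⟨(ha0.trans_le hab).trans hy.1.1, ?_, Φ y, h.isForwardSolution hyd, rfl⟩
    obtain ⟨r, hr⟩ := exists_eq_add_smul_of_wedge_eq_zero hv0 hy.2.1
    have h1 : Q y = AffineMap.lineMap p q r := by
      rw [hQ, AffineMap.lineMap_apply]
      simp only [hr, vsub_eq_sub, vadd_eq_add, hv]
      abel
    rw [h1]
    exact AffineMap.lineMap_mem_affineSpan_pair r p q

end IsDiskFlow

/-! ### Bounds from codes and names -/

theorem half_pow_le (m : ℕ) : (1 / 2 : ℝ) ^ m ≤ 1 / ((m : ℝ) + 1) := by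
  rw [one_div_pow]
  refine one_div_le_one_div_of_le (by positivity) ?_
  have : m + 1 ≤ 2 ^ m := Nat.lt_two_pow_self
  exact_mod_cast this

theorem abs_coord_le (a : Plane) (i : Fin 2) : |a i| ≤ ‖a‖ := by
  simpa using PiLp.norm_apply_le a i

/-- The sum of the absolute values of the coordinates. -/
def norm₁ (a : Plane) : ℝ := |a 0| + |a 1|

theorem norm_le_norm₁ (a : Plane) : ‖a‖ ≤ norm₁ a := by
  rw [EuclideanSpace.norm_eq, Fin.sum_univ_two, norm₁]
  refine Real.sqrt_le_iff.2 ⟨by positivity, ?_⟩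
  simp only [Real.norm_eq_abs]
  nlinarith [mul_nonneg (abs_nonneg (a 0)) (abs_nonneg (a 1))]

theorem norm₁_le (a : Plane) : norm₁ a ≤ 2 * ‖a‖ := by
  have h0 := abs_coord_le a 0
  have h1 := abs_coord_le a 1
  rw [norm₁]; linarith

namespace PtCode

@[simp] theorem val_norm₁ (a : PtCode) : (PtCode.norm₁ a).val = _root_.norm₁ a.val := by
  simp [PtCode.norm₁, _root_.norm₁, PtCode.val]

@[simp] theorem val_det (a b : PtCode) : (det a b).val = wedge a.val b.val := by
  simp [det, wedge, PtCode.val]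

@[simp] theorem val_dot (a b : PtCode) : (dot a b).val = inner ℝ a.val b.val := by
  simp [dot, PtCode.val, PiLp.inner_apply, Fin.sum_univ_two, mul_comm]

end PtCode

namespace PolyCode

theorem hasFDerivAt_eval (L : PolyCode) (x : Plane) :
    HasFDerivAt (eval L) (eval (deriv₀ L) x • EuclideanSpace.proj (𝕜 := ℝ) (0 : Fin 2)
      + eval (deriv₁ L) x • EuclideanSpace.proj (𝕜 := ℝ) (1 : Fin 2)) x := by
  induction L with
  | nil =>
    have h : eval [] = fun _ => 0 := by funext y; simp [eval]
    rw [h]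
    refine (hasFDerivAt_const (0 : ℝ) x).congr_fderiv ?_
    ext w; simp [deriv₀, deriv₁, eval]
  | cons m L ih =>
    have h : eval (m :: L) = fun y => m.2.2.val * (y 0 ^ m.1 * y 1 ^ m.2.1) + eval L y := by
      funext y; rw [eval_cons]; ring
    have h0 : HasFDerivAt (fun y : Plane => y 0) (EuclideanSpace.proj (𝕜 := ℝ) (0 : Fin 2)) x :=
      (EuclideanSpace.proj (𝕜 := ℝ) (0 : Fin 2)).hasFDerivAt
    have h1 : HasFDerivAt (fun y : Plane => y 1) (EuclideanSpace.proj (𝕜 := ℝ) (1 : Fin 2)) x :=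
      (EuclideanSpace.proj (𝕜 := ℝ) (1 : Fin 2)).hasFDerivAt
    rw [h]
    refine ((((h0.pow m.1).mul (h1.pow m.2.1)).const_mul m.2.2.val).add ih).congr_fderiv ?_
    have e0 : deriv₀ (m :: L) = (m.1 - 1, m.2.1, m.2.2.mul (RatCode.ofNat m.1)) :: deriv₀ L := rfl
    have e1 : deriv₁ (m :: L) = (m.1, m.2.1 - 1, m.2.2.mul (RatCode.ofNat m.2.1)) :: deriv₁ L := rfl
    ext w
    simp only [e0, e1, eval_cons, RatCode.val_mul, RatCode.val_ofNat, add_apply, smul_apply,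
      smul_eq_mul, PiLp.proj_apply, nsmul_eq_mul]
    ring

theorem abs_pow_mul_pow_le {x : Plane} (hx : x ∈ unitDisk) (i j : ℕ) : |x 0 ^ i * x 1 ^ j| ≤ 1 := by
  have h0 := (abs_coord_le x 0).trans (mem_unitDisk.1 hx)
  have h1 := (abs_coord_le x 1).trans (mem_unitDisk.1 hx)
  rw [abs_mul, abs_pow, abs_pow]
  exact mul_le_one₀ (pow_le_one₀ (abs_nonneg _) h0) (by positivity) (pow_le_one₀ (abs_nonneg _) h1)

theorem abs_monomial_le {x : Plane} (hx : x ∈ unitDisk) (i j : ℕ) (c : ℝ) :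
    |c * x 0 ^ i * x 1 ^ j| ≤ |c| := by
  rw [mul_assoc, abs_mul]
  exact mul_le_of_le_one_right (abs_nonneg _) (abs_pow_mul_pow_le hx i j)

theorem abs_eval_le (L : PolyCode) {x : Plane} (hx : x ∈ unitDisk) :
    |eval L x| ≤ (bound L).val := by
  induction L with
  | nil => simp [eval, bound]
  | cons m L ih =>
    rw [eval_cons, bound_cons]
    refine (abs_add_le _ _).trans (add_le_add ?_ ih)
    refine (abs_monomial_le hx _ _ _).trans (le_mul_of_one_le_right (abs_nonneg _) ?_)
    have : (0 : ℝ) ≤ m.1 + m.2.1 := by positivity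
    linarith

theorem abs_eval_deriv_le (L : PolyCode) {x : Plane} (hx : x ∈ unitDisk) :
    |eval (deriv₀ L) x| + |eval (deriv₁ L) x| ≤ (bound L).val := by
  induction L with
  | nil => simp [eval, deriv₀, deriv₁, bound]
  | cons m L ih =>
    have e0 : deriv₀ (m :: L) = (m.1 - 1, m.2.1, m.2.2.mul (RatCode.ofNat m.1)) :: deriv₀ L := rfl
    have e1 : deriv₁ (m :: L) = (m.1, m.2.1 - 1, m.2.2.mul (RatCode.ofNat m.2.1)) :: deriv₁ L := rfl
    rw [e0, e1, bound_cons, eval_cons, eval_cons]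
    simp only [RatCode.val_mul, RatCode.val_ofNat]
    have h0 := abs_monomial_le hx (m.1 - 1) m.2.1 (m.2.2.val * m.1)
    have h1 := abs_monomial_le hx m.1 (m.2.1 - 1) (m.2.2.val * m.2.1)
    rw [abs_mul _ (m.1 : ℝ), Nat.abs_cast] at h0
    rw [abs_mul _ (m.2.1 : ℝ), Nat.abs_cast] at h1
    have h2 := abs_add_le (m.2.2.val * m.1 * x 0 ^ (m.1 - 1) * x 1 ^ m.2.1) (eval (deriv₀ L) x)
    have h3 := abs_add_le (m.2.2.val * m.2.1 * x 0 ^ m.1 * x 1 ^ (m.2.1 - 1)) (eval (deriv₁ L) x)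
    have h4 := abs_nonneg m.2.2.val
    nlinarith

theorem norm_fderiv_eval_apply_le (L : PolyCode) {x : Plane} (hx : x ∈ unitDisk) (w : Plane) :
    |fderiv ℝ (eval L) x w| ≤ (bound L).val * ‖w‖ := by
  rw [(hasFDerivAt_eval L x).fderiv]
  simp only [add_apply, smul_apply, smul_eq_mul, PiLp.proj_apply]
  refine (abs_add_le _ _).trans ?_
  rw [abs_mul, abs_mul]
  calc _ ≤ |eval (deriv₀ L) x| * ‖w‖ + |eval (deriv₁ L) x| * ‖w‖ := by
        gcongr <;> exact abs_coord_le _ _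
    _ ≤ _ := by
        rw [← add_mul]
        exact mul_le_mul_of_nonneg_right (abs_eval_deriv_le L hx) (norm_nonneg _)

theorem bound_nonneg (L : PolyCode) : 0 ≤ (bound L).val :=
  (abs_nonneg _).trans (abs_eval_le L (x := 0) (by simp [unitDisk]))

theorem abs_eval_sub_le (L : PolyCode) {x y : Plane} (hx : x ∈ unitDisk) (hy : y ∈ unitDisk) :
    |eval L x - eval L y| ≤ (bound L).val * ‖x - y‖ :=
  convex_unitDisk.norm_image_sub_le_of_norm_fderiv_le
    (fun _ _ => (hasFDerivAt_eval L _).differentiableAt)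
    (fun _ hz => ContinuousLinearMap.opNorm_le_bound _ (bound_nonneg L)
      fun w => norm_fderiv_eval_apply_le L hz w) hy hx

end PolyCode

theorem HasFDerivAt.plane_coord {F : Plane → Plane} {F' : Plane →L[ℝ] Plane} {x : Plane}
    (hF : HasFDerivAt F F' x) (i : Fin 2) (w : Plane) :
    fderiv ℝ (fun y => F y i) x w = F' w i := by
  have h := (EuclideanSpace.proj (𝕜 := ℝ) i).hasFDerivAt.comp x hF
  have h' : HasFDerivAt (fun y => F y i) ((EuclideanSpace.proj (𝕜 := ℝ) i).comp F') x := h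
  rw [h'.fderiv]; rfl

theorem abs_tr_le (A : Plane →L[ℝ] Plane) : |tr A| ≤ 2 * ‖A‖ := by
  have h : ∀ i, |A (stdVec i) i| ≤ ‖A‖ := fun i => by
    refine (abs_coord_le _ i).trans ((A.le_opNorm _).trans ?_)
    simp [stdVec]
  rw [tr]
  have h0 := h 0
  have h1 := h 1
  exact (abs_add_le _ _).trans (by linarith)

theorem tr_sub (A A' : Plane →L[ℝ] Plane) : tr (A - A') = tr A - tr A' := by
  simp [tr]; ring

namespace FieldCode

/-- A bound on the disk for the norm of a coded field and of its derivative. -/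
def bound (c : FieldCode) : RatCode := c.1.bound.add c.2.bound

@[fun_prop]
theorem primrec_bound {γ : Type} [Primcodable γ] {f : γ → FieldCode} (hf : Primrec f) :
    Primrec fun x => bound (f x) := by
  unfold bound; fun_prop

theorem differentiableAt_eval (c : FieldCode) (x : Plane) :
    DifferentiableAt ℝ (FieldCode.eval c) x := by
  rw [differentiableAt_euclidean]
  intro i
  fin_cases i
  · exact (PolyCode.hasFDerivAt_eval c.1 x).differentiableAt
  · exact (PolyCode.hasFDerivAt_eval c.2 x).differentiableAt

theorem fderiv_eval_zero (c : FieldCode) (x w : Plane) :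
    fderiv ℝ (FieldCode.eval c) x w 0 = fderiv ℝ (PolyCode.eval c.1) x w :=
  ((differentiableAt_eval c x).hasFDerivAt.plane_coord 0 w).symm

theorem fderiv_eval_one (c : FieldCode) (x w : Plane) :
    fderiv ℝ (FieldCode.eval c) x w 1 = fderiv ℝ (PolyCode.eval c.2) x w :=
  ((differentiableAt_eval c x).hasFDerivAt.plane_coord 1 w).symm

theorem bound_nonneg (c : FieldCode) : 0 ≤ (bound c).val := by
  rw [bound, RatCode.val_add]
  exact add_nonneg c.1.bound_nonneg c.2.bound_nonneg

theorem norm_eval_le (c : FieldCode) {x : Plane} (hx : x ∈ unitDisk) :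
    ‖FieldCode.eval c x‖ ≤ (bound c).val := by
  refine (norm_le_norm₁ _).trans ?_
  rw [bound, RatCode.val_add]
  exact add_le_add (c.1.abs_eval_le hx) (c.2.abs_eval_le hx)

theorem norm_fderiv_eval_le (c : FieldCode) {x : Plane} (hx : x ∈ unitDisk) :
    ‖fderiv ℝ (FieldCode.eval c) x‖ ≤ (bound c).val := by
  refine ContinuousLinearMap.opNorm_le_bound _ (bound_nonneg c) fun w => ?_
  refine (norm_le_norm₁ _).trans ?_
  rw [norm₁, fderiv_eval_zero, fderiv_eval_one, bound, RatCode.val_add, add_mul]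
  exact add_le_add (c.1.norm_fderiv_eval_apply_le hx w) (c.2.norm_fderiv_eval_apply_le hx w)

theorem divergence_eval (c : FieldCode) (x : Plane) :
    divergence (FieldCode.eval c) x = PolyCode.eval (div c) x := by
  rw [divergence, tr, fderiv_eval_zero, fderiv_eval_one, (PolyCode.hasFDerivAt_eval c.1 x).fderiv,
    (PolyCode.hasFDerivAt_eval c.2 x).fderiv, div, PolyCode.eval_append]
  simp [stdVec]

end FieldCode

/-- The number `B` bounds on the disk the field, its Lipschitz constant and its divergence. -/
structure IsFieldBound (f : Plane → Plane) (B : ℝ) : Prop where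
  norm_le : ∀ x ∈ unitDisk, ‖f x‖ ≤ B
  sub_le : ∀ x ∈ unitDisk, ∀ y ∈ unitDisk, ‖f x - f y‖ ≤ B * ‖x - y‖
  div_le : ∀ x ∈ unitDisk, |divergence f x| ≤ B

theorem IsC1Name.isFieldBound {f : Plane → Plane} {F : ℕ → FieldCode} (hF : IsC1Name f F)
    (hf : Differentiable ℝ f) {B : ℝ} (hB : 2 + 2 * (FieldCode.bound (F 0)).val ≤ B) :
    IsFieldBound f B := by
  have h0 := FieldCode.bound_nonneg (F 0)
  have hd : ∀ x ∈ unitDisk, ‖fderiv ℝ f x‖ ≤ 1 + (FieldCode.bound (F 0)).val := fun x hx => by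
    have h1 := (hF 0 x hx).2
    have h2 := FieldCode.norm_fderiv_eval_le (F 0) hx
    have h3 := norm_le_norm_sub_add (fderiv ℝ f x) (fderiv ℝ (FieldCode.eval (F 0)) x)
    rw [pow_zero] at h1
    linarith
  refine ⟨fun x hx => ?_, fun x hx y hy => ?_, fun x hx => ?_⟩
  · have h1 := (hF 0 x hx).1
    have h2 := FieldCode.norm_eval_le (F 0) hx
    have h3 := norm_le_norm_sub_add (f x) (FieldCode.eval (F 0) x)
    rw [pow_zero] at h1
    linarith
  · exact convex_unitDisk.norm_image_sub_le_of_norm_fderiv_le (fun z _ => hf z)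
      (fun z hz => (hd z hz).trans (by linarith)) hy hx
  · have := abs_tr_le (fderiv ℝ f x)
    have := hd x hx
    rw [divergence]
    linarith

theorem IsC1Name.norm_sub_le {f : Plane → Plane} {F : ℕ → FieldCode} (hF : IsC1Name f F) (m : ℕ)
    {x : Plane} (hx : x ∈ unitDisk) : ‖f x - FieldCode.eval (F m) x‖ ≤ 1 / ((m : ℝ) + 1) :=
  (hF m x hx).1.trans (half_pow_le m)

theorem IsC1Name.abs_divergence_sub_le {f : Plane → Plane} {F : ℕ → FieldCode} (hF : IsC1Name f F)
    (l : ℕ) {x : Plane} (hx : x ∈ unitDisk) :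
    |divergence f x - PolyCode.eval (FieldCode.div (F l)) x| ≤ 2 * (1 / ((l : ℝ) + 1)) := by
  rw [← FieldCode.divergence_eval, divergence, divergence, ← tr_sub]
  refine (abs_tr_le _).trans ?_
  have := (hF l x hx).2.trans (half_pow_le l)
  linarith

/-! ### Density of the coded points -/

theorem exists_ratCode_eq (r : ℚ) : ∃ c : RatCode, c.val = r := by
  refine ⟨(r.num.toNat, (-r.num).toNat, r.den - 1), ?_⟩
  have h1 : ((r.den - 1 : ℕ) : ℝ) + 1 = r.den := by
    have := r.den_pos
    rw [Nat.cast_sub this]; simp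
  have h2 : ((r.num.toNat : ℝ)) - ((-r.num).toNat : ℝ) = r.num := by
    have : (r.num.toNat : ℤ) - ((-r.num).toNat : ℤ) = r.num := by omega
    exact_mod_cast this
  rw [RatCode.val, h1, h2, Rat.cast_def]

theorem exists_ratCode_between {a b : ℝ} (h : a < b) : ∃ c : RatCode, a < c.val ∧ c.val < b := by
  obtain ⟨r, h1, h2⟩ := exists_rat_btwn h
  obtain ⟨c, hc⟩ := exists_ratCode_eq r
  exact ⟨c, by rwa [hc], by rwa [hc]⟩

theorem exists_ptCode_near (x : Plane) {ε : ℝ} (hε : 0 < ε) : ∃ c : PtCode, ‖c.val - x‖ ≤ ε := by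
  obtain ⟨a, ha⟩ := exists_ratCode_between (show x 0 - ε / 2 < x 0 + ε / 2 by linarith)
  obtain ⟨b, hb⟩ := exists_ratCode_between (show x 1 - ε / 2 < x 1 + ε / 2 by linarith)
  refine ⟨(a, b), (norm_le_norm₁ _).trans ?_⟩
  have h0 : |a.val - x 0| ≤ ε / 2 := abs_le.2 ⟨by linarith, by linarith⟩
  have h1 : |b.val - x 1| ≤ ε / 2 := abs_le.2 ⟨by linarith, by linarith⟩
  simp only [norm₁, PtCode.val, PiLp.sub_apply]
  simp only [Matrix.cons_val_zero, Matrix.cons_val_one]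
  linarith

theorem exists_ptCode_near_of_mem_unitDisk {x : Plane} (hx : x ∈ unitDisk) {ε : ℝ} (hε : 0 < ε) :
    ∃ c : PtCode, ‖c.val - x‖ ≤ ε ∧ c.val ∈ unitDisk := by
  have hx1 := mem_unitDisk.1 hx
  set s := min (ε / 2) 1
  have hs0 : 0 < s := lt_min (by linarith) one_pos
  have hs1 : s ≤ 1 := min_le_right _ _
  have hs2 : s ≤ ε / 2 := min_le_left _ _
  -- shrinking `x` a little makes room for the approximation
  obtain ⟨c, hc⟩ := exists_ptCode_near ((1 - s) • x) hs0
  refine ⟨c, ?_, ?_⟩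
  · have h1 : c.val - x = (c.val - (1 - s) • x) - s • x := by module
    rw [h1]
    refine (norm_sub_le _ _).trans ?_
    rw [norm_smul, Real.norm_of_nonneg hs0.le]
    nlinarith
  · rw [mem_unitDisk]
    have h1 := norm_le_norm_sub_add c.val ((1 - s) • x)
    rw [norm_smul, Real.norm_of_nonneg (by linarith)] at h1
    nlinarith

/-! ### Computability of the end points of the segment -/

namespace RatCode

def max (a b : RatCode) : RatCode := if le a b then b else a

@[simp] theorem val_max (a b : RatCode) : (max a b).val = Max.max a.val b.val := by
  unfold max
  split_ifs with h
  · rw [max_eq_right ((le_iff a b).1 h)]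
  · rw [max_eq_left (not_le.1 fun h' => h ((le_iff a b).2 h')).le]

@[fun_prop]
theorem primrec_max {γ : Type} [Primcodable γ] {f g : γ → RatCode} (hf : Primrec f)
    (hg : Primrec g) : Primrec fun x => max (f x) (g x) :=
  Primrec.ite (primrec_le hf hg) hg hf

end RatCode

namespace BallCode

/-- The supremum of a linear form over the union of a list of balls, where `e` evaluates the
linear form; balls of negative radius are empty. The starting value `-10` is below all the suprema
that matter. -/
def listSup (e : PtCode → RatCode) (L : List BallCode) : RatCode :=
  L.foldr (fun b s => if RatCode.le (RatCode.ofNat 0) b.2 then ((e b.1).add b.2).max s else s)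
    (RatCode.neg (RatCode.ofNat 10))

theorem primrec_listSup {e : PtCode → RatCode} (he : Primrec e) : Primrec (listSup e) := by
  refine Primrec.foldr_comp (f := fun L : List BallCode => L)
    (g := fun _ => RatCode.neg (RatCode.ofNat 10))
    (h := fun (_ : List BallCode) (b : BallCode) (s : RatCode) =>
      if RatCode.le (RatCode.ofNat 0) b.2 then ((e b.1).add b.2).max s else s)
    (by fun_prop) (by fun_prop) ?_
  exact Primrec.ite (RatCode.primrec_le (by fun_prop) (by fun_prop)) (by fun_prop) (by fun_prop)

variable {e : PtCode → RatCode} {φ : Plane →L[ℝ] ℝ}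

theorem listSup_spec (he : ∀ c, (e c).val = φ c.val) (L : List BallCode) :
    (∀ b ∈ L, 0 ≤ b.2.val → φ b.1.val + b.2.val ≤ (listSup e L).val) ∧
      ((listSup e L).val = -10 ∨
        ∃ b ∈ L, 0 ≤ b.2.val ∧ (listSup e L).val = φ b.1.val + b.2.val) := by
  induction L with
  | nil => simp [listSup]
  | cons b L ih =>
    have h : listSup e (b :: L) = if RatCode.le (RatCode.ofNat 0) b.2 then
      ((e b.1).add b.2).max (listSup e L) else listSup e L := rfl
    by_cases hb : 0 ≤ b.2.val
    · rw [h, if_pos (by rw [RatCode.le_iff]; simpa using hb), RatCode.val_max, RatCode.val_add, he]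
      refine ⟨fun b' hb' h0 => ?_, ?_⟩
      · rcases List.mem_cons.1 hb' with rfl | h'
        · exact le_max_left _ _
        · exact (ih.1 b' h' h0).trans (le_max_right _ _)
      · rcases max_choice (φ b.1.val + b.2.val) (listSup e L).val with h1 | h1
        · exact Or.inr ⟨b, List.mem_cons_self, hb, h1⟩
        · rw [h1]
          exact ih.2.imp id fun ⟨b', h2, h3⟩ => ⟨b', List.mem_cons_of_mem _ h2, h3⟩
    · rw [h, if_neg (by rw [RatCode.le_iff]; simpa using hb)]
      refine ⟨fun b' hb' h0 => ?_, ih.2.imp id fun ⟨b', h2, h3⟩ =>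
        ⟨b', List.mem_cons_of_mem _ h2, h3⟩⟩
      rcases List.mem_cons.1 hb' with rfl | h'
      · exact absurd h0 hb
      · exact ih.1 b' h' h0

/-- The maximum of a linear form of norm one, attained at a unit vector `w`, on a computable compact
subset of the disk is a computable number. -/
theorem exists_computable_max {C : Set Plane} (hC : IsComputableCompact C) (hd : C ⊆ unitDisk)
    (he : ∀ c, (e c).val = φ c.val) (hep : Primrec e) (hφ : ∀ x, φ x ≤ ‖x‖) {w : Plane}
    (hw : ‖w‖ = 1) (hφw : φ w = 1) {M : ℝ} (hM : IsGreatest (φ '' C) M) :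
    ∃ c : ℕ → RatCode, Computable c ∧ ∀ l, |M - (c l).val| ≤ (1 / 2 : ℝ) ^ l := by
  obtain ⟨-, g, hg, hdist⟩ := hC
  refine ⟨fun l => listSup e (g l), (primrec_listSup hep).to_comp.comp hg, fun l => ?_⟩
  obtain ⟨⟨x, hx, rfl⟩, hmax⟩ := hM
  obtain ⟨h1, h2⟩ := listSup_spec he (g l)
  set s := (listSup e (g l)).val
  have hlip : ∀ a b : Plane, φ a ≤ φ b + dist a b := fun a b => by
    have := hφ (a - b)
    rw [map_sub] at this
    rw [dist_eq_norm]
    linarith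
  have hle : ∀ y ∈ ⋃ b ∈ g l, BallCode.toSet b, φ y ≤ s := by
    intro y hy
    obtain ⟨b, hb, hyb⟩ := mem_iUnion₂.1 hy
    have h3 : dist y b.1.val ≤ b.2.val := Metric.mem_closedBall.1 hyb
    have h4 := h1 b hb (dist_nonneg.trans h3)
    have := hlip y b.1.val
    linarith
  have hlt : ∀ ε : ℝ, 0 < ε → Metric.hausdorffEDist C (⋃ b ∈ g l, BallCode.toSet b)
      < ENNReal.ofReal ((1 / 2 : ℝ) ^ l + ε) := fun ε hε =>
    (hdist l).trans_lt ((ENNReal.ofReal_lt_ofReal_iff (by positivity)).2 (by linarith))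
  have hup : ∀ ε : ℝ, 0 < ε → φ x ≤ s + ((1 / 2 : ℝ) ^ l + ε) := by
    intro ε hε
    obtain ⟨y, hy, hxy⟩ := Metric.exists_edist_lt_of_hausdorffEDist_lt hx (hlt ε hε)
    rw [edist_lt_ofReal] at hxy
    have := hlip x y
    have := hle y hy
    linarith
  have hhalf : (1 / 2 : ℝ) ^ l ≤ 1 := pow_le_one₀ (by norm_num) (by norm_num)
  have hs : s ≠ -10 := by
    have h3 := hup 1 one_pos
    have h4 := hφ (-x)
    have h5 := mem_unitDisk.1 (hd hx)
    rw [norm_neg, map_neg] at h4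
    intro h6
    linarith
  obtain ⟨b, hb, hb0, hbs⟩ := h2.resolve_left hs
  have hy : b.1.val + b.2.val • w ∈ ⋃ b ∈ g l, BallCode.toSet b := by
    refine mem_iUnion₂.2 ⟨b, hb, Metric.mem_closedBall.2 ?_⟩
    rw [dist_eq_norm, add_sub_cancel_left, norm_smul, hw, mul_one, Real.norm_of_nonneg hb0]
  have hφy : φ (b.1.val + b.2.val • w) = s := by
    rw [hbs, map_add, map_smul, hφw, smul_eq_mul, mul_one]
  have hdown : ∀ ε : ℝ, 0 < ε → s ≤ φ x + ((1 / 2 : ℝ) ^ l + ε) := by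
    intro ε hε
    have h3 := hlt ε hε
    rw [Metric.hausdorffEDist_comm] at h3
    obtain ⟨z, hz, hyz⟩ := Metric.exists_edist_lt_of_hausdorffEDist_lt hy h3
    rw [edist_lt_ofReal] at hyz
    have h4 := hlip (b.1.val + b.2.val • w) z
    have h5 : φ z ≤ φ x := hmax ⟨z, hz, rfl⟩
    rw [hφy] at h4
    linarith
  have h3 : φ x ≤ s + (1 / 2 : ℝ) ^ l := le_of_forall_pos_le_add fun ε hε => by
    linarith [hup ε hε]
  have h4 : s ≤ φ x + (1 / 2 : ℝ) ^ l := le_of_forall_pos_le_add fun ε hε => by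
    linarith [hdown ε hε]
  exact abs_le.2 ⟨by linarith, by linarith⟩

end BallCode

/-- Each coordinate of the end point `p` is the maximum or the minimum of that coordinate on the
segment. -/
theorem exists_computable_coord {p q : Plane} (hpq : segment ℝ p q ⊆ unitDisk)
    (hcomp : IsComputableCompact (segment ℝ p q)) (i : Fin 2) :
    ∃ c : ℕ → RatCode, Computable c ∧ ∀ l, |p i - (c l).val| ≤ (1 / 2 : ℝ) ^ l := by
  obtain ⟨e, hep, he⟩ : ∃ e : PtCode → RatCode, Primrec e ∧ ∀ c, (e c).val = c.val i := by
    fin_cases i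
    · exact ⟨fun c => c.1, by fun_prop, fun c => by simp [PtCode.val]⟩
    · exact ⟨fun c => c.2, by fun_prop, fun c => by simp [PtCode.val]⟩
  set φ : Plane →L[ℝ] ℝ := EuclideanSpace.proj (𝕜 := ℝ) i
  have hφ : ∀ x : Plane, φ x = x i := fun x => rfl
  have hw : ‖stdVec i‖ = 1 := by simp [stdVec]
  have hφw : φ (stdVec i) = 1 := by simp [hφ, stdVec]
  have hseg : ∀ s : ℝ, φ (p + s • (q - p)) = p i + s * (q i - p i) := fun s => by
    simp [hφ]
  -- each coordinate of an end point is extremal on the segment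
  rcases le_total (q i) (p i) with h | h
  · refine BallCode.exists_computable_max hcomp hpq he hep
      (fun x => (le_abs_self _).trans (abs_coord_le x i)) hw hφw (φ := φ)
      ⟨⟨p, left_mem_segment ℝ p q, rfl⟩, ?_⟩
    rintro - ⟨x, hx, rfl⟩
    obtain ⟨s, hs, rfl⟩ := exists_mem_segment_iff.1 hx
    rw [hseg]
    nlinarith [mul_nonneg hs.1 (sub_nonneg.2 h)]
  · obtain ⟨c, hc, hc'⟩ := BallCode.exists_computable_max (φ := -φ) (e := fun c => (e c).neg)
      (w := -stdVec i) (M := -p i) hcomp hpq (fun c => by simp [he, hφ]) (by fun_prop)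
      (fun x => by
        have := (neg_le_abs (x i)).trans (abs_coord_le x i)
        simpa [hφ] using this)
      (by rw [norm_neg, hw]) (by simp [hφw]) ⟨⟨p, left_mem_segment ℝ p q, by simp [hφ]⟩, by
        rintro - ⟨x, hx, rfl⟩
        obtain ⟨s, hs, rfl⟩ := exists_mem_segment_iff.1 hx
        rw [neg_apply, hseg]
        nlinarith [mul_nonneg hs.1 (sub_nonneg.2 h)]⟩
    refine ⟨fun l => (c l).neg, Computable.comp (f := RatCode.neg)
      (Primrec.to_comp (by fun_prop)) hc, fun l => ?_⟩
    have := hc' l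
    rw [abs_sub_comm] at this
    rw [RatCode.val_neg]
    rw [show p i - -(c l).val = (c l).val - -p i by ring]
    exact this

theorem exists_computable_endpoint {p q : Plane} (hpq : segment ℝ p q ⊆ unitDisk)
    (hcomp : IsComputableCompact (segment ℝ p q)) :
    ∃ c : ℕ → PtCode, Computable c ∧ ∀ m, ‖p - (c m).val‖ ≤ 1 / ((m : ℝ) + 1) := by
  obtain ⟨c0, h0, h0'⟩ := exists_computable_coord hpq hcomp 0
  obtain ⟨c1, h1, h1'⟩ := exists_computable_coord hpq hcomp 1
  refine ⟨fun m => (c0 (m + 1), c1 (m + 1)),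
    (h0.comp Computable.succ).pair (h1.comp Computable.succ), fun m => ?_⟩
  refine (norm_le_norm₁ _).trans (le_trans ?_ (half_pow_le m))
  have e0 := h0' (m + 1)
  have e1 := h1' (m + 1)
  rw [pow_succ] at e0 e1
  simp only [norm₁, PtCode.val, PiLp.sub_apply, Matrix.cons_val_zero, Matrix.cons_val_one]
  linarith

/-! ### Certificates -/

theorem PrimrecPred.forall_lt_comp {γ : Type} [Primcodable γ] {n : γ → ℕ} {p : ℕ → γ → Prop}
    (hn : Primrec n) (hp : PrimrecPred fun x : ℕ × γ => p x.1 x.2) :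
    PrimrecPred fun x => ∀ i < n x, p i x :=
  ((PrimrecRel.forall_mem_list (R := p) hp).comp (Primrec.list_range.comp hn) Primrec.id).of_eq
    fun x => by simp

namespace RatCode

/-- The code of `1 / 2`. -/
def half : RatCode := unitFrac 1

@[simp] theorem val_half : half.val = 1 / 2 := by
  rw [half, val_unitFrac]; norm_num

end RatCode

/-- A certificate for an approximate value of the Poincaré map and of its Jacobian. It consists of
natural numbers `(m, H, l, Na, Nb, N)` and `(B, A, R, V, W, r)`, rational numbers
`(σ, s, E, J₁, J₂)`, two lists of points `(z, a)` and the points `(y, d₀, d₁)`. -/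
abbrev Certificate : Type :=
  (ℕ × ℕ × ℕ × ℕ × ℕ × ℕ) × (ℕ × ℕ × ℕ × ℕ × ℕ × ℕ) ×
    (RatCode × RatCode × RatCode × RatCode × RatCode) × (List PtCode × List PtCode) ×
    (PtCode × PtCode × PtCode)

namespace Certificate

variable (c : Certificate)

/-- The index of the entries used of the names of the field, the point and the end points. -/
abbrev m : ℕ := c.1.1
/-- The step of the polygon is `1 / (H + 1)`. -/
abbrev H : ℕ := c.1.2.1
/-- The index of the entry of the name of the field used for the divergence. -/
abbrev l : ℕ := c.1.2.2.1
/-- The vertices up to this index belong to the first transversal phase of the trajectory. -/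
abbrev Na : ℕ := c.1.2.2.2.1
/-- The last transversal phase, which contains the crossing, starts at this index. -/
abbrev Nb : ℕ := c.1.2.2.2.2.1
/-- The number of steps of the polygon. -/
abbrev N : ℕ := c.1.2.2.2.2.2
/-- A common bound for the field, its derivative and the rational data of the certificate. -/
abbrev B : ℕ := c.2.1.1
/-- A bound for the separating functionals. -/
abbrev A : ℕ := c.2.1.2.1
/-- The number that determines `ρ`. -/
abbrev R : ℕ := c.2.1.2.2.1
/-- The number that determines `η`. -/
abbrev V : ℕ := c.2.1.2.2.2.1
/-- The number that determines `ω`. -/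
abbrev W : ℕ := c.2.1.2.2.2.2.1
/-- The number of factors in the powers that bound the exponential. -/
abbrev r : ℕ := c.2.1.2.2.2.2.2
/-- The factor that normalizes the transversality to the segment. -/
abbrev σ : RatCode := c.2.2.1.1
/-- The parameter on the segment of a point near the crossing. -/
abbrev s : RatCode := c.2.2.1.2.1
/-- The approximate value of the exponential in Liouville's formula. -/
abbrev E : RatCode := c.2.2.1.2.2.1
/-- A lower bound for the integral of the divergence is `r * J₁`. -/
abbrev J₁ : RatCode := c.2.2.1.2.2.2.1
/-- An upper bound for the integral of the divergence is `r * J₂`. -/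
abbrev J₂ : RatCode := c.2.2.1.2.2.2.2
/-- The vertices of the polygon. -/
abbrev z (i : ℕ) : PtCode := c.2.2.2.1.1.getD i default
/-- The functional that separates the vertex `z i` from the segment. -/
abbrev a (i : ℕ) : PtCode := c.2.2.2.1.2.getD i default
/-- The approximate value of the Poincaré map. -/
abbrev y : PtCode := c.2.2.2.2.1
/-- The approximate first column of the Jacobian. -/
abbrev d₀ : PtCode := c.2.2.2.2.2.1
/-- The approximate second column of the Jacobian. -/
abbrev d₁ : PtCode := c.2.2.2.2.2.2

/-- The accuracy of the data. -/
def μ : ℝ := 1 / ((c.m : ℝ) + 1)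
/-- The time step. -/
def h : ℝ := 1 / ((c.H : ℝ) + 1)
/-- The radius of the tube about the polygon that contains the trajectory. -/
def ρ : ℝ := 1 / ((c.R : ℝ) + 1)
/-- The bound for the length of the arc of the trajectory that contains the crossing. -/
def η : ℝ := 1 / ((c.V : ℝ) + 1)
/-- The final accuracy, up to a constant. -/
def ω : ℝ := 1 / ((c.W : ℝ) + 1)

/-- The bound for the error of the Riemann sum `h ∑ div f (z i)` for the integral of the divergence
along the trajectory, up to the time of return. -/
def ζ (F₂ : FieldCode) : ℝ :=
  c.N * c.h * (2 * (1 / ((c.l : ℝ) + 1)) + F₂.div.bound.val * c.ρ) + c.η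

/-- The inequalities between rational numbers that make a certificate valid. The field is given
through three entries `F₀`, `F₁`, `F₂` of its name, the segment through approximations `p'` and `q'`
of its end points, the point through the approximation `X`. The points `z i` are the vertices of an
Euler polygon for the trajectory. It is transversal to the line before the time `Na h` and
after `Nb h`, between these times it avoids the segment (as the functionals `a i` show), and between
`Nb h` and `N h` it crosses the line. The integral of the divergence `J` satisfies
`(1 + J₁) ^ r ≤ exp J ≤ (1 - J₂) ^ (-r)` whenever `r J₁ ≤ J ≤ r J₂`, which makes the bounds for the
exponential rational. -/
structure IsValid (F₀ F₁ F₂ : FieldCode) (X p' q' : PtCode) (n : ℕ) : Prop where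
  bound : 2 + 2 * F₀.bound.val ≤ c.B
  abs_σ_le : |c.σ.val| ≤ c.B
  E_nonneg : 0 ≤ c.E.val
  E_le : c.E.val ≤ c.B
  d₀_le : norm₁ c.d₀.val ≤ c.B
  d₁_le : norm₁ c.d₁.val ≤ c.B
  mem : ∀ i < c.N + 1, inner ℝ (c.z i).val (c.z i).val ≤ 1
  start : norm₁ ((c.z 0).val - X.val) ≤ 4 * c.μ
  step : ∀ i < c.N, norm₁ ((c.z (i + 1)).val - (c.z i).val - c.h • F₁.eval (c.z i).val)
    ≤ 8 * (c.h * c.μ)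
  tube : (1 + c.B * c.h) ^ c.N * (5 * c.μ + c.N * (c.h * (9 * c.μ + c.B * c.B * c.h)))
    + c.B * c.h ≤ c.ρ
  μ_le : c.μ ≤ c.ρ
  ρ_le : c.ρ ≤ c.ω
  Na_pos : 1 ≤ c.Na
  Na_lt : c.Na < c.Nb
  Nb_lt : c.Nb < c.N
  transversal : ∀ i < c.N, (c.Na ≤ i ∧ i < c.Nb) ∨
    1 ≤ c.σ.val * wedge (q'.val - p'.val) (F₁.eval (c.z i).val)
  separated : ∀ i < c.N, (i < c.Na ∨ c.Nb ≤ i) ∨ norm₁ (c.a i).val ≤ c.A ∧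
    1 ≤ inner ℝ (c.a i).val ((c.z i).val - p'.val) ∧
    1 ≤ inner ℝ (c.a i).val ((c.z i).val - q'.val)
  A_le : 4 * (c.A * c.ρ) ≤ 1
  below : c.σ.val * wedge (q'.val - p'.val) ((c.z c.Nb).val - p'.val) ≤ -(11 * (c.B * c.ρ))
  above : 11 * (c.B * c.ρ) ≤ c.σ.val * wedge (q'.val - p'.val) ((c.z c.N).val - p'.val)
  s_nonneg : 0 ≤ c.s.val
  s_le : c.s.val ≤ 1
  near_segment : norm₁ (c.y.val - p'.val - c.s.val • (q'.val - p'.val)) ≤ c.ω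
  near_crossing : norm₁ ((c.z c.Nb).val - c.y.val) ≤ c.ω
  arc_le : c.B * (((c.N - c.Nb : ℕ) : ℝ) * c.h) ≤ c.η
  η_le : c.η ≤ c.ω
  integral_ge : c.r * c.J₁.val ≤
    c.h * ∑ i ∈ Finset.range c.Nb, F₂.div.eval (c.z i).val - c.ζ F₂
  integral_le : c.h * ∑ i ∈ Finset.range c.Nb, F₂.div.eval (c.z i).val + c.ζ F₂ ≤ c.r * c.J₂.val
  J₁_ge : 0 ≤ 1 + c.J₁.val
  J₂_le : 0 ≤ 1 - c.J₂.val
  exp_ge : c.E.val ≤ (1 + c.J₁.val) ^ c.r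
  exp_le : 1 ≤ (c.E.val + c.ω) * (1 - c.J₂.val) ^ c.r
  jacobian₀ : norm₁ (wedge (F₁.eval (c.z c.Nb).val) (q'.val - p'.val) • c.d₀.val -
    (c.E.val * wedge (F₁.eval (c.z 0).val) (stdVec 0)) • (q'.val - p'.val)) ≤ c.ω
  jacobian₁ : norm₁ (wedge (F₁.eval (c.z c.Nb).val) (q'.val - p'.val) • c.d₁.val -
    (c.E.val * wedge (F₁.eval (c.z 0).val) (stdVec 1)) • (q'.val - p'.val)) ≤ c.ω
  precision : 100 * (c.B * c.B * c.B * c.ω) ≤ (1 / 2) ^ n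

section code

open RatCode

/-- The code of the number `ζ`. -/
def ζCode (F₂ : FieldCode) : RatCode :=
  (((ofNat c.N).mul (unitFrac c.H)).mul (((ofNat 2).mul (unitFrac c.l)).add
    (F₂.div.bound.mul (unitFrac c.R)))).add (unitFrac c.V)

@[simp] theorem val_ζCode (F₂ : FieldCode) : (c.ζCode F₂).val = c.ζ F₂ := by
  simp [ζCode, ζ, h, ρ, η]

/-- The code of the left-hand sides in `IsValid.jacobian₀` and `IsValid.jacobian₁`. -/
def jacobianCode (F₁ : FieldCode) (p' q' d e : PtCode) : RatCode :=
  ((PtCode.smul (PtCode.det (F₁.evalCode (c.z c.Nb)) (q'.sub p')) d).sub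
    (PtCode.smul (c.E.mul (PtCode.det (F₁.evalCode (c.z 0)) e)) (q'.sub p'))).norm₁

/-- The code of the sum in `IsValid.integral_ge` and `IsValid.integral_le`. -/
def integralCode (F₂ : FieldCode) : RatCode :=
  (unitFrac c.H).mul (sumTo (fun i => F₂.div.evalCode (c.z i)) c.Nb)

@[simp] theorem val_integralCode (F₂ : FieldCode) : (c.integralCode F₂).val =
    c.h * ∑ i ∈ Finset.range c.Nb, F₂.div.eval (c.z i).val := by
  simp [integralCode, h, PolyCode.val_evalCode]

/-- The conditions on the Euler polygon, in terms of codes. -/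
def CheckPolygon (F₁ : FieldCode) (p' q' : PtCode) : Prop :=
  (∀ i < c.N + 1, le (PtCode.dot (c.z i) (c.z i)) (ofNat 1)) ∧
  (∀ i < c.N, le (((c.z (i + 1)).sub (c.z i)).sub
    (PtCode.smul (unitFrac c.H) (F₁.evalCode (c.z i)))).norm₁
    ((ofNat 8).mul ((unitFrac c.H).mul (unitFrac c.m)))) ∧
  (∀ i < c.N, (c.Na ≤ i ∧ i < c.Nb) ∨
    le (ofNat 1) (c.σ.mul (PtCode.det (q'.sub p') (F₁.evalCode (c.z i))))) ∧
  (∀ i < c.N, (i < c.Na ∨ c.Nb ≤ i) ∨ le (c.a i).norm₁ (ofNat c.A) ∧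
    le (ofNat 1) (PtCode.dot (c.a i) ((c.z i).sub p')) ∧
    le (ofNat 1) (PtCode.dot (c.a i) ((c.z i).sub q')))

/-- The bounds between the parameters, in terms of codes. -/
def CheckBounds (F₀ : FieldCode) (n : ℕ) : Prop :=
  le ((ofNat 2).add ((ofNat 2).mul F₀.bound)) (ofNat c.B) ∧
  le c.σ.abs (ofNat c.B) ∧ le (ofNat 0) c.E ∧ le c.E (ofNat c.B) ∧
  le c.d₀.norm₁ (ofNat c.B) ∧ le c.d₁.norm₁ (ofNat c.B) ∧
  le ((((ofNat 1).add ((ofNat c.B).mul (unitFrac c.H))).pow c.N |>.mul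
    (((ofNat 5).mul (unitFrac c.m)).add ((ofNat c.N).mul ((unitFrac c.H).mul
      (((ofNat 9).mul (unitFrac c.m)).add (((ofNat c.B).mul (ofNat c.B)).mul (unitFrac c.H))))))).add
    ((ofNat c.B).mul (unitFrac c.H))) (unitFrac c.R) ∧
  le (unitFrac c.m) (unitFrac c.R) ∧ le (unitFrac c.R) (unitFrac c.W) ∧
  1 ≤ c.Na ∧ c.Na < c.Nb ∧ c.Nb < c.N ∧
  le ((ofNat 4).mul ((ofNat c.A).mul (unitFrac c.R))) (ofNat 1) ∧
  le (ofNat 0) c.s ∧ le c.s (ofNat 1) ∧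
  le ((ofNat c.B).mul ((ofNat (c.N - c.Nb)).mul (unitFrac c.H))) (unitFrac c.V) ∧
  le (unitFrac c.V) (unitFrac c.W) ∧
  le (ofNat 0) ((ofNat 1).add c.J₁) ∧ le (ofNat 0) ((ofNat 1).sub c.J₂) ∧
  le c.E (((ofNat 1).add c.J₁).pow c.r) ∧
  le (ofNat 1) ((c.E.add (unitFrac c.W)).mul (((ofNat 1).sub c.J₂).pow c.r)) ∧
  le ((ofNat 100).mul ((((ofNat c.B).mul (ofNat c.B)).mul (ofNat c.B)).mul (unitFrac c.W)))
    (half.pow n)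

/-- The conditions on the crossing and on the derivative, in terms of codes. -/
def CheckCrossing (F₁ F₂ : FieldCode) (X p' q' : PtCode) : Prop :=
  le ((c.z 0).sub X).norm₁ ((ofNat 4).mul (unitFrac c.m)) ∧
  le (c.σ.mul (PtCode.det (q'.sub p') ((c.z c.Nb).sub p')))
    (neg ((ofNat 11).mul ((ofNat c.B).mul (unitFrac c.R)))) ∧
  le ((ofNat 11).mul ((ofNat c.B).mul (unitFrac c.R)))
    (c.σ.mul (PtCode.det (q'.sub p') ((c.z c.N).sub p'))) ∧
  le ((c.y.sub p').sub (PtCode.smul c.s (q'.sub p'))).norm₁ (unitFrac c.W) ∧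
  le ((c.z c.Nb).sub c.y).norm₁ (unitFrac c.W) ∧
  le ((ofNat c.r).mul c.J₁) ((c.integralCode F₂).sub (c.ζCode F₂)) ∧
  le ((c.integralCode F₂).add (c.ζCode F₂)) ((ofNat c.r).mul c.J₂) ∧
  le (c.jacobianCode F₁ p' q' c.d₀ (ofNat 1, ofNat 0)) (unitFrac c.W) ∧
  le (c.jacobianCode F₁ p' q' c.d₁ (ofNat 0, ofNat 1)) (unitFrac c.W)

/-- Validity of a certificate is a condition on codes. -/
theorem isValid_iff {F₀ F₁ F₂ : FieldCode} {X p' q' : PtCode} {n : ℕ} :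
    c.IsValid F₀ F₁ F₂ X p' q' n ↔
      c.CheckPolygon F₁ p' q' ∧ c.CheckBounds F₀ n ∧ c.CheckCrossing F₁ F₂ X p' q' := by
  have e0 : PtCode.val (ofNat 1, ofNat 0) = stdVec 0 := by
    ext i; fin_cases i <;> simp [PtCode.val, stdVec]
  have e1 : PtCode.val (ofNat 0, ofNat 1) = stdVec 1 := by
    ext i; fin_cases i <;> simp [PtCode.val, stdVec]
  simp only [CheckPolygon, CheckBounds, CheckCrossing, jacobianCode, le_iff, val_add, val_sub,
    val_mul, val_neg, val_abs, val_pow, val_ofNat, val_unitFrac, val_ζCode, val_integralCode,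
    val_half, PtCode.val_norm₁, PtCode.val_det, PtCode.val_dot, PtCode.val_sub,
    PtCode.val_smul, FieldCode.val_evalCode, e0, e1, Nat.cast_ofNat, Nat.cast_one, Nat.cast_zero]
  constructor
  · intro v
    exact ⟨⟨v.mem, v.step, v.transversal, v.separated⟩,
      ⟨v.bound, v.abs_σ_le, v.E_nonneg, v.E_le, v.d₀_le, v.d₁_le, v.tube, v.μ_le, v.ρ_le,
        v.Na_pos, v.Na_lt, v.Nb_lt, v.A_le, v.s_nonneg, v.s_le, v.arc_le, v.η_le, v.J₁_ge, v.J₂_le,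
        v.exp_ge, v.exp_le, v.precision⟩,
      v.start, v.below, v.above, v.near_segment, v.near_crossing, v.integral_ge, v.integral_le,
      v.jacobian₀, v.jacobian₁⟩
  · rintro ⟨⟨g1, g2, g3, g4⟩, ⟨b1, b2, b3, b4, b5, b6, b7, b8, b9, b10, b11, b12, b13, b14, b15,
      b16, b17, b18, b19, b20, b21, b22⟩, c1, c2, c3, c4, c5, c6, c7, c8, c9⟩
    exact ⟨b1, b2, b3, b4, b5, b6, g1, c1, g2, b7, b8, b9, b10, b11, b12, g3, g4, b13, c2, c3,
      b14, b15, c4, c5, b16, b17, c6, c7, b18, b19, b20, b21, c8, c9, b22⟩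

set_option synthInstance.maxSize 2000
set_option synthInstance.maxHeartbeats 400000

/-- The data of the check: a certificate, three coded fields, three coded points, the precision. -/
abbrev Input : Type :=
  Certificate × (FieldCode × FieldCode × FieldCode) × (PtCode × PtCode × PtCode) × ℕ

theorem primrecPred_checkPolygon : PrimrecPred fun x : Input =>
    x.1.CheckPolygon x.2.1.2.1 x.2.2.1.2.1 x.2.2.1.2.2 := by
  have hN : Primrec fun x : Input => x.1.N := by fun_prop
  refine PrimrecPred.and ?_ (PrimrecPred.and ?_ (PrimrecPred.and ?_ ?_))
  · refine PrimrecPred.forall_lt_comp (p := fun i (x : Input) =>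
      le (PtCode.dot (x.1.z i) (x.1.z i)) (ofNat 1))
      (Primrec.succ.comp hN) ?_
    exact primrec_le (by fun_prop) (by fun_prop)
  · refine PrimrecPred.forall_lt_comp (p := fun i (x : Input) =>
      le (((x.1.z (i + 1)).sub (x.1.z i)).sub
        (PtCode.smul (unitFrac x.1.H) (x.2.1.2.1.evalCode (x.1.z i)))).norm₁
        ((ofNat 8).mul ((unitFrac x.1.H).mul (unitFrac x.1.m)))) hN ?_
    exact primrec_le (by fun_prop) (by fun_prop)
  · refine PrimrecPred.forall_lt_comp (p := fun i (x : Input) => (x.1.Na ≤ i ∧ i < x.1.Nb) ∨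
      le (ofNat 1) (x.1.σ.mul (PtCode.det (x.2.2.1.2.2.sub x.2.2.1.2.1)
        (x.2.1.2.1.evalCode (x.1.z i))))) hN ?_
    refine PrimrecPred.or (PrimrecPred.and ?_ ?_) (primrec_le (by fun_prop) (by fun_prop))
    · exact Primrec.nat_le.comp (f := fun x : ℕ × Input => x.2.1.Na) (by fun_prop)
        (g := fun x : ℕ × Input => x.1) (by fun_prop)
    · exact Primrec.nat_lt.comp (f := fun x : ℕ × Input => x.1) (by fun_prop)
        (g := fun x : ℕ × Input => x.2.1.Nb) (by fun_prop)
  · refine PrimrecPred.forall_lt_comp (p := fun i (x : Input) => (i < x.1.Na ∨ x.1.Nb ≤ i) ∨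
      le (x.1.a i).norm₁ (ofNat x.1.A) ∧
        le (ofNat 1) (PtCode.dot (x.1.a i) ((x.1.z i).sub x.2.2.1.2.1)) ∧
        le (ofNat 1) (PtCode.dot (x.1.a i) ((x.1.z i).sub x.2.2.1.2.2))) hN ?_
    refine PrimrecPred.or (PrimrecPred.or ?_ ?_) (PrimrecPred.and ?_ (PrimrecPred.and ?_ ?_))
    · exact Primrec.nat_lt.comp (f := fun x : ℕ × Input => x.1) (by fun_prop)
        (g := fun x : ℕ × Input => x.2.1.Na) (by fun_prop)
    · exact Primrec.nat_le.comp (f := fun x : ℕ × Input => x.2.1.Nb) (by fun_prop)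
        (g := fun x : ℕ × Input => x.1) (by fun_prop)
    · exact primrec_le (by fun_prop) (by fun_prop)
    · exact primrec_le (by fun_prop) (by fun_prop)
    · exact primrec_le (by fun_prop) (by fun_prop)

theorem primrecPred_checkBounds : PrimrecPred fun x : Input =>
    x.1.CheckBounds x.2.1.1 x.2.2.2 := by
  refine .and ?_ <| .and ?_ <| .and ?_ <| .and ?_ <| .and ?_ <| .and ?_ <| .and ?_ <| .and ?_ <|
    .and ?_ <| .and ?_ <| .and ?_ <| .and ?_ <| .and ?_ <| .and ?_ <| .and ?_ <| .and ?_ <|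
    .and ?_ <| .and ?_ <| .and ?_ <| .and ?_ <| .and ?_ ?_
  case refine_10 =>
    exact Primrec.nat_le.comp (f := fun _ : Input => 1) (by fun_prop)
      (g := fun x : Input => x.1.Na) (by fun_prop)
  case refine_11 =>
    exact Primrec.nat_lt.comp (f := fun x : Input => x.1.Na) (by fun_prop)
      (g := fun x : Input => x.1.Nb) (by fun_prop)
  case refine_12 =>
    exact Primrec.nat_lt.comp (f := fun x : Input => x.1.Nb) (by fun_prop)
      (g := fun x : Input => x.1.N) (by fun_prop)
  all_goals exact primrec_le (by fun_prop) (by fun_prop)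

theorem primrecPred_checkCrossing : PrimrecPred fun x : Input =>
    x.1.CheckCrossing x.2.1.2.1 x.2.1.2.2 x.2.2.1.1 x.2.2.1.2.1 x.2.2.1.2.2 := by
  have h1 : Primrec fun x : Input => x.1.integralCode x.2.1.2.2 := by
    unfold integralCode
    exact primrec_mul (by fun_prop) (primrec_sumTo
      (f := fun (x : Input) i => x.2.1.2.2.div.evalCode (x.1.z i)) (by fun_prop) (by fun_prop))
  have h2 : Primrec fun x : Input => x.1.ζCode x.2.1.2.2 := by
    unfold ζCode; fun_prop
  have h3 : ∀ (d : Certificate → PtCode) (_ : Primrec d) (e : PtCode), Primrec fun x : Input =>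
      x.1.jacobianCode x.2.1.2.1 x.2.2.1.2.1 x.2.2.1.2.2 (d x.1) e := by
    intro d hd e
    unfold jacobianCode
    fun_prop
  refine .and ?_ <| .and ?_ <| .and ?_ <| .and ?_ <| .and ?_ <| .and ?_ <| .and ?_ <| .and ?_ ?_
  case refine_8 => exact primrec_le (h3 _ (by fun_prop) _) (by fun_prop)
  case refine_9 => exact primrec_le (h3 _ (by fun_prop) _) (by fun_prop)
  all_goals exact primrec_le (by fun_prop) (by fun_prop)

theorem primrecPred_isValid : PrimrecPred fun x : Input =>
    x.1.IsValid x.2.1.1 x.2.1.2.1 x.2.1.2.2 x.2.2.1.1 x.2.2.1.2.1 x.2.2.1.2.2 x.2.2.2 :=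
  (primrecPred_checkPolygon.and (primrecPred_checkBounds.and primrecPred_checkCrossing)).of_eq
    fun x => (isValid_iff x.1).symm

end code

end Certificate

/-! ### Perturbation estimates -/

theorem abs_wedge_sub_le (a a' b b' : Plane) :
    |wedge a b - wedge a' b'| ≤ ‖a - a'‖ * ‖b‖ + ‖a'‖ * ‖b - b'‖ := by
  have h : wedge a b - wedge a' b' = wedge (a - a') b + wedge a' (b - b') := by
    rw [wedge_sub_left, wedge_sub_right]; ring
  rw [h]
  exact (abs_add_le _ _).trans (add_le_add (abs_wedge_le _ _) (abs_wedge_le _ _))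

/-- The field `f'` approximates `f` up to `μ` on the disk, and the points `p'` and `q'` approximate
the points `p` and `q` of the disk; `B` bounds the field `f`. -/
structure IsApproximation (f f' : Plane → Plane) (B μ : ℝ) (p q p' q' : Plane) : Prop where
  field : IsFieldBound f B
  one_le : 1 ≤ B
  nonneg : 0 ≤ μ
  le_one : μ ≤ 1
  left_mem : p ∈ unitDisk
  right_mem : q ∈ unitDisk
  left_le : ‖p - p'‖ ≤ μ
  right_le : ‖q - q'‖ ≤ μ
  field_le : ∀ x ∈ unitDisk, ‖f x - f' x‖ ≤ μ

namespace IsApproximation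

variable {f f' : Plane → Plane} {B μ s : ℝ} {p q p' q' z w : Plane}

theorem norm_dir_le (h : IsApproximation f f' B μ p q p' q') : ‖q - p‖ ≤ 2 := by
  have h1 := mem_unitDisk.1 h.left_mem
  have h2 := mem_unitDisk.1 h.right_mem
  exact (norm_sub_le _ _).trans (by linarith)

theorem norm_dir_sub_le (h : IsApproximation f f' B μ p q p' q') :
    ‖(q' - p') - (q - p)‖ ≤ 2 * μ := by
  have h1 : (q' - p') - (q - p) = (p - p') - (q - q') := by abel
  rw [h1]
  have h2 := h.left_le
  have h3 := h.right_le
  exact (norm_sub_le _ _).trans (by linarith)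

theorem norm_dir'_le (h : IsApproximation f f' B μ p q p' q') : ‖q' - p'‖ ≤ 4 := by
  have h1 := norm_le_norm_sub_add (q' - p') (q - p)
  have h2 := h.norm_dir_le
  have h3 := h.norm_dir_sub_le
  have h4 := h.le_one
  linarith

theorem norm_field'_le (h : IsApproximation f f' B μ p q p' q') (hz : z ∈ unitDisk) :
    ‖f' z‖ ≤ 2 * B := by
  have h1 := norm_le_norm_sub_add (f' z) (f z)
  have h2 := h.field_le z hz
  have h3 := h.field.norm_le z hz
  have h4 := h.one_le
  have h5 := h.le_one
  rw [norm_sub_rev] at h1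
  linarith

theorem norm_field_sub_le (h : IsApproximation f f' B μ p q p' q') (hz : z ∈ unitDisk)
    (hw : w ∈ unitDisk) (hs : ‖z - w‖ ≤ s) (hμ : μ ≤ s) : ‖f' z - f w‖ ≤ 2 * B * s := by
  have h1 : f' z - f w = (f z - f w) - (f z - f' z) := by abel
  have h2 := h.field_le z hz
  have h3 := h.field.sub_le z hz w hw
  have h4 := h.one_le
  have h5 := h.nonneg
  rw [h1]
  refine (norm_sub_le _ _).trans ?_
  nlinarith [mul_le_mul_of_nonneg_left hs (zero_le_one.trans h4), norm_nonneg (z - w)]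

theorem abs_wedge_field_sub_le (h : IsApproximation f f' B μ p q p' q') (hz : z ∈ unitDisk)
    (hw : w ∈ unitDisk) (hs : ‖z - w‖ ≤ s) (hμ : μ ≤ s) :
    |wedge (q' - p') (f' z) - wedge (q - p) (f w)| ≤ 8 * B * s := by
  have h1 := h.norm_field_sub_le hz hw hs hμ
  have h2 := h.norm_dir_sub_le
  have h3 := h.norm_dir_le
  have h4 := h.norm_field'_le hz
  have h5 := h.one_le
  have h6 := h.nonneg
  refine (abs_wedge_sub_le _ _ _ _).trans ?_
  have h7 := mul_le_mul (h2.trans (show 2 * μ ≤ 2 * s by linarith)) h4 (norm_nonneg _)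
    (by linarith)
  have h8 := mul_le_mul h3 h1 (norm_nonneg _) zero_le_two
  linarith

theorem abs_wedge_sub_point_le (h : IsApproximation f f' B μ p q p' q') (hz : z ∈ unitDisk)
    (hs : ‖z - w‖ ≤ s) (hμ : μ ≤ s) :
    |wedge (q' - p') (z - p') - wedge (q - p) (w - p)| ≤ 10 * s := by
  have h2 := h.norm_dir_sub_le
  have h3 := h.norm_dir_le
  have h6 := h.nonneg
  have h9 := h.le_one
  have h4 : ‖z - p'‖ ≤ 3 := by
    have e : z - p' = z - p + (p - p') := by abel
    rw [e]
    have e1 := norm_add_le (z - p) (p - p')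
    have e2 := norm_sub_le z p
    have e3 := mem_unitDisk.1 hz
    have e4 := mem_unitDisk.1 h.left_mem
    have e5 := h.left_le
    linarith
  have h1 : ‖(z - p') - (w - p)‖ ≤ 2 * s := by
    have e : (z - p') - (w - p) = (z - w) + (p - p') := by abel
    rw [e]
    have e5 := h.left_le
    exact (norm_add_le _ _).trans (by linarith)
  refine (abs_wedge_sub_le _ _ _ _).trans ?_
  have h7 := mul_le_mul (h2.trans (show 2 * μ ≤ 2 * s by linarith)) h4 (norm_nonneg _)
    (by linarith)
  have h8 := mul_le_mul h3 h1 (norm_nonneg _) zero_le_two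
  linarith

/-- The equation `wedge (f w₁) (q - p) • d = (E * wedge (f w₀) e) • (q - p)` characterizes the value
`d` at `e` of the derivative of the Poincaré map; its two sides vary little with the data. -/
theorem norm_jacobian_sub_le (h : IsApproximation f f' B μ p q p' q') {z₀ z₁ w₀ w₁ d e : Plane}
    {E : ℝ} (hz₀ : z₀ ∈ unitDisk) (hz₁ : z₁ ∈ unitDisk) (hw₀ : w₀ ∈ unitDisk) (hw₁ : w₁ ∈ unitDisk)
    (hs₀ : ‖z₀ - w₀‖ ≤ s) (hs₁ : ‖z₁ - w₁‖ ≤ s) (hμ : μ ≤ s) (he : ‖e‖ ≤ 1) (hd : ‖d‖ ≤ B)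
    (hE0 : 0 ≤ E) (hE : E ≤ B) :
    ‖(wedge (f' z₁) (q' - p') • d - (E * wedge (f' z₀) e) • (q' - p')) -
      (wedge (f w₁) (q - p) • d - (E * wedge (f w₀) e) • (q - p))‖ ≤ 18 * B ^ 2 * s := by
  have hB := h.one_le
  have hs : 0 ≤ s := h.nonneg.trans hμ
  have h1 : |wedge (f' z₁) (q' - p') - wedge (f w₁) (q - p)| ≤ 8 * B * s := by
    rw [wedge_comm (f' z₁), wedge_comm (f w₁), neg_sub_neg, abs_sub_comm]
    exact h.abs_wedge_field_sub_le hz₁ hw₁ hs₁ hμ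
  have h2 : |wedge (f' z₀) e - wedge (f w₀) e| ≤ 2 * B * s := by
    rw [← wedge_sub_left]
    refine (abs_wedge_le _ _).trans ?_
    have := h.norm_field_sub_le hz₀ hw₀ hs₀ hμ
    exact (mul_le_of_le_one_right (norm_nonneg _) he).trans this
  have h3 : |wedge (f w₀) e| ≤ B := (abs_wedge_le _ _).trans
    ((mul_le_of_le_one_right (norm_nonneg _) he).trans (h.field.norm_le _ hw₀))
  have h4 := h.norm_dir_sub_le
  have h5 := h.norm_dir'_le
  have e1 : (wedge (f' z₁) (q' - p') • d - (E * wedge (f' z₀) e) • (q' - p')) -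
      (wedge (f w₁) (q - p) • d - (E * wedge (f w₀) e) • (q - p)) =
      (wedge (f' z₁) (q' - p') - wedge (f w₁) (q - p)) • d
      - (E * (wedge (f' z₀) e - wedge (f w₀) e)) • (q' - p')
      - (E * wedge (f w₀) e) • ((q' - p') - (q - p)) := by module
  rw [e1]
  refine (norm_sub_le _ _).trans ((add_le_add (norm_sub_le _ _) le_rfl).trans ?_)
  simp only [norm_smul, Real.norm_eq_abs, abs_mul, abs_of_nonneg hE0]
  have k1 := mul_le_mul h1 hd (norm_nonneg _) (by positivity)
  have k2 := mul_le_mul (mul_le_mul hE h2 (abs_nonneg _) (by positivity)) h5 (norm_nonneg _)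
    (by positivity)
  have k3 := mul_le_mul (mul_le_mul hE h3 (abs_nonneg _) (by positivity))
    (h4.trans (show 2 * μ ≤ 2 * s by linarith)) (norm_nonneg _) (by positivity)
  nlinarith

end IsApproximation

/-! ### Euler polygons and Riemann sums along a trajectory -/

theorem exists_nat_mul_le_le {h t : ℝ} {j k : ℕ} (hjk : j < k) (ht : t ∈ Icc (j * h) (k * h)) :
    ∃ i, j ≤ i ∧ i < k ∧ i * h ≤ t ∧ t ≤ i * h + h := by
  induction k, hjk using Nat.le_induction with
  | base => exact ⟨j, le_rfl, Nat.lt_succ_self j, ht.1, by have := ht.2; push_cast at this; linarith⟩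
  | succ k hk ih =>
    rcases le_total t (k * h) with h1 | h1
    · obtain ⟨i, h2, h3, h4⟩ := ih ⟨ht.1, h1⟩
      exact ⟨i, h2, h3.trans (Nat.lt_succ_self k), h4⟩
    · exact ⟨k, (Nat.le_succ j).trans hk, Nat.lt_succ_self k, h1, by
        have := ht.2; push_cast at this; linarith⟩

namespace IsDiskFlow

variable {f g : Plane → Plane} {Φ : Plane → ℝ → Plane} {K L : NNReal} {B : ℝ} {x : Plane}

theorem hasDerivAt (h : IsDiskFlow f g Φ K L) (hx : x ∈ unitDisk) {t : ℝ} (ht : 0 ≤ t) :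
    HasDerivAt (Φ x) (f (Φ x t)) t := by
  rw [← h.eq _ (h.mem x hx t ht)]
  exact h.flow.deriv x t

theorem norm_sub_le (h : IsDiskFlow f g Φ K L) (hB : IsFieldBound f B) (hx : x ∈ unitDisk)
    {s t : ℝ} (hs : 0 ≤ s) (ht : 0 ≤ t) : ‖Φ x t - Φ x s‖ ≤ B * |t - s| :=
  (convex_Ici (0 : ℝ)).norm_image_sub_le_of_norm_hasDerivWithin_le
    (fun _ hr => (h.hasDerivAt hx hr).hasDerivWithinAt)
    (fun r hr => hB.norm_le _ (h.mem x hx r hr)) hs ht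

theorem norm_euler_step_le (h : IsDiskFlow f g Φ K L) (hB : IsFieldBound f B) (hB0 : 0 ≤ B)
    (hx : x ∈ unitDisk) {t d : ℝ} (ht : 0 ≤ t) (hd : 0 ≤ d) :
    ‖Φ x (t + d) - Φ x t - d • f (Φ x t)‖ ≤ B * B * d * d := by
  have h1 : ∀ r ∈ Icc t (t + d), HasDerivWithinAt (fun r => Φ x r - r • f (Φ x t))
      (f (Φ x r) - f (Φ x t)) (Icc t (t + d)) r := fun r hr => by
    have e := ((hasDerivAt_id r).smul_const (f (Φ x t)))
    rw [one_smul] at e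
    exact ((h.hasDerivAt hx (ht.trans hr.1)).sub e).hasDerivWithinAt
  have h2 : ∀ r ∈ Icc t (t + d), ‖f (Φ x r) - f (Φ x t)‖ ≤ B * B * d := fun r hr => by
    refine (hB.sub_le _ (h.mem x hx r (ht.trans hr.1)) _ (h.mem x hx t ht)).trans ?_
    rw [mul_assoc]
    refine mul_le_mul_of_nonneg_left ((h.norm_sub_le hB hx ht (ht.trans hr.1)).trans ?_) hB0
    refine mul_le_mul_of_nonneg_left ?_ hB0
    rw [abs_of_nonneg (by linarith [hr.1])]
    linarith [hr.2]
  have h3 := (convex_Icc t (t + d)).norm_image_sub_le_of_norm_hasDerivWithin_le h1 h2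
    (left_mem_Icc.2 (by linarith)) (right_mem_Icc.2 (by linarith))
  rw [add_sub_cancel_left, Real.norm_of_nonneg hd] at h3
  have e : Φ x (t + d) - Φ x t - d • f (Φ x t)
      = (Φ x (t + d) - (t + d) • f (Φ x t)) - (Φ x t - t • f (Φ x t)) := by module
  rw [e]
  exact h3

/-- The distance between a trajectory and an Euler polygon with inexact steps. -/
theorem norm_sub_euler_le (h : IsDiskFlow f g Φ K L) (hB : IsFieldBound f B) (hB0 : 0 ≤ B)
    (hx : x ∈ unitDisk) {f' : Plane → Plane} {μ d : ℝ} (hμ : 0 ≤ μ) (hd : 0 ≤ d)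
    (hf' : ∀ x ∈ unitDisk, ‖f x - f' x‖ ≤ μ) {z : ℕ → Plane} {N : ℕ}
    (hz : ∀ i ≤ N, z i ∈ unitDisk) (h0 : ‖z 0 - x‖ ≤ 5 * μ)
    (hstep : ∀ i < N, ‖z (i + 1) - z i - d • f' (z i)‖ ≤ 8 * (d * μ)) :
    ∀ i ≤ N, ‖z i - Φ x (i * d)‖ ≤
      (1 + B * d) ^ i * (5 * μ + i * (d * (9 * μ + B * B * d))) := by
  intro i
  induction i with
  | zero => intro _; simpa [h.flow.zero] using h0
  | succ i ih =>
    intro hi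
    have h1 := ih (Nat.le_of_succ_le hi)
    have ht : 0 ≤ (i : ℝ) * d := by positivity
    have h2 := hstep i hi
    have hzi := hz i (Nat.le_of_succ_le hi)
    have h3 := hf' _ hzi
    have h4 := hB.sub_le _ hzi _ (h.mem x hx _ ht)
    have h5 := h.norm_euler_step_le hB hB0 hx ht hd
    set u := Φ x (i * d)
    have e : z (i + 1) - Φ x ((i + 1 : ℕ) * d) = (z i - u) + d • (f (z i) - f u)
        - d • (f (z i) - f' (z i)) + (z (i + 1) - z i - d • f' (z i))
        - (Φ x (i * d + d) - u - d • f u) := by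
      have : ((i + 1 : ℕ) : ℝ) * d = i * d + d := by push_cast; ring
      rw [this]
      module
    rw [e]
    refine (_root_.norm_sub_le _ _).trans ((add_le_add ((norm_add_le _ _).trans
      (add_le_add ((_root_.norm_sub_le _ _).trans (add_le_add
        (norm_add_le _ _) le_rfl)) le_rfl)) le_rfl).trans ?_)
    rw [norm_smul, norm_smul, Real.norm_of_nonneg hd]
    have h6 := mul_le_mul_of_nonneg_left h4 hd
    have h7 := mul_le_mul_of_nonneg_left h3 hd
    set P := (1 + B * d) ^ i
    have hP : 1 ≤ P := one_le_pow₀ (le_add_of_nonneg_right (by positivity))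
    set a := d * (9 * μ + B * B * d)
    have ha : 0 ≤ a := by positivity
    have h8 : ‖z i - u‖ * (1 + B * d) ≤ P * (5 * μ + i * a) * (1 + B * d) :=
      mul_le_mul_of_nonneg_right h1 (by positivity)
    have h9 : a ≤ P * (1 + B * d) * a :=
      le_mul_of_one_le_left ha (one_le_mul_of_one_le_of_one_le hP
        (le_add_of_nonneg_right (by positivity)))
    have h10 : a = d * (9 * μ) + B * B * d * d := by ring
    have h11 : P * (1 + B * d) * (5 * μ + ((i + 1 : ℕ) : ℝ) * a)
        = P * (5 * μ + i * a) * (1 + B * d) + P * (1 + B * d) * a := by push_cast; ring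
    rw [pow_succ, h11]
    linarith

theorem continuous_divergence_comp (h : IsDiskFlow f g Φ K L) (hf : ContDiff ℝ 1 f) (x : Plane) :
    Continuous fun t => divergence f (Φ x t) :=
  continuous_tr.comp ((hf.continuous_fderiv one_ne_zero).comp (h.flow.continuous_time x))

/-- The error of a Riemann sum for the integral of the divergence along a trajectory. -/
theorem abs_integral_divergence_sub_le (h : IsDiskFlow f g Φ K L) (hf : ContDiff ℝ 1 f)
    {δ : ℕ → ℝ} {C d : ℝ} (hd : 0 ≤ d) {n : ℕ}
    (hδ : ∀ i < n, ∀ t ∈ Icc (i * d) (i * d + d), |divergence f (Φ x t) - δ i| ≤ C) :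
    |(∫ t in (0 : ℝ)..n * d, divergence f (Φ x t)) - d * ∑ i ∈ Finset.range n, δ i|
      ≤ n * d * C := by
  have hc := h.continuous_divergence_comp hf x
  induction n with
  | zero => simp
  | succ n ih =>
    have h1 := ih fun i hi => hδ i (hi.trans (Nat.lt_succ_self n))
    have h2 : |∫ t in (n * d : ℝ)..n * d + d, (divergence f (Φ x t) - δ n)| ≤ C * d := by
      have := intervalIntegral.norm_integral_le_of_norm_le_const (a := (n * d : ℝ))
        (b := n * d + d) (f := fun t => divergence f (Φ x t) - δ n) (C := C) fun t ht => by
          rw [uIoc_of_le (by linarith)] at ht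
          exact hδ n (Nat.lt_succ_self n) t ⟨ht.1.le, ht.2⟩
      rwa [add_sub_cancel_left, abs_of_nonneg hd] at this
    rw [intervalIntegral.integral_sub (hc.intervalIntegrable _ _) (by simp),
      intervalIntegral.integral_const, add_sub_cancel_left, smul_eq_mul] at h2
    have e : ((n + 1 : ℕ) : ℝ) * d = n * d + d := by push_cast; ring
    rw [e, ← intervalIntegral.integral_add_adjacent_intervals (hc.intervalIntegrable 0 (n * d))
      (hc.intervalIntegrable _ _), Finset.sum_range_succ]
    have e2 : ∀ a b s : ℝ, a + b - d * (s + δ n) = (a - d * s) + (b - d * δ n) :=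
      fun a b s => by ring
    rw [e2]
    refine (abs_add_le _ _).trans ?_
    linarith

end IsDiskFlow

/-! ### Valid certificates are correct -/

namespace Certificate

variable {c : Certificate}

theorem μ_pos (c : Certificate) : 0 < c.μ := by unfold μ; positivity
theorem h_pos (c : Certificate) : 0 < c.h := by unfold h; positivity
theorem ρ_pos (c : Certificate) : 0 < c.ρ := by unfold ρ; positivity
theorem ω_pos (c : Certificate) : 0 < c.ω := by unfold ω; positivity

theorem μ_le_one (c : Certificate) : c.μ ≤ 1 := by
  rw [μ, div_le_one (by positivity)]
  exact le_add_of_nonneg_left (Nat.cast_nonneg _)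

theorem isApproximation (c : Certificate) {F : ℕ → FieldCode} {f : Plane → Plane} {p q : Plane}
    {p' q' : PtCode} (hB : 2 + 2 * (F 0).bound.val ≤ c.B) (hf : Differentiable ℝ f)
    (hF : IsC1Name f F) (hpq : segment ℝ p q ⊆ unitDisk) (hp : ‖p - p'.val‖ ≤ c.μ)
    (hq : ‖q - q'.val‖ ≤ c.μ) :
    IsApproximation f (F c.m).eval c.B c.μ p q p'.val q'.val where
  field := hF.isFieldBound hf hB
  one_le := by linarith [(F 0).bound_nonneg]
  nonneg := c.μ_pos.le
  le_one := c.μ_le_one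
  left_mem := hpq (left_mem_segment ℝ p q)
  right_mem := hpq (right_mem_segment ℝ p q)
  left_le := hp
  right_le := hq
  field_le := fun _ hx => hF.norm_sub_le c.m hx

namespace IsValid

variable {F₀ F₁ F₂ : FieldCode} {X p' q' : PtCode} {n : ℕ} {f g : Plane → Plane}
  {Φ : Plane → ℝ → Plane} {K L : NNReal} {p q x : Plane} {P : Plane → Plane}

theorem one_le_B (hv : c.IsValid F₀ F₁ F₂ X p' q' n) : (1 : ℝ) ≤ c.B := by
  have h1 := hv.bound
  have h2 := F₀.bound_nonneg
  linarith

theorem le_half_pow (hv : c.IsValid F₀ F₁ F₂ X p' q' n) {k j : ℕ} (hk : k ≤ 100) (hj : j ≤ 3) :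
    k * (c.B : ℝ) ^ j * c.ω ≤ (1 / 2) ^ n := by
  refine le_trans ?_ hv.precision
  have h1 : (c.B : ℝ) ^ j ≤ (c.B : ℝ) ^ 3 := pow_le_pow_right₀ hv.one_le_B hj
  have h2 : (k : ℝ) ≤ 100 := by exact_mod_cast hk
  calc k * (c.B : ℝ) ^ j * c.ω ≤ 100 * (c.B : ℝ) ^ 3 * c.ω := by
        have := c.ω_pos
        gcongr
    _ = _ := by ring

theorem le_one (hv : c.IsValid F₀ F₁ F₂ X p' q' n) {k j : ℕ} (hk : k ≤ 100) (hj : j ≤ 3) :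
    k * (c.B : ℝ) ^ j * c.ω ≤ 1 :=
  (hv.le_half_pow hk hj).trans (pow_le_one₀ (by norm_num) (by norm_num))

theorem z_mem (hv : c.IsValid F₀ F₁ F₂ X p' q' n) {i : ℕ} (hi : i ≤ c.N) :
    (c.z i).val ∈ unitDisk := by
  have h1 := hv.mem i (Nat.lt_succ_of_le hi)
  rw [real_inner_self_eq_norm_sq, sq_le_one_iff₀ (norm_nonneg _)] at h1
  exact mem_unitDisk.2 h1

/-- The trajectory stays in the tube of radius `ρ` about the polygon. -/
theorem norm_z_sub_le (hv : c.IsValid F₀ F₁ F₂ X p' q' n) (hfl : IsDiskFlow f g Φ K L)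
    (ha : IsApproximation f F₁.eval c.B c.μ p q p'.val q'.val) (hx : x ∈ unitDisk)
    (hX : ‖x - X.val‖ ≤ c.μ) {i : ℕ} (hi : i ≤ c.N) {t : ℝ} (ht : t ∈ Icc (i * c.h) (i * c.h + c.h)) :
    ‖(c.z i).val - Φ x t‖ ≤ c.ρ := by
  have hB0 : (0 : ℝ) ≤ c.B := Nat.cast_nonneg _
  have hh := c.h_pos
  have hμ := c.μ_pos
  have h0 : ‖(c.z 0).val - x‖ ≤ 5 * c.μ := by
    have e : (c.z 0).val - x = ((c.z 0).val - X.val) - (x - X.val) := by abel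
    rw [e]
    have h1 := (norm_le_norm₁ _).trans hv.start
    exact (norm_sub_le _ _).trans (by linarith)
  have h1 := hfl.norm_sub_euler_le ha.field hB0 hx hμ.le hh.le ha.field_le
    (z := fun i => (c.z i).val) (N := c.N) (fun i hi => hv.z_mem hi) h0
    (fun i hi => (norm_le_norm₁ _).trans (hv.step i hi)) i hi
  have hi0 : (0 : ℝ) ≤ i * c.h := by positivity
  have h2 : ‖Φ x t - Φ x (i * c.h)‖ ≤ c.B * c.h := by
    refine (hfl.norm_sub_le ha.field hx hi0 (hi0.trans ht.1)).trans ?_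
    refine mul_le_mul_of_nonneg_left ?_ hB0
    rw [abs_of_nonneg (by linarith [ht.1])]
    linarith [ht.2]
  have h3 : (1 + c.B * c.h) ^ i * (5 * c.μ + i * (c.h * (9 * c.μ + c.B * c.B * c.h))) ≤
      (1 + c.B * c.h) ^ c.N * (5 * c.μ + c.N * (c.h * (9 * c.μ + c.B * c.B * c.h))) := by
    have : (i : ℝ) ≤ c.N := by exact_mod_cast hi
    refine mul_le_mul (pow_le_pow_right₀ (le_add_of_nonneg_right (by positivity)) hi) ?_
      (by positivity) (by positivity)
    gcongr
  have e : (c.z i).val - Φ x t = ((c.z i).val - Φ x (i * c.h)) - (Φ x t - Φ x (i * c.h)) := by abel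
  rw [e]
  refine (norm_sub_le _ _).trans ((add_le_add (h1.trans h3) h2).trans hv.tube)

theorem half_le_wedge (hv : c.IsValid F₀ F₁ F₂ X p' q' n)
    (ha : IsApproximation f F₁.eval c.B c.μ p q p'.val q'.val) {i : ℕ} (hi : i < c.N)
    (hi' : i < c.Na ∨ c.Nb ≤ i) {w : Plane} (hw : w ∈ unitDisk)
    (hd : ‖(c.z i).val - w‖ ≤ 5 * c.ω) : 1 / 2 ≤ c.σ.val * wedge (q - p) (f w) := by
  have hω := c.ω_pos
  have h1 := (hv.transversal i hi).resolve_left (by omega)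
  have h2 := ha.abs_wedge_field_sub_le (hv.z_mem hi.le) hw hd
    (by linarith [hv.μ_le, hv.ρ_le])
  have h3 := mul_le_mul hv.abs_σ_le h2 (abs_nonneg _) (Nat.cast_nonneg _)
  rw [← abs_mul, mul_sub] at h3
  have h4 := (le_abs_self _).trans h3
  have h5 := hv.le_one (k := 80) (j := 2) (by norm_num) (by norm_num)
  push_cast at h5
  nlinarith

/-- The separation of a vertex from the end points by a functional extends to the trajectory, and by
convexity to the whole segment. -/
theorem not_mem_segment (hv : c.IsValid F₀ F₁ F₂ X p' q' n)
    (ha : IsApproximation f F₁.eval c.B c.μ p q p'.val q'.val) {i : ℕ} (hi : i < c.N)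
    (hi1 : c.Na ≤ i) (hi2 : i < c.Nb) {w : Plane} (hd : ‖(c.z i).val - w‖ ≤ c.ρ) :
    w ∉ segment ℝ p q := by
  obtain ⟨h1, h2, h3⟩ := (hv.separated i hi).resolve_left (by omega)
  set a := (c.a i).val
  have hA : ‖a‖ ≤ c.A := (norm_le_norm₁ _).trans h1
  have key : ∀ r r' : Plane, ‖r - r'‖ ≤ c.μ → 1 ≤ inner ℝ a ((c.z i).val - r') →
      1 / 2 ≤ inner ℝ a (w - r) := by
    intro r r' hr h4
    have e : (c.z i).val - r' = (w - r) + (((c.z i).val - w) + (r - r')) := by abel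
    rw [e, inner_add_right] at h4
    have h5 := real_inner_le_norm a (((c.z i).val - w) + (r - r'))
    have h6 : ‖((c.z i).val - w) + (r - r')‖ ≤ 2 * c.ρ :=
      (norm_add_le _ _).trans (by linarith [hv.μ_le])
    have h7 := mul_le_mul hA h6 (norm_nonneg _) (Nat.cast_nonneg _)
    linarith [hv.A_le]
  intro hw
  obtain ⟨s, hs, rfl⟩ := exists_mem_segment_iff.1 hw
  have h4 := key p p'.val ha.left_le h2
  have h5 := key q q'.val ha.right_le h3
  have e1 : p + s • (q - p) - p = s • (q - p) := by module
  have e2 : p + s • (q - p) - q = (-(1 - s)) • (q - p) := by module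
  rw [e1, inner_smul_right] at h4
  rw [e2, inner_smul_right] at h5
  have h6 := mul_le_mul_of_nonneg_left h4 (sub_nonneg.2 hs.2)
  have h7 := mul_le_mul_of_nonneg_left h5 hs.1
  linarith

/-- The crossing found by the certificate is the first return to the segment. -/
theorem exists_crossing (hv : c.IsValid F₀ F₁ F₂ X p' q' n) (hfl : IsDiskFlow f g Φ K L)
    (ha : IsApproximation f F₁.eval c.B c.μ p q p'.val q'.val)
    (hret : ∀ x ∈ segment ℝ p q, ∃ τ > 0, Φ x τ ∈ segment ℝ p q)
    (hne : ∀ x ∈ segment ℝ p q, wedge (q - p) (g x) ≠ 0) (hpq : segment ℝ p q ⊆ unitDisk)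
    (hx : x ∈ segment ℝ p q) (hX : ‖x - X.val‖ ≤ c.μ) :
    ∃ θ ∈ Icc (c.Nb * c.h) (c.N * c.h), 0 < θ ∧ Φ x θ ∈ segment ℝ p q ∧
      (∀ t ∈ Ioo 0 θ, Φ x t ∉ segment ℝ p q) ∧ ‖(c.z c.Nb).val - Φ x θ‖ ≤ 2 * c.ω := by
  have hxd := hpq hx
  have hh := c.h_pos
  have hρ := c.ρ_pos
  have hω := c.ω_pos
  have hB1 := hv.one_le_B
  have hlx : wedge (q - p) (x - p) = 0 := by
    obtain ⟨s, _, hs⟩ := exists_mem_segment_iff.1 hx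
    rw [hs, wedge_line]
  have tube : ∀ i ≤ c.N, ∀ t ∈ Icc (i * c.h) (i * c.h + c.h), ‖(c.z i).val - Φ x t‖ ≤ c.ρ :=
    fun i hi t ht => hv.norm_z_sub_le hfl ha hxd hX hi ht
  have trans : ∀ i < c.N, (i < c.Na ∨ c.Nb ≤ i) → ∀ t ∈ Icc (i * c.h) (i * c.h + c.h),
      0 < c.σ.val * wedge (q - p) (g (Φ x t)) := by
    intro i hi hi' t ht
    have ht0 : 0 ≤ t := le_trans (by positivity) ht.1
    have h1 := hfl.mem x hxd t ht0
    have h2 := hv.half_le_wedge ha hi hi' h1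
      ((tube i hi.le t ht).trans (by linarith [hv.ρ_le]))
    rw [hfl.eq _ h1]
    linarith
  have hA : ∀ t ∈ Icc 0 (c.Na * c.h), 0 < c.σ.val * wedge (q - p) (g (Φ x t)) := by
    intro t ht
    obtain ⟨i, -, h2, h3, h4⟩ := exists_nat_mul_le_le (j := 0) hv.Na_pos (by simpa using ht)
    have := hv.Na_lt
    have := hv.Nb_lt
    exact trans i (by omega) (Or.inl h2) t ⟨h3, h4⟩
  have hC : ∀ t ∈ Icc (c.Nb * c.h) (c.N * c.h), 0 < c.σ.val * wedge (q - p) (g (Φ x t)) := by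
    intro t ht
    obtain ⟨i, h1, h2, h3, h4⟩ := exists_nat_mul_le_le hv.Nb_lt ht
    exact trans i h2 (Or.inr h1) t ⟨h3, h4⟩
  have hBm : ∀ t ∈ Icc (c.Na * c.h) (c.Nb * c.h), Φ x t ∉ segment ℝ p q := by
    intro t ht
    obtain ⟨i, h1, h2, h3, h4⟩ := exists_nat_mul_le_le hv.Na_lt ht
    have hi := h2.trans hv.Nb_lt
    exact hv.not_mem_segment ha hi h1 h2 (tube i hi.le t ⟨h3, h4⟩)
  have pos : ∀ i ≤ c.N, |c.σ.val * wedge (q'.val - p'.val) ((c.z i).val - p'.val) -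
      c.σ.val * wedge (q - p) (Φ x (i * c.h) - p)| ≤ c.B * (10 * c.ρ) := by
    intro i hi
    rw [← mul_sub, abs_mul]
    exact mul_le_mul hv.abs_σ_le (ha.abs_wedge_sub_point_le (hv.z_mem hi)
      (tube i hi _ ⟨le_rfl, by linarith⟩) hv.μ_le) (abs_nonneg _) (Nat.cast_nonneg _)
  have hBρ : 0 < c.B * c.ρ := mul_pos (by linarith) hρ
  have hb : c.σ.val * wedge (q - p) (Φ x (c.Nb * c.h) - p) < 0 := by
    have h1 := abs_le.1 (pos c.Nb hv.Nb_lt.le)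
    have h2 := hv.below
    linarith [h1.1]
  have hT : 0 < c.σ.val * wedge (q - p) (Φ x (c.N * c.h) - p) := by
    have h1 := abs_le.1 (pos c.N le_rfl)
    have h2 := hv.above
    linarith [h1.2]
  have hbN : (c.Nb * c.h : ℝ) ≤ c.N * c.h := by
    have : (c.Nb : ℝ) ≤ c.N := by exact_mod_cast hv.Nb_lt.le
    exact mul_le_mul_of_nonneg_right this hh.le
  obtain ⟨θ, hθ, hθ0, -⟩ := hfl.exists_unique_crossing hbN hC hb hT
  have hNa0 : (0 : ℝ) ≤ c.Na * c.h := by positivity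
  have hNb0 : (0 : ℝ) ≤ c.Nb * c.h := by positivity
  have hθpos : 0 < θ := hNb0.trans_lt hθ.1
  have hno := hfl.not_mem_segment_of_lt_crossing hlx hNa0 hA hBm hC hθ hθ0
  have hz : ‖(c.z c.Nb).val - Φ x θ‖ ≤ 2 * c.ω := by
    have h1 := tube c.Nb hv.Nb_lt.le (c.Nb * c.h) ⟨le_rfl, by linarith⟩
    have h2 := hfl.norm_sub_le ha.field hxd hNb0 hθpos.le
    have h3 : c.B * |θ - c.Nb * c.h| ≤ c.η := by
      refine le_trans (mul_le_mul_of_nonneg_left ?_ (Nat.cast_nonneg _)) hv.arc_le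
      rw [abs_of_nonneg (by linarith [hθ.1]), Nat.cast_sub hv.Nb_lt.le]
      linarith [hθ.2]
    have e : (c.z c.Nb).val - Φ x θ = ((c.z c.Nb).val - Φ x (c.Nb * c.h))
      - (Φ x θ - Φ x (c.Nb * c.h)) := by abel
    rw [e]
    refine (norm_sub_le _ _).trans ?_
    linarith [hv.ρ_le, hv.η_le]
  refine ⟨θ, Ioo_subset_Icc_self hθ, hθpos, ?_, hno, hz⟩
  -- the crossing is near the point of parameter `s` of the segment
  set e := p + c.s.val • (q - p) with he
  have heS : e ∈ segment ℝ p q := exists_mem_segment_iff.2 ⟨_, ⟨hv.s_nonneg, hv.s_le⟩, rfl⟩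
  have hze : ‖(c.z c.Nb).val - e‖ ≤ 5 * c.ω := by
    have e1 : (c.z c.Nb).val - e = ((c.z c.Nb).val - c.y.val)
        + (c.y.val - p'.val - c.s.val • (q'.val - p'.val)) - (p - p'.val)
        + c.s.val • ((q'.val - p'.val) - (q - p)) := by rw [he]; module
    have h1 := (norm_le_norm₁ _).trans hv.near_crossing
    have h2 := (norm_le_norm₁ _).trans hv.near_segment
    have h3 : ‖c.s.val • ((q'.val - p'.val) - (q - p))‖ ≤ 2 * c.μ := by
      rw [norm_smul, Real.norm_of_nonneg hv.s_nonneg]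
      exact (mul_le_of_le_one_left (norm_nonneg _) hv.s_le).trans ha.norm_dir_sub_le
    have h4 := norm_add_le (((c.z c.Nb).val - c.y.val)
        + (c.y.val - p'.val - c.s.val • (q'.val - p'.val)) - (p - p'.val))
        (c.s.val • ((q'.val - p'.val) - (q - p)))
    have h5 := norm_sub_le (((c.z c.Nb).val - c.y.val)
        + (c.y.val - p'.val - c.s.val • (q'.val - p'.val))) (p - p'.val)
    have h6 := norm_add_le ((c.z c.Nb).val - c.y.val)
        (c.y.val - p'.val - c.s.val • (q'.val - p'.val))
    have h7 := ha.left_le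
    rw [e1]
    linarith [hv.μ_le, hv.ρ_le]
  refine hfl.mem_segment_of_crossing hret hne hx hθpos hθ0 heS hno (σ := c.σ.val)
    fun w hw => ?_
  have hwd : w ∈ unitDisk :=
    convex_unitDisk.segment_subset (hfl.mem x hxd θ hθpos.le) (hpq heS) hw
  have hwb : w ∈ Metric.closedBall (c.z c.Nb).val (5 * c.ω) := by
    refine (convex_closedBall _ _).segment_subset ?_ ?_ hw
    · rw [Metric.mem_closedBall', dist_eq_norm]; linarith
    · rw [Metric.mem_closedBall', dist_eq_norm]; exact hze
  rw [Metric.mem_closedBall', dist_eq_norm] at hwb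
  rw [hfl.eq w hwd]
  linarith [hv.half_le_wedge ha hv.Nb_lt (Or.inr le_rfl) hwd hwb]

/-- The factor `E` approximates the exponential in Liouville's formula. -/
theorem exp_integral_mem_Icc (hv : c.IsValid F₀ F₁ F₂ X p' q' n) (hfl : IsDiskFlow f g Φ K L)
    (hf : ContDiff ℝ 1 f) (ha : IsApproximation f F₁.eval c.B c.μ p q p'.val q'.val)
    (hdiv : ∀ x ∈ unitDisk, |divergence f x - F₂.div.eval x| ≤ 2 * (1 / ((c.l : ℝ) + 1)))
    (hx : x ∈ unitDisk) (hX : ‖x - X.val‖ ≤ c.μ) {θ : ℝ}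
    (hθ : θ ∈ Icc (c.Nb * c.h) (c.N * c.h)) :
    Real.exp (∫ t in (0 : ℝ)..θ, divergence f (Φ x t)) ∈ Icc c.E.val (c.E.val + c.ω) := by
  have hh := c.h_pos
  have hρ := c.ρ_pos
  have hcd := hfl.continuous_divergence_comp hf x
  set C : ℝ := 2 * (1 / ((c.l : ℝ) + 1)) + F₂.div.bound.val * c.ρ with hC
  have hC0 : 0 ≤ C := add_nonneg (by positivity) (mul_nonneg F₂.div.bound_nonneg hρ.le)
  have h1 := hfl.abs_integral_divergence_sub_le hf (x := x) (δ := fun i => F₂.div.eval (c.z i).val)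
    (C := C) hh.le (n := c.Nb) fun i hi t ht => by
      have hi' := (hi.trans hv.Nb_lt).le
      have ht0 : 0 ≤ t := le_trans (by positivity) ht.1
      have hu := hfl.mem x hx t ht0
      have e1 := hdiv _ hu
      have e2 := F₂.div.abs_eval_sub_le hu (hv.z_mem hi')
      have e3 := hv.norm_z_sub_le hfl ha hx hX hi' ht
      rw [norm_sub_rev] at e3
      have e4 := mul_le_mul_of_nonneg_left e3 F₂.div.bound_nonneg
      have e5 := abs_sub_le (divergence f (Φ x t)) (F₂.div.eval (Φ x t)) (F₂.div.eval (c.z i).val)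
      linarith
  have hNb0 : (0 : ℝ) ≤ c.Nb * c.h := by positivity
  have h2 : |∫ t in (c.Nb * c.h : ℝ)..θ, divergence f (Φ x t)| ≤ c.η := by
    have e1 := intervalIntegral.norm_integral_le_of_norm_le_const (a := (c.Nb * c.h : ℝ))
      (b := θ) (f := fun t => divergence f (Φ x t)) (C := c.B) fun t ht => by
        rw [uIoc_of_le hθ.1] at ht
        exact ha.field.div_le _ (hfl.mem x hx t (hNb0.trans ht.1.le))
    refine e1.trans (le_trans (mul_le_mul_of_nonneg_left ?_ (Nat.cast_nonneg _)) hv.arc_le)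
    rw [abs_of_nonneg (by linarith [hθ.1]), Nat.cast_sub hv.Nb_lt.le]
    linarith [hθ.2]
  have h3 : (c.Nb : ℝ) * c.h * C ≤ c.N * c.h * C := by
    have : (c.Nb : ℝ) ≤ c.N := by exact_mod_cast hv.Nb_lt.le
    gcongr
  have h4 : |(∫ t in (0 : ℝ)..θ, divergence f (Φ x t)) -
      c.h * ∑ i ∈ Finset.range c.Nb, F₂.div.eval (c.z i).val| ≤ c.ζ F₂ := by
    rw [← intervalIntegral.integral_add_adjacent_intervals (hcd.intervalIntegrable 0 (c.Nb * c.h))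
      (hcd.intervalIntegrable _ _), add_sub_right_comm]
    refine (abs_add_le _ _).trans ?_
    rw [ζ]
    linarith
  set S := ∫ t in (0 : ℝ)..θ, divergence f (Φ x t)
  have h5 := abs_le.1 h4
  have h6 : c.r * c.J₁.val ≤ S := by linarith [hv.integral_ge, h5.1]
  have h7 : S ≤ c.r * c.J₂.val := by linarith [hv.integral_le, h5.2]
  constructor
  · calc c.E.val ≤ (1 + c.J₁.val) ^ c.r := hv.exp_ge
      _ ≤ Real.exp c.J₁.val ^ c.r := by
          refine pow_le_pow_left₀ hv.J₁_ge ?_ _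
          rw [add_comm]; exact Real.add_one_le_exp _
      _ = Real.exp (c.r * c.J₁.val) := (Real.exp_nat_mul _ _).symm
      _ ≤ _ := Real.exp_le_exp.2 h6
  · have h8 : (1 - c.J₂.val) ^ c.r ≤ Real.exp (-(c.r * c.J₂.val)) := by
      rw [← mul_neg, Real.exp_nat_mul]
      refine pow_le_pow_left₀ hv.J₂_le ?_ _
      have := Real.add_one_le_exp (-c.J₂.val)
      linarith
    have h9 : 1 ≤ (c.E.val + c.ω) * Real.exp (-(c.r * c.J₂.val)) :=
      hv.exp_le.trans (mul_le_mul_of_nonneg_left h8 (add_nonneg hv.E_nonneg c.ω_pos.le))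
    rw [Real.exp_neg, ← div_eq_mul_inv, one_le_div (Real.exp_pos _)] at h9
    exact (Real.exp_le_exp.2 h7).trans h9

/-- The approximate value `d` is characterized by `wedge (f w) v • d = (E * wedge (f x) e) • v` up to
`ω`, where `w` is the point of return and `v` the direction of the segment. Transversality at `w`
bounds the error from the division by `wedge (f w) v`. -/
theorem norm_poincareDeriv_sub_le (hv : c.IsValid F₀ F₁ F₂ X p' q' n)
    (ha : IsApproximation f F₁.eval c.B c.μ p q p'.val q'.val) {τ : ℝ} {d e : Plane} (hx : x ∈ unitDisk)
    (hxz : ‖(c.z 0).val - x‖ ≤ 2 * c.ω) (hw : Φ x τ ∈ unitDisk)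
    (hwz : ‖(c.z c.Nb).val - Φ x τ‖ ≤ 2 * c.ω)
    (hexp : Real.exp (∫ t in (0 : ℝ)..τ, divergence f (Φ x t)) ∈ Icc c.E.val (c.E.val + c.ω))
    (he : ‖e‖ ≤ 1) (hd : norm₁ d ≤ c.B)
    (hjac : norm₁ (wedge (F₁.eval (c.z c.Nb).val) (q'.val - p'.val) • d -
      (c.E.val * wedge (F₁.eval (c.z 0).val) e) • (q'.val - p'.val)) ≤ c.ω) :
    ‖poincareDeriv f Φ (q - p) x τ e - d‖ ≤ (1 / 2) ^ n := by
  have hB1 := hv.one_le_B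
  have hω := c.ω_pos
  rw [poincareDeriv_apply]
  set D := Real.exp (∫ t in (0 : ℝ)..τ, divergence f (Φ x t))
  set w := Φ x τ
  set G := wedge (f w) (q - p) with hG
  set φ := wedge (f x) e with hφ
  have h1 := ha.norm_jacobian_sub_le (hv.z_mem (Nat.zero_le _)) (hv.z_mem hv.Nb_lt.le) hx hw
    hxz hwz (by linarith [hv.μ_le, hv.ρ_le]) he ((norm_le_norm₁ _).trans hd) hv.E_nonneg hv.E_le
  have h2 := (norm_le_norm₁ _).trans hjac
  have h3 : |φ| ≤ c.B := (abs_wedge_le _ _).trans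
    ((mul_le_of_le_one_right (norm_nonneg _) he).trans (ha.field.norm_le _ hx))
  have h4 : |c.E.val - D| ≤ c.ω := abs_le.2 ⟨by linarith [hexp.2], by linarith [hexp.1]⟩
  have h5 := hv.half_le_wedge ha hv.Nb_lt (Or.inr le_rfl) hw (by linarith)
  rw [wedge_comm, ← hG] at h5
  have h6 : 1 / 2 ≤ c.B * |G| := by
    have e1 := le_abs_self (c.σ.val * -G)
    rw [abs_mul, abs_neg] at e1
    have e2 := mul_le_mul_of_nonneg_right hv.abs_σ_le (abs_nonneg G)
    linarith
  have hG0 : G ≠ 0 := by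
    intro h0
    rw [h0, abs_zero, mul_zero] at h6
    linarith
  have e1 : G • (d - (D / G * φ) • (q - p)) = (wedge (F₁.eval (c.z c.Nb).val) (q'.val - p'.val) • d -
      (c.E.val * wedge (F₁.eval (c.z 0).val) e) • (q'.val - p'.val))
      - ((wedge (F₁.eval (c.z c.Nb).val) (q'.val - p'.val) • d -
      (c.E.val * wedge (F₁.eval (c.z 0).val) e) • (q'.val - p'.val))
      - (G • d - (c.E.val * φ) • (q - p))) + ((c.E.val - D) * φ) • (q - p) := by
    have e2 : G * (D / G * φ) = D * φ := by field_simp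
    rw [smul_sub, smul_smul, e2]
    module
  have h7 : ‖G • (d - (D / G * φ) • (q - p))‖ ≤ c.ω + 18 * (c.B : ℝ) ^ 2 * (2 * c.ω)
      + c.ω * c.B * 2 := by
    rw [e1]
    refine (norm_add_le _ _).trans (add_le_add ((norm_sub_le _ _).trans (add_le_add h2 h1)) ?_)
    rw [norm_smul, Real.norm_eq_abs, abs_mul]
    exact mul_le_mul (mul_le_mul h4 h3 (abs_nonneg _) hω.le) ha.norm_dir_le (norm_nonneg _)
      (by positivity)
  rw [norm_smul, Real.norm_eq_abs] at h7
  rw [norm_sub_rev]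
  set T := ‖d - (D / G * φ) • (q - p)‖
  have hT : 0 ≤ T := norm_nonneg _
  have h8 : T ≤ 2 * c.B * (|G| * T) := by
    have := mul_le_mul_of_nonneg_right h6 hT
    linarith
  have h9 : c.ω + 18 * (c.B : ℝ) ^ 2 * (2 * c.ω) + c.ω * c.B * 2 ≤ 39 * (c.B : ℝ) ^ 2 * c.ω := by
    have e2 : c.ω ≤ (c.B : ℝ) ^ 2 * c.ω := le_mul_of_one_le_left hω.le (one_le_pow₀ hB1)
    have e3 : c.B * c.ω ≤ (c.B : ℝ) ^ 2 * c.ω :=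
      mul_le_mul_of_nonneg_right (le_self_pow₀ hB1 two_ne_zero) hω.le
    linarith
  have h10 := mul_le_mul_of_nonneg_left (h7.trans h9) (show (0 : ℝ) ≤ 2 * c.B by positivity)
  have h11 := hv.le_half_pow (k := 78) (j := 3) (by norm_num) le_rfl
  push_cast at h11
  calc T ≤ 2 * c.B * (39 * (c.B : ℝ) ^ 2 * c.ω) := h8.trans h10
    _ = 78 * (c.B : ℝ) ^ 3 * c.ω := by ring
    _ ≤ _ := h11

end IsValid

/-- The claims of a valid certificate are correct: it exhibits a first return of the trajectory, and
there is only one. -/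
theorem IsValid.sound {F : ℕ → FieldCode} {X : ℕ → PtCode} {p' q' : PtCode} {n : ℕ}
    {f g : Plane → Plane} {Φ : Plane → ℝ → Plane} {K L : NNReal} {p q x : Plane}
    {P : Plane → Plane} {τ : ℝ} (hv : c.IsValid (F 0) (F c.m) (F c.l) (X c.m) p' q' n)
    (hfl : IsDiskFlow f g Φ K L) (hf : ContDiff ℝ 1 f) (hF : IsC1Name f F) (hX : IsPointName x X)
    (hpq : segment ℝ p q ⊆ unitDisk) (hP : IsPoincareMap f (segment ℝ p q) P)
    (hne : ∀ x ∈ segment ℝ p q, wedge (q - p) (g x) ≠ 0)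
    (hp : ‖p - p'.val‖ ≤ c.μ) (hq : ‖q - q'.val‖ ≤ c.μ) (hx : x ∈ segment ℝ p q)
    (hτ : IsFirstReturn f (segment ℝ p q) x (P x) τ) :
    ‖P x - c.y.val‖ ≤ (1 / 2) ^ n ∧
      ‖poincareDeriv f Φ (q - p) x τ (stdVec 0) - c.d₀.val‖ ≤ (1 / 2) ^ n ∧
      ‖poincareDeriv f Φ (q - p) x τ (stdVec 1) - c.d₁.val‖ ≤ (1 / 2) ^ n := by
  have hxd := hpq hx
  have hX' : ‖x - (X c.m).val‖ ≤ c.μ := (hX c.m).trans (half_pow_le c.m)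
  have ha := c.isApproximation hv.bound (hf.differentiable one_ne_zero) hF hpq hp hq
  have hω := c.ω_pos
  have hret : ∀ x ∈ segment ℝ p q, ∃ τ > 0, Φ x τ ∈ segment ℝ p q := by
    intro y hy
    obtain ⟨τ, hτ⟩ := hP y hy
    rw [hfl.isFirstReturn_iff (hpq hy)] at hτ
    exact ⟨τ, hτ.1, hτ.2.2.1 ▸ hτ.2.1⟩
  obtain ⟨θ, hθ, hθ0, hθS, hθn, hθz⟩ := hv.exists_crossing hfl ha hret hne hpq hx hX'
  rw [hfl.isFirstReturn_iff hxd] at hτ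
  have hτS : Φ x τ ∈ segment ℝ p q := hτ.2.2.1 ▸ hτ.2.1
  obtain rfl : θ = τ := IsDiskFlow.return_time_unique hθ0 hθS hθn hτ.1 hτS hτ.2.2.2
  have hexp := hv.exp_integral_mem_Icc hfl hf ha (fun y hy => hF.abs_divergence_sub_le c.l hy)
    hxd hX' hθ
  have hz0 : ‖(c.z 0).val - x‖ ≤ 2 * c.ω := by
    have h1 := hv.norm_z_sub_le hfl ha hxd hX' (Nat.zero_le _) (t := 0)
      ⟨by simp, by simpa using c.h_pos.le⟩
    rw [hfl.flow.zero] at h1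
    linarith [hv.ρ_le]
  refine ⟨?_, ?_, ?_⟩
  · have h1 := (norm_le_norm₁ _).trans hv.near_crossing
    have e : P x - c.y.val = ((c.z c.Nb).val - c.y.val) - ((c.z c.Nb).val - Φ x θ) := by
      rw [← hτ.2.2.1]; abel
    have h2 := hv.le_half_pow (k := 3) (j := 0) (by norm_num) (by norm_num)
    rw [pow_zero, mul_one] at h2
    push_cast at h2
    rw [e]
    exact (norm_sub_le _ _).trans (by linarith)
  · exact hv.norm_poincareDeriv_sub_le ha hxd hz0 (hpq hθS) hθz hexp (by simp) hv.d₀_le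
      hv.jacobian₀
  · exact hv.norm_poincareDeriv_sub_le ha hxd hz0 (hpq hθS) hθz hexp (by simp) hv.d₁_le
      hv.jacobian₁

end Certificate

/-! ### The choices in a certificate -/

theorem exists_unitFrac_le {ε : ℝ} (hε : 0 < ε) : ∃ n : ℕ, 1 / ((n : ℝ) + 1) ≤ ε :=
  (exists_nat_one_div_lt hε).imp fun _ h => h.le

/-- Rational brackets for an exponential, of the form that valid certificates use. -/
theorem exists_exp_bracket (S : ℝ) {ω : ℝ} (hω : 0 < ω) :
    ∃ (E J₁ J₂ : RatCode) (r : ℕ), 0 ≤ E.val ∧ E.val ≤ Real.exp S ∧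
      r * J₁.val < S ∧ S < r * J₂.val ∧ 0 ≤ 1 + J₁.val ∧ 0 ≤ 1 - J₂.val ∧
      E.val ≤ (1 + J₁.val) ^ r ∧ 1 ≤ (E.val + ω) * (1 - J₂.val) ^ r := by
  have hD := Real.exp_pos S
  obtain ⟨E, hE1, hE2⟩ := exists_ratCode_between
    (show max 0 (Real.exp S - ω) < Real.exp S from max_lt hD (by linarith))
  have hE0 : 0 < E.val := (le_max_left _ _).trans_lt hE1
  have hEω : Real.exp S < E.val + ω := by linarith [le_max_right 0 (Real.exp S - ω)]
  obtain ⟨S₁, hS₁, hS₁'⟩ := exists_between ((Real.log_lt_iff_lt_exp hE0).2 hE2)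
  obtain ⟨S₂, hS₂, hS₂'⟩ := exists_between ((Real.lt_log_iff_exp_lt (by linarith)).2 hEω)
  have h1 : ∀ᶠ r : ℕ in atTop, E.val < (1 + S₁ / r) ^ r :=
    (Real.tendsto_one_add_div_pow_exp S₁).eventually
      (lt_mem_nhds ((Real.log_lt_iff_lt_exp hE0).1 hS₁))
  have h2 : ∀ᶠ r : ℕ in atTop, (E.val + ω)⁻¹ < (1 + (-S₂) / r) ^ r := by
    refine (Real.tendsto_one_add_div_pow_exp (-S₂)).eventually (lt_mem_nhds ?_)
    rw [Real.exp_neg]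
    exact inv_strictAnti₀ (Real.exp_pos _) ((Real.lt_log_iff_exp_lt (by linarith)).1 hS₂')
  obtain ⟨r, hr1, hr2, hr3, hr4⟩ := (h1.and (h2.and ((eventually_gt_atTop 0).and
    (eventually_ge_atTop ⌈max |S₁| |S₂|⌉₊)))).exists
  have hr0 : (0 : ℝ) < r := by exact_mod_cast hr3
  have hr5 : max |S₁| |S₂| ≤ r := Nat.ceil_le.1 hr4
  have hS₁r : -1 ≤ S₁ / r := by
    rw [le_div_iff₀ hr0]
    linarith [neg_abs_le S₁, le_max_left |S₁| |S₂|]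
  have hS₂r : S₂ / r ≤ 1 := by
    rw [div_le_one hr0]
    linarith [le_abs_self S₂, le_max_right |S₁| |S₂|]
  obtain ⟨J₁, hJ1, hJ1'⟩ := exists_ratCode_between (div_lt_div_of_pos_right hS₁' hr0)
  obtain ⟨J₂, hJ2, hJ2'⟩ := exists_ratCode_between (div_lt_div_of_pos_right hS₂ hr0)
  refine ⟨E, J₁, J₂, r, hE0.le, hE2.le, ?_, ?_, by linarith, by linarith, ?_, ?_⟩
  · rwa [lt_div_iff₀ hr0, mul_comm] at hJ1'
  · rwa [div_lt_iff₀ hr0, mul_comm] at hJ2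
  · exact hr1.le.trans (pow_le_pow_left₀ (by linarith) (by linarith) r)
  · have h3 : (E.val + ω)⁻¹ ≤ (1 - J₂.val) ^ r := by
      refine hr2.le.trans (pow_le_pow_left₀ ?_ ?_ r)
      · rw [neg_div]; linarith
      · rw [neg_div]; linarith
    have h4 := mul_le_mul_of_nonneg_left h3 (show 0 ≤ E.val + ω by linarith)
    rwa [mul_inv_cancel₀ (by linarith)] at h4

/-- Two numbers of the same sign can be scaled by a common rational factor to be at least `2`. -/
theorem exists_ratCode_scale {a b : ℝ} (hab : 0 < a * b) :
    ∃ σ : RatCode, 2 ≤ σ.val * a ∧ 2 ≤ σ.val * b := by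
  have ha : a ≠ 0 := left_ne_zero_of_mul hab.ne'
  have hb : b ≠ 0 := right_ne_zero_of_mul hab.ne'
  obtain ⟨M, hM⟩ := exists_nat_ge (2 / |a| + 2 / |b|)
  have h1 : 2 ≤ M * |a| := by
    rw [← div_le_iff₀ (abs_pos.2 ha)]
    have : 0 ≤ 2 / |b| := by positivity
    linarith
  have h2 : 2 ≤ M * |b| := by
    rw [← div_le_iff₀ (abs_pos.2 hb)]
    have : 0 ≤ 2 / |a| := by positivity
    linarith
  rcases lt_or_gt_of_ne ha with h | h
  · have hb' : b < 0 := by nlinarith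
    refine ⟨(RatCode.ofNat M).neg, ?_, ?_⟩
    · rw [abs_of_neg h] at h1; simpa using h1
    · rw [abs_of_neg hb'] at h2; simpa using h2
  · have hb' : 0 < b := pos_of_mul_pos_right hab h.le
    refine ⟨RatCode.ofNat M, ?_, ?_⟩
    · rw [abs_of_pos h] at h1; simpa using h1
    · rw [abs_of_pos hb'] at h2; simpa using h2

theorem exists_ratCode_near_of_mem_Icc {s δ : ℝ} (hs : s ∈ Icc (0 : ℝ) 1) (hδ : 0 < δ) :
    ∃ c : RatCode, 0 ≤ c.val ∧ c.val ≤ 1 ∧ |c.val - s| ≤ δ := by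
  obtain ⟨c, h1, h2⟩ := exists_ratCode_between (show max 0 (s - δ) < min 1 (s + δ) from
    max_lt (lt_min one_pos (by linarith [hs.1])) (lt_min (by linarith [hs.2]) (by linarith)))
  refine ⟨c, (le_max_left _ _).trans h1.le, h2.le.trans (min_le_left _ _), abs_le.2 ⟨?_, ?_⟩⟩
  · linarith [le_max_right 0 (s - δ)]
  · linarith [min_le_right 1 (s + δ)]

/-- Times near those of departure and of return. -/
theorem exists_times {F : ℝ → ℝ} (hF : Continuous F) {τ ε : ℝ} (hτ : 0 < τ) (hε : 0 < ε)
    (h0 : 3 / 2 < F 0) (h1 : 3 / 2 < F τ) :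
    ∃ a e : ℝ, 0 < a ∧ 0 < e ∧ a < τ - e ∧ e ≤ ε ∧
      (∀ t ∈ Icc 0 a, 3 / 2 ≤ F t) ∧ (∀ t ∈ Icc (τ - e) (τ + e), 3 / 2 ≤ F t) := by
  obtain ⟨ε₁, hε₁, h2⟩ := Metric.eventually_nhds_iff.1 (hF.continuousAt.eventually (lt_mem_nhds h0))
  obtain ⟨ε₂, hε₂, h3⟩ := Metric.eventually_nhds_iff.1 (hF.continuousAt.eventually (lt_mem_nhds h1))
  have e1 := min_le_left (ε₁ / 2) (τ / 3)
  have e2 := min_le_right (ε₁ / 2) (τ / 3)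
  have e3 := (min_le_left (min (ε₂ / 2) (τ / 3)) ε).trans (min_le_left _ _)
  have e4 := (min_le_left (min (ε₂ / 2) (τ / 3)) ε).trans (min_le_right _ _)
  refine ⟨min (ε₁ / 2) (τ / 3), min (min (ε₂ / 2) (τ / 3)) ε, by positivity, by positivity,
    by linarith, min_le_right _ _, fun t ht => (h2 ?_).le, fun t ht => (h3 ?_).le⟩
  · rw [Real.dist_eq, sub_zero, abs_of_nonneg ht.1]
    linarith [ht.2]
  · rw [Real.dist_eq, abs_lt]
    constructor <;> linarith [ht.1, ht.2]

/-- Each point of a compact set off the segment is separated from the end points by a rational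
functional, with a uniform bound. -/
theorem exists_separating {C : Set Plane} (hC : IsCompact C) {p q : Plane}
    (hd : ∀ w ∈ C, w ∉ segment ℝ p q) :
    ∃ A : ℕ, ∀ w ∈ C, ∃ a : PtCode, norm₁ a.val ≤ A ∧
      2 ≤ inner ℝ a.val (w - p) ∧ 2 ≤ inner ℝ a.val (w - q) := by
  have hloc : ∀ w ∈ C, ∃ a : PtCode, ∀ᶠ w' in 𝓝 w,
      2 ≤ inner ℝ a.val (w' - p) ∧ 2 ≤ inner ℝ a.val (w' - q) := by
    intro w hw
    have hcl : IsClosed (segment ℝ p q) := by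
      rw [segment_eq_image']
      exact (isCompact_Icc.image (by fun_prop)).isClosed
    obtain ⟨φ, r, h1, h2⟩ := geometric_hahn_banach_closed_point (convex_segment p q) hcl (hd w hw)
    set b := (InnerProductSpace.toDual ℝ Plane).symm φ
    have hb : ∀ y, inner ℝ b y = φ y := fun y => by simp [b]
    have hp := h1 p (left_mem_segment ℝ p q)
    have hq := h1 q (right_mem_segment ℝ p q)
    set k := 3 / (φ w - r)
    have hk : 0 < k := div_pos (by norm_num) (by linarith)
    have hk3 : k * (φ w - r) = 3 := div_mul_cancel₀ _ (by linarith)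
    set M := ‖w - p‖ + ‖w - q‖ + 1
    have hM : 0 < M := by positivity
    obtain ⟨a, ha⟩ := exists_ptCode_near (k • b) (show 0 < 1 / (2 * M) by positivity)
    have key : ∀ y : Plane, φ y < r → ‖w - y‖ ≤ M → 2 < inner ℝ a.val (w - y) := by
      intro y hy hyM
      have e1 : inner ℝ a.val (w - y) = k * (φ w - φ y) + inner ℝ (a.val - k • b) (w - y) := by
        rw [inner_sub_left, inner_smul_left, hb, map_sub]
        simp
      have e2 := abs_real_inner_le_norm (a.val - k • b) (w - y)
      have e3 := mul_le_mul ha hyM (norm_nonneg _) (by positivity)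
      have e4 : 1 / (2 * M) * M = 1 / 2 := by field_simp
      have e5 : 3 < k * (φ w - φ y) := by
        rw [← hk3]; exact mul_lt_mul_of_pos_left (by linarith) hk
      have e6 := (abs_le.1 e2).1
      rw [e1]
      linarith
    have hcp : Continuous fun w' : Plane => inner ℝ a.val (w' - p) := by fun_prop
    have hcq : Continuous fun w' : Plane => inner ℝ a.val (w' - q) := by fun_prop
    refine ⟨a, ?_⟩
    filter_upwards [hcp.continuousAt.eventually (lt_mem_nhds (key p hp (by
        have := norm_nonneg (w - q); linarith))),
      hcq.continuousAt.eventually (lt_mem_nhds (key q hq (by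
        have := norm_nonneg (w - p); linarith)))] with w' e1 e2
    exact ⟨e1.le, e2.le⟩
  choose! α hα using hloc
  obtain ⟨t, ht, hCt⟩ := hC.elim_nhds_subcover (fun w => {w' | 2 ≤ inner ℝ (α w).val (w' - p) ∧
    2 ≤ inner ℝ (α w).val (w' - q)}) hα
  obtain ⟨A, hA⟩ := exists_nat_ge (∑ w ∈ t, norm₁ (α w).val)
  refine ⟨A, fun w hw => ?_⟩
  obtain ⟨w₀, hw₀, h1⟩ := mem_iUnion₂.1 (hCt hw)
  refine ⟨α w₀, le_trans ?_ hA, h1.1, h1.2⟩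
  exact Finset.single_le_sum (f := fun w => norm₁ (α w).val)
    (fun w _ => add_nonneg (abs_nonneg _) (abs_nonneg _)) hw₀

/-- The indices of a grid of step `h` that correspond to the times `a`, `b`, `T`. -/
theorem exists_grid {a b T h : ℝ} (ha : 0 < a) (hh : 0 < h) (hab : h < b - a) (hbT : h < T - b) :
    ∃ Na Nb N : ℕ, 1 ≤ Na ∧ Na < Nb ∧ Nb < N ∧ (∀ i < Na, (i : ℝ) * h ≤ a) ∧
      (∀ i, Na ≤ i → a ≤ i * h) ∧ (∀ i < Nb, (i : ℝ) * h ≤ b) ∧ (∀ i, Nb ≤ i → b ≤ i * h) ∧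
      (∀ i < N, (i : ℝ) * h ≤ T) ∧ T ≤ N * h ∧ Nb * h ≤ b + h ∧ N * h ≤ T + h := by
  have lt : ∀ {c : ℝ} {i : ℕ}, i < ⌈c / h⌉₊ → (i : ℝ) * h ≤ c := fun {c i} hi => by
    have := Nat.lt_ceil.1 hi
    rw [lt_div_iff₀ hh] at this
    exact this.le
  have le : ∀ {c : ℝ} {i : ℕ}, ⌈c / h⌉₊ ≤ i → c ≤ i * h := fun {c i} hi => by
    have := Nat.ceil_le.1 hi
    rwa [div_le_iff₀ hh] at this
  have up : ∀ {c : ℝ}, 0 < c → (⌈c / h⌉₊ : ℝ) * h ≤ c + h := fun {c} hc => by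
    have := (Nat.ceil_lt_add_one (div_pos hc hh).le).le
    have := mul_le_mul_of_nonneg_right this hh.le
    rwa [add_mul, div_mul_cancel₀ _ hh.ne', one_mul] at this
  have mono : ∀ {c d : ℝ}, 0 < c → h < d - c → ⌈c / h⌉₊ < ⌈d / h⌉₊ := fun {c d} hc hcd => by
    rw [Nat.lt_ceil, lt_div_iff₀ hh]
    linarith [up hc]
  refine ⟨⌈a / h⌉₊, ⌈b / h⌉₊, ⌈T / h⌉₊, Nat.ceil_pos.2 (div_pos ha hh), mono ha hab,
    mono (by linarith) hbT, fun i => lt, fun i => le, fun i => lt, fun i => le, fun i => lt,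
    le le_rfl, up (by linarith), up (by linarith)⟩

theorem one_add_pow_le_exp {d c : ℝ} {N : ℕ} (hd : 0 ≤ d) (h : N * d ≤ c) :
    (1 + d) ^ N ≤ Real.exp c := by
  have h1 : 1 + d ≤ Real.exp d := by rw [add_comm]; exact Real.add_one_le_exp d
  refine (pow_le_pow_left₀ (by linarith) h1 N).trans ?_
  rw [← Real.exp_nat_mul]
  exact Real.exp_le_exp.2 h

/-- The vertices of an Euler polygon may be taken to be rational points near the trajectory. -/
theorem IsDiskFlow.norm_polygon_step_le {f g : Plane → Plane} {Φ : Plane → ℝ → Plane} {K L : NNReal}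
    (h : IsDiskFlow f g Φ K L) {f' : Plane → Plane} {B μ d ε : ℝ} {p q p' q' x : Plane}
    (ha : IsApproximation f f' B μ p q p' q') (hx : x ∈ unitDisk) {t : ℝ} (ht : 0 ≤ t) (hd : 0 ≤ d)
    (hd1 : d ≤ 1) (hBd : B * B * d ≤ μ) (hε : 4 * B * ε ≤ d * μ) {z z' : Plane} (hz : z ∈ unitDisk)
    (hzt : ‖z - Φ x t‖ ≤ ε) (hzt' : ‖z' - Φ x (t + d)‖ ≤ ε) :
    norm₁ (z' - z - d • f' z) ≤ 8 * (d * μ) := by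
  have hB := ha.one_le
  have hμ := ha.nonneg
  have hε0 : 0 ≤ ε := (norm_nonneg _).trans hzt
  refine (norm₁_le _).trans ?_
  set u := Φ x t
  have e : z' - z - d • f' z = (z' - Φ x (t + d)) - (z - u) + (Φ x (t + d) - u - d • f u)
      - d • (f z - f u) + d • (f z - f' z) := by module
  have h1 := h.norm_euler_step_le ha.field (by linarith) hx ht hd
  have h2 : ‖d • (f z - f u)‖ ≤ d * (B * ε) := by
    rw [norm_smul, Real.norm_of_nonneg hd]
    refine mul_le_mul_of_nonneg_left ((ha.field.sub_le z hz u (h.mem x hx t ht)).trans ?_) hd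
    exact mul_le_mul_of_nonneg_left hzt (by linarith)
  have h3 : ‖d • (f z - f' z)‖ ≤ d * μ := by
    rw [norm_smul, Real.norm_of_nonneg hd]
    exact mul_le_mul_of_nonneg_left (ha.field_le z hz) hd
  have h4 : ‖z' - z - d • f' z‖ ≤ ε + ε + B * B * d * d + d * (B * ε) + d * μ := by
    rw [e]
    refine (norm_add_le _ _).trans (add_le_add ((_root_.norm_sub_le _ _).trans (add_le_add
      ((norm_add_le _ _).trans (add_le_add ((_root_.norm_sub_le _ _).trans
        (add_le_add hzt' hzt)) h1)) h2)) h3)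
  have h5 := mul_le_mul_of_nonneg_right hBd hd
  have h6 : ε ≤ B * ε := le_mul_of_one_le_left hε0 hB
  have h7 : d * (B * ε) ≤ B * ε := mul_le_of_le_one_left (by positivity) hd1
  linarith

/-! ### Existence of valid certificates -/

theorem IsApproximation.norm₁_jacobian_le {f f' : Plane → Plane} {B μ s E δ : ℝ}
    {p q p' q' z₀ z₁ w₀ w₁ d e : Plane} (h : IsApproximation f f' B μ p q p' q')
    (hz₀ : z₀ ∈ unitDisk) (hz₁ : z₁ ∈ unitDisk) (hw₀ : w₀ ∈ unitDisk) (hw₁ : w₁ ∈ unitDisk)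
    (hs₀ : ‖z₀ - w₀‖ ≤ s) (hs₁ : ‖z₁ - w₁‖ ≤ s) (hμ : μ ≤ s) (he : ‖e‖ ≤ 1) (hd : ‖d‖ ≤ B)
    (hE0 : 0 ≤ E) (hE : E ≤ B) (hG : wedge (f w₁) (q - p) ≠ 0)
    (hdδ : ‖d - (E * wedge (f w₀) e / wedge (f w₁) (q - p)) • (q - p)‖ ≤ δ) :
    norm₁ (wedge (f' z₁) (q' - p') • d - (E * wedge (f' z₀) e) • (q' - p')) ≤
      2 * (2 * B * δ + 18 * B ^ 2 * s) := by
  have hB := h.one_le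
  have h1 := h.norm_jacobian_sub_le hz₀ hz₁ hw₀ hw₁ hs₀ hs₁ hμ he hd hE0 hE
  set G := wedge (f w₁) (q - p) with hGdef
  have h2 : |G| ≤ 2 * B := by
    refine (abs_wedge_le _ _).trans ?_
    have := mul_le_mul (h.field.norm_le _ hw₁) h.norm_dir_le (norm_nonneg _) (by linarith)
    linarith
  have e1 : G • d - (E * wedge (f w₀) e) • (q - p)
      = G • (d - (E * wedge (f w₀) e / G) • (q - p)) := by
    have e2 : G * (E * wedge (f w₀) e / G) = E * wedge (f w₀) e := mul_div_cancel₀ _ hG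
    rw [smul_sub G, smul_smul, e2]
  have h3 : ‖G • d - (E * wedge (f w₀) e) • (q - p)‖ ≤ 2 * B * δ := by
    rw [e1, norm_smul, Real.norm_eq_abs]
    exact mul_le_mul h2 hdδ (norm_nonneg _) (by linarith)
  refine (norm₁_le _).trans (mul_le_mul_of_nonneg_left ?_ zero_le_two)
  have h4 := norm_le_norm_sub_add (wedge (f' z₁) (q' - p') • d -
    (E * wedge (f' z₀) e) • (q' - p')) (G • d - (E * wedge (f w₀) e) • (q - p))
  linarith

namespace Certificate

/-- The data of the certificate are close to those of the actual trajectory of `x`, which returns to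
the segment at the time `τ`, and the parameters are small enough for the certificate to be valid. -/
structure IsClose (c : Certificate) (f : Plane → Plane) (Φ : Plane → ℝ → Plane) (p q x : Plane)
    (τ : ℝ) (F₀ F₂ : FieldCode) (n : ℕ) : Prop where
  bound : 2 + 2 * F₀.bound.val ≤ c.B
  abs_σ_le : |c.σ.val| ≤ c.B
  E_nonneg : 0 ≤ c.E.val
  E_le : c.E.val ≤ c.B
  d₀_le : norm₁ c.d₀.val ≤ c.B
  d₁_le : norm₁ c.d₁.val ≤ c.B
  Na_pos : 1 ≤ c.Na
  Na_lt : c.Na < c.Nb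
  Nb_lt : c.Nb < c.N
  s_nonneg : 0 ≤ c.s.val
  s_le : c.s.val ≤ 1
  J₁_ge : 0 ≤ 1 + c.J₁.val
  J₂_le : 0 ≤ 1 - c.J₂.val
  exp_ge : c.E.val ≤ (1 + c.J₁.val) ^ c.r
  exp_le : 1 ≤ (c.E.val + c.ω) * (1 - c.J₂.val) ^ c.r
  precision : 100 * (c.B * c.B * c.B * c.ω) ≤ (1 / 2) ^ n
  z_mem : ∀ i ≤ c.N, (c.z i).val ∈ unitDisk
  z_near : ∀ i ≤ c.N, 4 * c.B * ‖(c.z i).val - Φ x (i * c.h)‖ ≤ c.h * c.μ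
  h_le_one : c.h ≤ 1
  h_le_μ : c.B * c.B * c.h ≤ c.μ
  growth : Real.exp (c.B * (c.N * c.h)) * (5 * c.μ + c.N * c.h * (10 * c.μ)) + c.μ ≤ c.ρ
  ρ_le : 1000 * (c.B : ℝ) ^ 3 * c.ρ ≤ c.ω
  η_le : 1000 * (c.B : ℝ) ^ 3 * c.η ≤ c.ω
  A_le : 4 * (c.A * c.ρ) ≤ 1
  arc_le : c.B * (((c.N - c.Nb : ℕ) : ℝ) * c.h) ≤ c.η
  transversal : ∀ i < c.N, (c.Na ≤ i ∧ i < c.Nb) ∨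
    3 / 2 ≤ c.σ.val * wedge (q - p) (f (Φ x (i * c.h)))
  separated : ∀ i < c.N, (i < c.Na ∨ c.Nb ≤ i) ∨ norm₁ (c.a i).val ≤ c.A ∧
    2 ≤ inner ℝ (c.a i).val (Φ x (i * c.h) - p) ∧ 2 ≤ inner ℝ (c.a i).val (Φ x (i * c.h) - q)
  below : c.σ.val * wedge (q - p) (Φ x (c.Nb * c.h) - p) ≤ -(21 * (c.B * c.ρ))
  above : 21 * (c.B * c.ρ) ≤ c.σ.val * wedge (q - p) (Φ x (c.N * c.h) - p)
  return_near : c.B * |τ - c.Nb * c.h| ≤ c.η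
  s_near : 1000 * ‖p + c.s.val • (q - p) - Φ x τ‖ ≤ c.ω
  y_near : 1000 * ‖c.y.val - Φ x τ‖ ≤ c.ω
  d₀_near : 1000 * (c.B : ℝ) ^ 3 * ‖c.d₀.val - (c.E.val * wedge (f x) (stdVec 0) /
    wedge (f (Φ x τ)) (q - p)) • (q - p)‖ ≤ c.ω
  d₁_near : 1000 * (c.B : ℝ) ^ 3 * ‖c.d₁.val - (c.E.val * wedge (f x) (stdVec 1) /
    wedge (f (Φ x τ)) (q - p)) • (q - p)‖ ≤ c.ω
  integral_ge : c.r * c.J₁.val ≤ (∫ t in (0 : ℝ)..τ, divergence f (Φ x t)) - 2 * c.ζ F₂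
  integral_le : (∫ t in (0 : ℝ)..τ, divergence f (Φ x t)) + 2 * c.ζ F₂ ≤ c.r * c.J₂.val

/-- Data close enough to the trajectory satisfy the inequalities of a valid certificate, whatever
entries of the names are used, as long as they have the required accuracy. -/
theorem IsClose.isValid {c : Certificate} {F₀ F₁ F₂ : FieldCode} {X p' q' : PtCode} {n : ℕ}
    {f g : Plane → Plane} {Φ : Plane → ℝ → Plane} {K L : NNReal} {p q x : Plane} {τ : ℝ}
    (hc : c.IsClose f Φ p q x τ F₀ F₂ n) (hfl : IsDiskFlow f g Φ K L) (hf : ContDiff ℝ 1 f)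
    (ha : IsApproximation f F₁.eval c.B c.μ p q p'.val q'.val)
    (hdiv : ∀ x ∈ unitDisk, |divergence f x - F₂.div.eval x| ≤ 2 * (1 / ((c.l : ℝ) + 1)))
    (hx : x ∈ unitDisk) (hX : ‖x - X.val‖ ≤ c.μ) (hτ : 0 ≤ τ)
    (hG : wedge (f (Φ x τ)) (q - p) ≠ 0) : c.IsValid F₀ F₁ F₂ X p' q' n := by
  have hB := ha.one_le
  have hB0 : (0 : ℝ) ≤ c.B := by linarith
  have hh := c.h_pos
  have hμ := c.μ_pos
  have hρ := c.ρ_pos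
  have hω := c.ω_pos
  have hBpow : ∀ {r : ℝ}, 0 ≤ r → ∀ {j : ℕ}, j ≤ 3 → (c.B : ℝ) ^ j * r ≤ (c.B : ℝ) ^ 3 * r :=
    fun hr _ hj => mul_le_mul_of_nonneg_right (pow_le_pow_right₀ hB hj) hr
  have hρω : 1000 * c.ρ ≤ c.ω := by
    have := hBpow hρ.le (Nat.zero_le 3)
    rw [pow_zero, one_mul] at this
    linarith [hc.ρ_le]
  have hηpos : 0 ≤ c.η := by unfold η; positivity
  have hηω : 1000 * c.η ≤ c.ω := by
    have := hBpow hηpos (Nat.zero_le 3)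
    rw [pow_zero, one_mul] at this
    linarith [hc.η_le]
  have hω1 : 100 * ((c.B : ℝ) ^ 3 * c.ω) ≤ 1 := by
    have h1 := hc.precision.trans (pow_le_one₀ (by norm_num) (by norm_num) :
      (1 / 2 : ℝ) ^ n ≤ 1)
    calc 100 * ((c.B : ℝ) ^ 3 * c.ω) = 100 * (c.B * c.B * c.B * c.ω) := by ring
      _ ≤ 1 := h1
  have hBh : c.B * c.h ≤ c.μ :=
    (mul_le_mul_of_nonneg_right (le_mul_of_one_le_left hB0 hB) hh.le).trans hc.h_le_μ
  have hμρ : 6 * c.μ ≤ c.ρ := by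
    have h1 : 1 ≤ Real.exp (c.B * (c.N * c.h)) := Real.one_le_exp (by positivity)
    have h2 : 5 * c.μ ≤ 5 * c.μ + c.N * c.h * (10 * c.μ) := by
      have : 0 ≤ c.N * c.h * (10 * c.μ) := by positivity
      linarith
    have h3 := le_mul_of_one_le_left (show 0 ≤ 5 * c.μ + c.N * c.h * (10 * c.μ) by positivity) h1
    linarith [hc.growth]
  have htN : ∀ i : ℕ, 0 ≤ (i : ℝ) * c.h := fun i => by positivity
  have hzε : ∀ i ≤ c.N, 4 * ‖(c.z i).val - Φ x (i * c.h)‖ ≤ c.μ := fun i hi => by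
    have h1 := hc.z_near i hi
    have h2 := mul_le_mul_of_nonneg_right hB (norm_nonneg ((c.z i).val - Φ x (i * c.h)))
    have h3 := mul_le_of_le_one_left hμ.le hc.h_le_one
    linarith
  have hzt : ∀ i ≤ c.N, ∀ t, i * c.h ≤ t → t ≤ i * c.h + c.h →
      ‖(c.z i).val - Φ x t‖ ≤ c.ρ := fun i hi t h1 h2 => by
    have e : (c.z i).val - Φ x t = ((c.z i).val - Φ x (i * c.h)) - (Φ x t - Φ x (i * c.h)) := by
      abel
    have h3 := hfl.norm_sub_le ha.field hx (htN i) ((htN i).trans h1)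
    have h4 : c.B * |t - i * c.h| ≤ c.B * c.h := by
      rw [abs_of_nonneg (by linarith)]
      exact mul_le_mul_of_nonneg_left (by linarith) hB0
    rw [e]
    refine (norm_sub_le _ _).trans ?_
    linarith [hzε i hi]
  have hz0 : ‖(c.z 0).val - x‖ ≤ c.ρ := by
    have := hzt 0 (Nat.zero_le _) 0 (by simp) (by simpa using hh.le)
    rwa [hfl.flow.zero] at this
  have hzτ : ‖(c.z c.Nb).val - Φ x τ‖ ≤ c.ρ + c.η := by
    have e : (c.z c.Nb).val - Φ x τ = ((c.z c.Nb).val - Φ x (c.Nb * c.h))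
      - (Φ x τ - Φ x (c.Nb * c.h)) := by abel
    have h1 := hfl.norm_sub_le ha.field hx (htN c.Nb) hτ
    have h2 := hzt c.Nb hc.Nb_lt.le _ le_rfl (by linarith)
    rw [e]
    refine (norm_sub_le _ _).trans ?_
    linarith [hc.return_near]
  have hwd := hfl.mem x hx τ hτ
  have hjac : ∀ d e : Plane, ‖e‖ ≤ 1 → norm₁ d ≤ c.B → 1000 * (c.B : ℝ) ^ 3 *
      ‖d - (c.E.val * wedge (f x) e / wedge (f (Φ x τ)) (q - p)) • (q - p)‖ ≤ c.ω →
      norm₁ (wedge (F₁.eval (c.z c.Nb).val) (q'.val - p'.val) • d -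
      (c.E.val * wedge (F₁.eval (c.z 0).val) e) • (q'.val - p'.val)) ≤ c.ω := by
    intro d e he hd hde
    refine (ha.norm₁_jacobian_le (hc.z_mem 0 (Nat.zero_le _)) (hc.z_mem _ hc.Nb_lt.le) hx hwd
      (s := c.ρ + c.η) (by linarith) hzτ (by linarith) he ((norm_le_norm₁ _).trans hd) hc.E_nonneg
      hc.E_le hG le_rfl).trans ?_
    set T := ‖d - (c.E.val * wedge (f x) e / wedge (f (Φ x τ)) (q - p)) • (q - p)‖
    have h1 := hBpow (norm_nonneg _ : 0 ≤ T) (j := 1) (by norm_num)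
    have h2 := hBpow hρ.le (j := 2) (by norm_num)
    have h3 := hBpow hηpos (j := 2) (by norm_num)
    rw [pow_one] at h1
    linarith [hc.ρ_le, hc.η_le]
  have hint : |(∫ t in (0 : ℝ)..τ, divergence f (Φ x t)) -
      c.h * ∑ i ∈ Finset.range c.Nb, F₂.div.eval (c.z i).val| ≤ c.ζ F₂ := by
    have hcd := hfl.continuous_divergence_comp hf x
    have h1 := hfl.abs_integral_divergence_sub_le hf (x := x)
      (δ := fun i => F₂.div.eval (c.z i).val)
      (C := 2 * (1 / ((c.l : ℝ) + 1)) + F₂.div.bound.val * c.ρ) hh.le (n := c.Nb)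
      fun i hi t ht => by
        have hi' := (hi.trans hc.Nb_lt).le
        have hu := hfl.mem x hx t ((htN i).trans ht.1)
        have e1 := hdiv _ hu
        have e2 := F₂.div.abs_eval_sub_le hu (hc.z_mem i hi')
        have e3 := hzt i hi' t ht.1 ht.2
        rw [norm_sub_rev] at e3
        have e4 := mul_le_mul_of_nonneg_left e3 F₂.div.bound_nonneg
        have e5 := abs_sub_le (divergence f (Φ x t)) (F₂.div.eval (Φ x t))
          (F₂.div.eval (c.z i).val)
        linarith
    have h2 : |∫ t in (c.Nb * c.h : ℝ)..τ, divergence f (Φ x t)| ≤ c.η := by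
      refine (intervalIntegral.norm_integral_le_of_norm_le_const (a := (c.Nb * c.h : ℝ))
        (b := τ) (f := fun t => divergence f (Φ x t)) (C := c.B) fun t ht => ?_).trans
        hc.return_near
      have ht0 : 0 ≤ t := (le_min (htN _) hτ).trans ht.1.le
      exact ha.field.div_le _ (hfl.mem x hx t ht0)
    have h3 : (c.Nb : ℝ) * c.h * (2 * (1 / ((c.l : ℝ) + 1)) + F₂.div.bound.val * c.ρ) ≤
        c.N * c.h * (2 * (1 / ((c.l : ℝ) + 1)) + F₂.div.bound.val * c.ρ) := by
      have : (c.Nb : ℝ) ≤ c.N := by exact_mod_cast hc.Nb_lt.le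
      have := F₂.div.bound_nonneg
      gcongr
    rw [← intervalIntegral.integral_add_adjacent_intervals (hcd.intervalIntegrable 0 (c.Nb * c.h))
      (hcd.intervalIntegrable _ _), add_sub_right_comm]
    refine (abs_add_le _ _).trans ?_
    rw [ζ]
    linarith
  have hint' := abs_le.1 hint
  have hpos : ∀ i ≤ c.N, |c.σ.val * wedge (q'.val - p'.val) ((c.z i).val - p'.val) -
      c.σ.val * wedge (q - p) (Φ x (i * c.h) - p)| ≤ c.B * (10 * c.ρ) := by
    intro i hi
    rw [← mul_sub, abs_mul]
    exact mul_le_mul hc.abs_σ_le (ha.abs_wedge_sub_point_le (hc.z_mem i hi)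
      (hzt i hi _ le_rfl (by linarith)) (by linarith)) (abs_nonneg _) hB0
  have hBρ : 0 ≤ c.B * c.ρ := by positivity
  exact
  { bound := hc.bound
    abs_σ_le := hc.abs_σ_le
    E_nonneg := hc.E_nonneg
    E_le := hc.E_le
    d₀_le := hc.d₀_le
    d₁_le := hc.d₁_le
    mem := fun i hi => by
      rw [real_inner_self_eq_norm_sq, sq_le_one_iff₀ (norm_nonneg _)]
      exact mem_unitDisk.1 (hc.z_mem i (Nat.lt_succ_iff.1 hi))
    start := by
      have e : (c.z 0).val - X.val = ((c.z 0).val - x) + (x - X.val) := by abel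
      have h1 := hzε 0 (Nat.zero_le _)
      rw [Nat.cast_zero, zero_mul, hfl.flow.zero] at h1
      rw [e]
      refine (norm₁_le _).trans ?_
      have := norm_add_le ((c.z 0).val - x) (x - X.val)
      linarith
    step := fun i hi => by
      have h1 := hc.z_near i hi.le
      have h2 := hc.z_near (i + 1) hi
      have e : ((i + 1 : ℕ) : ℝ) * c.h = i * c.h + c.h := by push_cast; ring
      rw [e] at h2
      refine hfl.norm_polygon_step_le ha hx (htN i) hh.le hc.h_le_one hc.h_le_μ
        (ε := max ‖(c.z i).val - Φ x (i * c.h)‖ ‖(c.z (i + 1)).val - Φ x (i * c.h + c.h)‖) ?_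
        (hc.z_mem i hi.le) (le_max_left _ _) (le_max_right _ _)
      rcases max_choice ‖(c.z i).val - Φ x (i * c.h)‖
        ‖(c.z (i + 1)).val - Φ x (i * c.h + c.h)‖ with h3 | h3 <;> rw [h3] <;> assumption
    tube := by
      refine le_trans ?_ hc.growth
      have h1 := one_add_pow_le_exp (d := c.B * c.h) (c := c.B * (c.N * c.h)) (N := c.N)
        (by positivity) (by linarith)
      have h2 : c.N * (c.h * (9 * c.μ + c.B * c.B * c.h)) ≤ c.N * c.h * (10 * c.μ) := by
        rw [mul_assoc (c.N : ℝ)]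
        refine mul_le_mul_of_nonneg_left (mul_le_mul_of_nonneg_left ?_ hh.le) (Nat.cast_nonneg _)
        linarith [hc.h_le_μ]
      refine add_le_add (mul_le_mul h1 (by linarith) (by positivity) (Real.exp_pos _).le) hBh
    μ_le := by linarith
    ρ_le := by linarith
    Na_pos := hc.Na_pos
    Na_lt := hc.Na_lt
    Nb_lt := hc.Nb_lt
    transversal := fun i hi => by
      refine (hc.transversal i hi).imp id fun h1 => ?_
      have h2 := ha.abs_wedge_field_sub_le (hc.z_mem i hi.le) (hfl.mem x hx _ (htN i))
        (hzt i hi.le _ le_rfl (by linarith)) (by linarith)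
      have h3 := mul_le_mul hc.abs_σ_le h2 (abs_nonneg _) hB0
      rw [← abs_mul, mul_sub] at h3
      have h4 := (abs_le.1 h3).1
      have h5 := hBpow hρ.le (j := 2) (by norm_num)
      have h6 := hBpow hω.le (j := 0) (by norm_num)
      rw [pow_zero, one_mul] at h6
      have h7 : c.B * (8 * c.B * c.ρ) = 8 * ((c.B : ℝ) ^ 2 * c.ρ) := by ring
      linarith [hc.ρ_le]
    separated := fun i hi => by
      refine (hc.separated i hi).imp id fun ⟨h1, h2, h3⟩ => ?_
      have key : ∀ r r' : Plane, ‖r - r'‖ ≤ c.μ → 2 ≤ inner ℝ (c.a i).val (Φ x (i * c.h) - r) →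
          1 ≤ inner ℝ (c.a i).val ((c.z i).val - r') := by
        intro r r' hr h4
        have e : (c.z i).val - r' = (Φ x (i * c.h) - r)
          + (((c.z i).val - Φ x (i * c.h)) + (r - r')) := by abel
        rw [e, inner_add_right]
        have h5 := (abs_le.1 (abs_real_inner_le_norm (c.a i).val
          (((c.z i).val - Φ x (i * c.h)) + (r - r')))).1
        have h6 : ‖((c.z i).val - Φ x (i * c.h)) + (r - r')‖ ≤ 2 * c.ρ :=
          (norm_add_le _ _).trans (by linarith [hzt i hi.le _ le_rfl (by linarith)])
        have h7 := mul_le_mul ((norm_le_norm₁ _).trans h1) h6 (norm_nonneg _) (Nat.cast_nonneg _)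
        linarith [hc.A_le]
      exact ⟨h1, key p _ ha.left_le h2, key q _ ha.right_le h3⟩
    A_le := hc.A_le
    below := by
      have := (abs_le.1 (hpos c.Nb hc.Nb_lt.le)).2
      linarith [hc.below]
    above := by
      have := (abs_le.1 (hpos c.N le_rfl)).1
      linarith [hc.above]
    s_nonneg := hc.s_nonneg
    s_le := hc.s_le
    near_segment := by
      have e : c.y.val - p'.val - c.s.val • (q'.val - p'.val) = (c.y.val - Φ x τ)
        - (p + c.s.val • (q - p) - Φ x τ) + (p - p'.val)
        - c.s.val • ((q'.val - p'.val) - (q - p)) := by module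
      have h3 : ‖c.s.val • ((q'.val - p'.val) - (q - p))‖ ≤ 2 * c.μ := by
        rw [norm_smul, Real.norm_of_nonneg hc.s_nonneg]
        exact (mul_le_of_le_one_left (norm_nonneg _) hc.s_le).trans ha.norm_dir_sub_le
      refine (norm₁_le _).trans ?_
      rw [e]
      have h4 := norm_sub_le ((c.y.val - Φ x τ) - (p + c.s.val • (q - p) - Φ x τ) + (p - p'.val))
        (c.s.val • ((q'.val - p'.val) - (q - p)))
      have h5 := norm_add_le ((c.y.val - Φ x τ) - (p + c.s.val • (q - p) - Φ x τ)) (p - p'.val)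
      have h6 := norm_sub_le (c.y.val - Φ x τ) (p + c.s.val • (q - p) - Φ x τ)
      linarith [ha.left_le, hc.s_near, hc.y_near]
    near_crossing := by
      have e : (c.z c.Nb).val - c.y.val = ((c.z c.Nb).val - Φ x τ) - (c.y.val - Φ x τ) := by abel
      refine (norm₁_le _).trans ?_
      rw [e]
      have := norm_sub_le ((c.z c.Nb).val - Φ x τ) (c.y.val - Φ x τ)
      linarith [hc.y_near]
    arc_le := hc.arc_le
    η_le := by linarith
    integral_ge := by linarith [hc.integral_ge, hint'.2]
    integral_le := by linarith [hc.integral_le, hint'.1]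
    J₁_ge := hc.J₁_ge
    J₂_le := hc.J₂_le
    exp_ge := hc.exp_ge
    exp_le := hc.exp_le
    jacobian₀ := hjac _ _ (by simp) hc.d₀_le hc.d₀_near
    jacobian₁ := hjac _ _ (by simp) hc.d₁_le hc.d₁_near
    precision := hc.precision }

end Certificate

theorem List.getD_map_range {α : Type*} (f : ℕ → α) (d : α) {n i : ℕ} (hi : i < n) :
    ((List.range n).map f).getD i d = f i := by
  simp [List.getD, hi]

namespace Certificate

variable {f g : Plane → Plane} {Φ : Plane → ℝ → Plane} {K L : NNReal} {p q x : Plane} {τ : ℝ}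
  {F : ℕ → FieldCode}

set_option maxHeartbeats 1000000 in
/-- The parameters are chosen one after the other: `σ`, `B`, `ω` and the exponential bracket depend
on the trajectory up to the return only; the accuracy of the bracket determines `η`, hence the times
where the phases change, hence the separating functionals; these determine `l`, `ρ`, then `μ` and
finally the step `h`. -/
theorem exists_isClose (hfl : IsDiskFlow f g Φ K L) (hf : ContDiff ℝ 1 f) (hF : IsC1Name f F)
    (hpq : segment ℝ p q ⊆ unitDisk) (hne : ∀ x ∈ segment ℝ p q, wedge (q - p) (g x) ≠ 0)
    (hx : x ∈ segment ℝ p q) (hτ : 0 < τ) (hτS : Φ x τ ∈ segment ℝ p q)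
    (hτn : ∀ t ∈ Ioo 0 τ, Φ x t ∉ segment ℝ p q) (n : ℕ) :
    ∃ c : Certificate, c.IsClose f Φ p q x τ (F 0) (F c.l) n := by
  have hxd := hpq hx
  have hwd := hpq hτS
  have hcu : Continuous (Φ x) := hfl.flow.continuous_time x
  have hv2 : ‖q - p‖ ≤ 2 := by
    have h1 := mem_unitDisk.1 (hpq (left_mem_segment ℝ p q))
    have h2 := mem_unitDisk.1 (hpq (right_mem_segment ℝ p q))
    exact (norm_sub_le _ _).trans (by linarith)
  -- the factor `σ` normalizes the transversality at both ends
  have hpos : 0 < wedge (q - p) (f x) * wedge (q - p) (f (Φ x τ)) := by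
    have h1 := hfl.sign_const hne hx hτS (mul_self_pos.2 (hne x hx))
    rwa [hfl.eq _ hxd, hfl.eq _ hwd] at h1
  obtain ⟨σ, hσx, hσw⟩ := exists_ratCode_scale hpos
  set S := ∫ t in (0 : ℝ)..τ, divergence f (Φ x t) with hS
  set G := wedge (f (Φ x τ)) (q - p) with hG
  have hD := Real.exp_pos S
  set M : Plane → ℝ := fun e => Real.exp S * |wedge (f x) e| / |G| * ‖q - p‖ with hM
  have hM0 : ∀ e, 0 ≤ M e := fun e => by positivity
  have hF0 := FieldCode.bound_nonneg (F 0)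
  obtain ⟨B, hB⟩ := exists_nat_ge (2 + 2 * (FieldCode.bound (F 0)).val + |σ.val| + Real.exp S
    + 2 * (M (stdVec 0) + 1) + 2 * (M (stdVec 1) + 1))
  have hM1 := hM0 (stdVec 0)
  have hM2 := hM0 (stdVec 1)
  have hσ0 := abs_nonneg σ.val
  have hBb : 2 + 2 * (FieldCode.bound (F 0)).val ≤ B := by linarith
  have hB1 : (1 : ℝ) ≤ B := by linarith
  have hB0 : (0 : ℝ) < B := by linarith
  have hσB : |σ.val| ≤ B := by linarith
  have hEB : Real.exp S ≤ B := by linarith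
  have hfB := hF.isFieldBound (hf.differentiable one_ne_zero) hBb
  obtain ⟨W, hW⟩ := exists_unitFrac_le (show 0 < (1 / 2 : ℝ) ^ n / (100 * (B * B * B)) by positivity)
  set ω : ℝ := 1 / ((W : ℝ) + 1) with hωdef
  have hω : 0 < ω := by positivity
  have hω1 : ω ≤ 1 := by
    rw [hωdef, div_le_one (by positivity)]
    have : (0 : ℝ) ≤ W := Nat.cast_nonneg _
    linarith
  obtain ⟨E, J₁, J₂, r, hE0, hED, hJ1, hJ2, hJ1', hJ2', hE1, hE2⟩ := exists_exp_bracket S hω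
  set δ : ℝ := ω / (1000 * (B : ℝ) ^ 3) with hδdef
  have hδ : 0 < δ := by positivity
  have hB3 : (1 : ℝ) ≤ (B : ℝ) ^ 3 := one_le_pow₀ hB1
  have hδω : 1000 * (B : ℝ) ^ 3 * δ = ω := mul_div_cancel₀ _ (by positivity)
  have hδ1 : δ ≤ 1 := (div_le_one (by positivity)).2 (by linarith)
  have hle : ∀ {t : ℝ}, t ≤ δ → 1000 * (B : ℝ) ^ 3 * t ≤ ω := fun ht => by
    rw [← hδω]; gcongr
  -- the approximate values
  obtain ⟨s₀, hs₀, hws⟩ := exists_mem_segment_iff.1 hτS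
  obtain ⟨s, hs0, hs1, hss⟩ := exists_ratCode_near_of_mem_Icc hs₀
    (show 0 < ω / 2000 by positivity)
  obtain ⟨y, hy⟩ := exists_ptCode_near (Φ x τ) (show 0 < ω / 1000 by positivity)
  have hdex : ∀ e : Plane, 2 * (M e + 1) ≤ B → ∃ d : PtCode, norm₁ d.val ≤ B ∧
      ‖d.val - (E.val * wedge (f x) e / G) • (q - p)‖ ≤ δ := by
    intro e he
    obtain ⟨d, hd⟩ := exists_ptCode_near ((E.val * wedge (f x) e / G) • (q - p)) hδ
    refine ⟨d, (norm₁_le _).trans ?_, hd⟩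
    have h1 : ‖(E.val * wedge (f x) e / G) • (q - p)‖ ≤ M e := by
      rw [norm_smul, Real.norm_eq_abs, abs_div, abs_mul, abs_of_nonneg hE0]
      change _ ≤ Real.exp S * |wedge (f x) e| / |G| * ‖q - p‖
      gcongr
    have h2 := norm_le_norm_sub_add d.val ((E.val * wedge (f x) e / G) • (q - p))
    linarith
  obtain ⟨d₀, hd₀, hd₀'⟩ := hdex (stdVec 0) (by linarith)
  obtain ⟨d₁, hd₁, hd₁'⟩ := hdex (stdVec 1) (by linarith)
  set ζ₀ : ℝ := min (S - r * J₁.val) (r * J₂.val - S) with hζ₀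
  have hζ0 : 0 < ζ₀ := lt_min (by linarith) (by linarith)
  obtain ⟨V, hV⟩ := exists_unitFrac_le (show 0 < min δ (ζ₀ / 8) by positivity)
  set η : ℝ := 1 / ((V : ℝ) + 1) with hηdef
  have hη : 0 < η := by positivity
  -- the times that separate the phases of the trajectory
  have hcF : Continuous fun t => σ.val * wedge (q - p) (f (Φ x t)) := by
    have := hf.continuous
    fun_prop
  obtain ⟨a, e, ha, he, hae, heη, hA, hC⟩ := exists_times hcF (ε := η / (4 * B)) hτ (by positivity)
    (by rw [hfl.flow.zero]; linarith) (by linarith)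
  have hBe : B * e ≤ η / 4 := by
    rw [le_div_iff₀ (by positivity)] at heη
    linarith
  have hmono := hfl.strictMonoOn_wedge (p := p) (v := q - p) (x := x) (σ := σ.val) (b := τ - e)
    (T := τ + e) fun t ht => by
      have h1 := hC t ht
      rw [hfl.eq _ (hfl.mem x hxd t (by linarith [ht.1]))]
      linarith
  have hzero : σ.val * wedge (q - p) (Φ x τ - p) = 0 := by
    rw [hws, wedge_line, mul_zero]
  have hFb : σ.val * wedge (q - p) (Φ x (τ - e) - p) < 0 := by
    rw [← hzero]
    exact hmono ⟨le_rfl, by linarith⟩ ⟨by linarith, by linarith⟩ (by linarith)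
  have hFT : 0 < σ.val * wedge (q - p) (Φ x (τ + e) - p) := by
    rw [← hzero]
    exact hmono ⟨by linarith, by linarith⟩ ⟨by linarith, le_rfl⟩ (by linarith)
  set m₀ : ℝ := min (-(σ.val * wedge (q - p) (Φ x (τ - e) - p)))
    (σ.val * wedge (q - p) (Φ x (τ + e) - p)) with hm₀
  have hm0 : 0 < m₀ := lt_min (by linarith) hFT
  obtain ⟨A, hAsep⟩ := exists_separating (p := p) (q := q)
    ((isCompact_Icc (a := a) (b := τ - e)).image hcu) (by
      rintro - ⟨t, ht, rfl⟩
      exact hτn t ⟨ha.trans_le ht.1, by linarith [ht.2]⟩)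
  -- the accuracies
  obtain ⟨l, hl⟩ := exists_unitFrac_le (show 0 < ζ₀ / (16 * (τ + e + 1)) by positivity)
  set κ := (FieldCode.div (F l)).bound.val with hκ
  have hκ0 : 0 ≤ κ := PolyCode.bound_nonneg _
  obtain ⟨R, hR⟩ := exists_unitFrac_le (show 0 < min (min δ (1 / (4 * (A + 1))))
    (min (m₀ / (23 * B)) (ζ₀ / (8 * ((τ + e + 1) * (κ + 1))))) by positivity)
  set ρ : ℝ := 1 / ((R : ℝ) + 1) with hρdef
  have hρ : 0 < ρ := by positivity
  have hρ1 : ρ ≤ δ := hR.trans ((min_le_left _ _).trans (min_le_left _ _))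
  have hρ2 : ρ ≤ 1 / (4 * (A + 1)) := hR.trans ((min_le_left _ _).trans (min_le_right _ _))
  have hρ3 : ρ ≤ m₀ / (23 * B) := hR.trans ((min_le_right _ _).trans (min_le_left _ _))
  have hρ4 : ρ ≤ ζ₀ / (8 * ((τ + e + 1) * (κ + 1))) :=
    hR.trans ((min_le_right _ _).trans (min_le_right _ _))
  set Γ := Real.exp (B * (τ + e + 1)) with hΓ
  obtain ⟨m, hm⟩ := exists_unitFrac_le
    (show 0 < ρ / (Γ * (5 + (τ + e + 1) * 10) + 1) by positivity)
  set μ : ℝ := 1 / ((m : ℝ) + 1) with hμdef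
  have hμ : 0 < μ := by positivity
  have hμΓ : Γ * (5 * μ + (τ + e + 1) * (10 * μ)) + μ ≤ ρ := by
    rw [le_div_iff₀ (by positivity)] at hm
    linarith
  have hμρ : μ ≤ ρ := by
    have : 0 ≤ Γ * (5 * μ + (τ + e + 1) * (10 * μ)) := by positivity
    linarith
  have hba : 0 < τ - e - a := by linarith
  obtain ⟨H, hH⟩ := exists_unitFrac_le (show 0 < min (min (μ / (B * B)) ((τ - e - a) / 2))
    (min e (min (η / (2 * B)) 1)) by positivity)
  set h : ℝ := 1 / ((H : ℝ) + 1) with hhdef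
  have hh : 0 < h := by positivity
  have hh1 : h ≤ μ / (B * B) := hH.trans ((min_le_left _ _).trans (min_le_left _ _))
  have hh2 : h ≤ (τ - e - a) / 2 := hH.trans ((min_le_left _ _).trans (min_le_right _ _))
  have hh3 : h ≤ e := hH.trans ((min_le_right _ _).trans (min_le_left _ _))
  have hh4 : h ≤ η / (2 * B) :=
    hH.trans ((min_le_right _ _).trans ((min_le_right _ _).trans (min_le_left _ _)))
  have hh5 : h ≤ 1 :=
    hH.trans ((min_le_right _ _).trans ((min_le_right _ _).trans (min_le_right _ _)))
  have hBBh : B * B * h ≤ μ := by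
    rw [le_div_iff₀ (by positivity)] at hh1
    linarith
  have hBh : B * h ≤ η / 2 := by
    rw [le_div_iff₀ (by positivity)] at hh4
    linarith
  have hbpos : 0 < τ - e := by linarith only [ha, hae]
  have hTpos : 0 < τ + e := by linarith only [hτ, he]
  obtain ⟨Na, Nb, N, hNa, hNab, hNbN, g1, g2, g3, g4, g5, g6, g7, g8⟩ :=
    exists_grid (a := a) (b := τ - e) (T := τ + e) ha hh
      (by linarith only [hh2, hba]) (by linarith only [hh3, he])
  have g4' := g4 Nb le_rfl
  have htN : ∀ i : ℕ, 0 ≤ (i : ℝ) * h := fun i => by positivity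
  have hNh : N * h ≤ τ + e + 1 := by linarith only [g8, hh5]
  choose zc hzc using fun i : ℕ => exists_ptCode_near_of_mem_unitDisk (hfl.mem x hxd _ (htN i))
    (show 0 < h * μ / (4 * B) by positivity)
  have hac : ∀ i : ℕ, ∃ α : PtCode, (i : ℝ) * h ∈ Icc a (τ - e) → norm₁ α.val ≤ A ∧
      2 ≤ inner ℝ α.val (Φ x (i * h) - p) ∧ 2 ≤ inner ℝ α.val (Φ x (i * h) - q) := by
    intro i
    by_cases hi : (i : ℝ) * h ∈ Icc a (τ - e)
    · obtain ⟨α, hα⟩ := hAsep _ ⟨_, hi, rfl⟩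
      exact ⟨α, fun _ => hα⟩
    · exact ⟨default, fun h => absurd h hi⟩
  choose ac hac using hac
  set c : Certificate := ((m, H, l, Na, Nb, N), (B, A, R, V, W, r), (σ, s, E, J₁, J₂),
    ((List.range (N + 1)).map zc, (List.range N).map ac), (y, d₀, d₁))
  have hcz : ∀ i ≤ N, c.z i = zc i := fun i hi =>
    List.getD_map_range zc _ (Nat.lt_succ_of_le hi)
  have hca : ∀ i < N, c.a i = ac i := fun i hi => List.getD_map_range ac _ hi
  have hFbound : ∀ t t' : ℝ, 0 ≤ t → 0 ≤ t' → |t' - t| ≤ h →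
      |σ.val * wedge (q - p) (Φ x t' - p) - σ.val * wedge (q - p) (Φ x t - p)| ≤ 2 * μ := by
    intro t t' ht ht' htt
    rw [← mul_sub, ← wedge_sub_right, sub_sub_sub_cancel_right, abs_mul]
    have h1 := abs_wedge_le (q - p) (Φ x t' - Φ x t)
    have h2 := hfl.norm_sub_le hfB hxd ht ht'
    have h3 : |wedge (q - p) (Φ x t' - Φ x t)| ≤ 2 * (B * h) := by
      refine h1.trans (mul_le_mul hv2 (h2.trans ?_) (norm_nonneg _) zero_le_two)
      exact mul_le_mul_of_nonneg_left htt hB0.le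
    have h4 := mul_le_mul hσB h3 (abs_nonneg _) hB0.le
    linarith only [h4, hBBh]
  have h23 : 23 * (B * ρ) ≤ m₀ := by
    rw [le_div_iff₀ (by positivity)] at hρ3
    linarith only [hρ3]
  have hBρ : ρ ≤ B * ρ := le_mul_of_one_le_left hρ.le hB1
  have hζ : 2 * c.ζ (F l) ≤ ζ₀ := by
    have e1 : c.ζ (F l) = N * h * (2 * (1 / ((l : ℝ) + 1)) + κ * ρ) + η := rfl
    have hT : 0 < τ + e + 1 := by linarith only [hτ, he]
    have e2 : N * h * (2 * (1 / ((l : ℝ) + 1)) + κ * ρ)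
        ≤ (τ + e + 1) * (2 * (1 / ((l : ℝ) + 1)) + κ * ρ) :=
      mul_le_mul_of_nonneg_right hNh (by positivity)
    rw [le_div_iff₀ (by positivity)] at hl hρ4
    have e3 : (τ + e + 1) * (κ * ρ) ≤ ρ * ((τ + e + 1) * (κ + 1)) := by
      linarith only [mul_nonneg hT.le hρ.le]
    have e4 := hV.trans (min_le_right _ _)
    rw [e1]
    linarith only [e2, e3, e4, hl, hρ4, hζ0]
  refine ⟨c, ?_⟩
  exact
  { bound := hBb
    abs_σ_le := hσB
    E_nonneg := hE0
    E_le := hED.trans hEB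
    d₀_le := hd₀
    d₁_le := hd₁
    Na_pos := hNa
    Na_lt := hNab
    Nb_lt := hNbN
    s_nonneg := hs0
    s_le := hs1
    J₁_ge := hJ1'
    J₂_le := hJ2'
    exp_ge := hE1
    exp_le := hE2
    precision := by
      rw [le_div_iff₀ (by positivity)] at hW
      change 100 * (B * B * B * ω) ≤ (1 / 2 : ℝ) ^ n
      linarith only [hW]
    z_mem := fun i hi => by rw [hcz i hi]; exact (hzc i).2
    z_near := fun i hi => by
      rw [hcz i hi]
      have h1 := (hzc i).1
      rw [le_div_iff₀ (by positivity)] at h1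
      change 4 * B * ‖(zc i).val - Φ x (i * h)‖ ≤ h * μ
      linarith only [h1]
    h_le_one := hh5
    h_le_μ := hBBh
    growth := by
      refine le_trans ?_ hμΓ
      change Real.exp (B * (N * h)) * (5 * μ + N * h * (10 * μ)) + μ ≤ _
      rw [hΓ]
      gcongr
    ρ_le := hle hρ1
    η_le := hle (hV.trans (min_le_left _ _))
    A_le := by
      change 4 * (A * ρ) ≤ 1
      rw [le_div_iff₀ (by positivity)] at hρ2
      linarith only [hρ2, hρ]
    arc_le := by
      change B * (((N - Nb : ℕ) : ℝ) * h) ≤ η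
      rw [Nat.cast_sub hNbN.le, sub_mul]
      have e1 : B * (N * h - Nb * h) ≤ B * (e + e + h) :=
        mul_le_mul_of_nonneg_left (by linarith only [g8, g4']) hB0.le
      linarith only [e1, hBe, hBh]
    transversal := fun i hi => by
      change (Na ≤ i ∧ i < Nb) ∨ 3 / 2 ≤ σ.val * wedge (q - p) (f (Φ x (i * h)))
      rcases lt_or_ge i Na with h1 | h1
      · exact Or.inr (hA _ ⟨htN i, g1 i h1⟩)
      · rcases lt_or_ge i Nb with h2 | h2
        · exact Or.inl ⟨h1, h2⟩
        · exact Or.inr (hC _ ⟨g4 i h2, g5 i hi⟩)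
    separated := fun i hi => by
      rw [hca i hi]
      change (i < Na ∨ Nb ≤ i) ∨ norm₁ (ac i).val ≤ A ∧
        2 ≤ inner ℝ (ac i).val (Φ x (i * h) - p) ∧ 2 ≤ inner ℝ (ac i).val (Φ x (i * h) - q)
      rcases lt_or_ge i Na with h1 | h1
      · exact Or.inl (Or.inl h1)
      · rcases lt_or_ge i Nb with h2 | h2
        · exact Or.inr (hac i ⟨g2 i h1, g3 i h2⟩)
        · exact Or.inl (Or.inr h2)
    below := by
      change σ.val * wedge (q - p) (Φ x (Nb * h) - p) ≤ -(21 * (B * ρ))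
      have h1 := abs_le.1 (hFbound (τ - e) (Nb * h) hbpos.le (htN _)
        (abs_le.2 ⟨by linarith only [g4', hh], by linarith only [g7]⟩))
      have h2 := min_le_left (-(σ.val * wedge (q - p) (Φ x (τ - e) - p)))
        (σ.val * wedge (q - p) (Φ x (τ + e) - p))
      linarith only [h1.2, h2, h23, hm₀, hμρ, hBρ]
    above := by
      change 21 * (B * ρ) ≤ σ.val * wedge (q - p) (Φ x (N * h) - p)
      have h1 := abs_le.1 (hFbound (τ + e) (N * h) hTpos.le (htN _)
        (abs_le.2 ⟨by linarith only [g6, hh], by linarith only [g8]⟩))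
      have h2 := min_le_right (-(σ.val * wedge (q - p) (Φ x (τ - e) - p)))
        (σ.val * wedge (q - p) (Φ x (τ + e) - p))
      linarith only [h1.1, h2, h23, hm₀, hμρ, hBρ]
    return_near := by
      change B * |τ - Nb * h| ≤ η
      have h1 : |τ - Nb * h| ≤ e + h := abs_le.2
        ⟨by linarith only [g7, he], by linarith only [g4', hh]⟩
      have h2 := mul_le_mul_of_nonneg_left h1 hB0.le
      linarith only [h2, hBe, hBh, hη]
    s_near := by
      change 1000 * ‖p + s.val • (q - p) - Φ x τ‖ ≤ ω
      have e1 : p + s.val • (q - p) - Φ x τ = (s.val - s₀) • (q - p) := by rw [hws]; module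
      rw [e1, norm_smul, Real.norm_eq_abs]
      have := mul_le_mul hss hv2 (norm_nonneg _) (by positivity)
      linarith only [this]
    y_near := show 1000 * ‖y.val - Φ x τ‖ ≤ ω by linarith only [hy]
    d₀_near := hle hd₀'
    d₁_near := hle hd₁'
    integral_ge := by
      change r * J₁.val ≤ S - 2 * c.ζ (F l)
      linarith only [min_le_left (S - r * J₁.val) (r * J₂.val - S), hζ, hζ₀]
    integral_le := by
      change S + 2 * c.ζ (F l) ≤ r * J₂.val
      linarith only [min_le_right (S - r * J₁.val) (r * J₂.val - S), hζ, hζ₀] }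

end Certificate

/-! ### The algorithm -/

namespace Certificate

/-- The points that a certificate claims to approximate the value and the columns of the Jacobian. -/
def output (c : Certificate) : PtCode × PtCode × PtCode := (c.y, c.d₀, c.d₁)

open Classical in
/-- At the stage `k`, the algorithm decodes a certificate from `k` and outputs its claims if it is
valid. Every certificate comes up at arbitrarily late stages. -/
def search (pc qc : ℕ → PtCode) (Fs : List FieldCode) (Xs : List PtCode) (n : ℕ) :
    Option (PtCode × PtCode × PtCode) :=
  (Encodable.decode (α := Certificate) Fs.length.unpair.1).bind fun c =>
    if (c.m < Fs.length ∧ c.l < Fs.length ∧ c.m < Xs.length) ∧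
      c.IsValid (Fs.getD 0 default) (Fs.getD c.m default) (Fs.getD c.l default)
        (Xs.getD c.m default) (pc c.m) (qc c.m) n
    then some c.output else none

set_option synthInstance.maxSize 2000 in
set_option synthInstance.maxHeartbeats 400000 in
open Classical in
theorem isOracleAlgorithm_search {pc qc : ℕ → PtCode} (hp : Computable pc) (hq : Computable qc) :
    IsOracleAlgorithm (search pc qc) := by
  have hcheck : Primrec fun x : Input × ℕ × ℕ =>
      if (x.1.1.m < x.2.1 ∧ x.1.1.l < x.2.1 ∧ x.1.1.m < x.2.2) ∧
        x.1.1.IsValid x.1.2.1.1 x.1.2.1.2.1 x.1.2.1.2.2 x.1.2.2.1.1 x.1.2.2.1.2.1 x.1.2.2.1.2.2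
          x.1.2.2.2
      then some x.1.1.output else none := by
    refine Primrec.ite (PrimrecPred.and (PrimrecPred.and ?_ (PrimrecPred.and ?_ ?_)) ?_) ?_ ?_
    · exact Primrec.nat_lt.comp (f := fun x : Input × ℕ × ℕ => x.1.1.m) (by fun_prop)
        (g := fun x => x.2.1) (by fun_prop)
    · exact Primrec.nat_lt.comp (f := fun x : Input × ℕ × ℕ => x.1.1.l) (by fun_prop)
        (g := fun x => x.2.1) (by fun_prop)
    · exact Primrec.nat_lt.comp (f := fun x : Input × ℕ × ℕ => x.1.1.m) (by fun_prop)
        (g := fun x => x.2.2) (by fun_prop)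
    · exact primrecPred_isValid.comp (f := fun x : Input × ℕ × ℕ => x.1) (by fun_prop)
    · unfold output
      exact Primrec.option_some.comp (by fun_prop)
    · fun_prop
  refine Computable.option_bind (Primrec.to_comp ?_) ?_
  · exact Primrec.decode.comp (Primrec.fst.comp (Primrec.unpair.comp
      (Primrec.list_length.comp (by fun_prop))))
  · have hm : Computable fun x : (List FieldCode × List PtCode × ℕ) × Certificate => x.2.m :=
      Primrec.to_comp (by fun_prop)
    refine hcheck.to_comp.comp
      (g := fun x : (List FieldCode × List PtCode × ℕ) × Certificate =>
        ((x.2, (x.1.1.getD 0 default, x.1.1.getD x.2.m default, x.1.1.getD x.2.l default),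
          (x.1.2.1.getD x.2.m default, pc x.2.m, qc x.2.m), x.1.2.2),
          x.1.1.length, x.1.2.1.length)) ?_
    refine .pair (.pair (Primrec.to_comp (by fun_prop)) (.pair (Primrec.to_comp (by fun_prop))
      (.pair (.pair (Primrec.to_comp (by fun_prop)) (.pair (hp.comp hm) (hq.comp hm)))
        (Primrec.to_comp (by fun_prop))))) (.pair (Primrec.to_comp ?_) (Primrec.to_comp ?_))
    · exact Primrec.list_length.comp (by fun_prop)
    · exact Primrec.list_length.comp (by fun_prop)

variable {pc qc : ℕ → PtCode} {F : ℕ → FieldCode} {X : ℕ → PtCode} {n : ℕ}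

theorem isValid_of_search_eq_some {k : ℕ} {v : PtCode × PtCode × PtCode}
    (h : search pc qc ((List.range k).map F) ((List.range k).map X) n = some v) :
    ∃ c : Certificate, c.IsValid (F 0) (F c.m) (F c.l) (X c.m) (pc c.m) (qc c.m) n ∧
      v = c.output := by
  obtain ⟨c, -, h⟩ := Option.bind_eq_some_iff.1 h
  split_ifs at h with hc
  obtain ⟨⟨h1, h2, h3⟩, hv⟩ := hc
  rw [List.length_map, List.length_range] at h1 h2 h3
  rw [List.getD_map_range _ _ h1, List.getD_map_range _ _ h2, List.getD_map_range _ _ h3,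
    List.getD_map_range _ _ (Nat.zero_lt_of_lt h1)] at hv
  exact ⟨c, hv, (Option.some.inj h).symm⟩

theorem exists_search_eq_some {c : Certificate}
    (hv : c.IsValid (F 0) (F c.m) (F c.l) (X c.m) (pc c.m) (qc c.m) n) :
    ∃ k, search pc qc ((List.range k).map F) ((List.range k).map X) n = some c.output := by
  set k := Nat.pair (Encodable.encode c) (c.m + c.l + 1) with hk
  have hle : c.m + c.l + 1 ≤ k := Nat.right_le_pair _ _
  have h1 : c.m < k := by omega
  have h2 : c.l < k := by omega
  refine ⟨k, Option.bind_eq_some_iff.2 ⟨c, ?_, ?_⟩⟩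
  · rw [List.length_map, List.length_range, hk, Nat.unpair_pair, Encodable.encodek]
  · refine if_pos ⟨by simp only [List.length_map, List.length_range]; exact ⟨h1, h2, h1⟩, ?_⟩
    rw [List.getD_map_range _ _ h1, List.getD_map_range _ _ h2, List.getD_map_range _ _ h1,
      List.getD_map_range _ _ (Nat.zero_lt_of_lt h1)]
    exact hv

end Certificate

/-- An algorithm that stops at some stage stops at a first stage, with a possibly different output. -/
theorem exists_oracleOutputs {α β γ : Type} {M : List α → List β → ℕ → Option γ} {F : ℕ → α}
    {X : ℕ → β} {n k : ℕ} {v : γ}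
    (h : M ((List.range k).map F) ((List.range k).map X) n = some v) :
    ∃ v, OracleOutputs M F X n v := by
  classical
  have hex : ∃ k, ∃ v, M ((List.range k).map F) ((List.range k).map X) n = some v := ⟨k, v, h⟩
  obtain ⟨v, hv⟩ := Nat.find_spec hex
  refine ⟨v, Nat.find hex, hv, fun j hj => ?_⟩
  have := Nat.find_min hex hj
  push Not at this
  exact Option.eq_none_iff_forall_ne_some.2 this

end

theorem mainTheorem5 (p q : Plane) (hpq : segment ℝ p q ⊆ unitDisk)
    (hcomp : IsComputableCompact (segment ℝ p q)) :
    ∃ M : List FieldCode → List PtCode → ℕ → Option (PtCode × PtCode × PtCode),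
      IsOracleAlgorithm M ∧
      ∀ (f : Plane → Plane) (γ : Set Plane) (P : Plane → Plane),
        IsInwardC1Field f → IsPeriodicOrbit f γ → IsCrossSection f p q γ →
        IsPoincareMap f (segment ℝ p q) P →
        ∃ DP : Plane → (Plane →L[ℝ] Plane),
          (∀ x ∈ segment ℝ p q,
            HasFDerivWithinAt P (DP x) (segment ℝ p q) x ∧ IsPoincareJacobian f p q P x (DP x)) ∧
          ∀ F : ℕ → FieldCode, IsC1Name f F →
          ∀ x ∈ segment ℝ p q, ∀ X : ℕ → PtCode, IsPointName x X →
          ∀ n : ℕ, ∃ y d₀ d₁ : PtCode,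
            OracleOutputs M F X n (y, d₀, d₁) ∧
            ‖P x - PtCode.val y‖ ≤ (1 / 2 : ℝ) ^ n ∧
            ‖DP x (EuclideanSpace.single 0 1) - PtCode.val d₀‖ ≤ (1 / 2 : ℝ) ^ n ∧
            ‖DP x (EuclideanSpace.single 1 1) - PtCode.val d₁‖ ≤ (1 / 2 : ℝ) ^ n := by
  obtain ⟨pc, hpc, hpc'⟩ := exists_computable_endpoint hpq hcomp
  obtain ⟨qc, hqc, hqc'⟩ := exists_computable_endpoint (p := q) (q := p)
    (by rwa [segment_symm]) (by rwa [segment_symm])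
  refine ⟨Certificate.search pc qc, Certificate.isOracleAlgorithm_search hpc hqc, ?_⟩
  intro f γ P hf _ hcross hP
  obtain ⟨g, Φ, K, L, hfl⟩ := hf.exists_isDiskFlow
  have hne : ∀ x ∈ segment ℝ p q, wedge (q - p) (g x) ≠ 0 := fun x hx => by
    rw [hfl.eq x (hpq hx), wedge_comm, neg_ne_zero]
    exact (linearIndependent_iff_wedge_ne_zero _ _).1 (hcross.2.1 x hx)
  have hP' := hP
  choose! τ hτ using hP'
  refine ⟨fun x => poincareDeriv f Φ (q - p) x (τ x),
    fun x hx => hfl.isPoincareJacobian hpq hP hne hx (hτ x hx), ?_⟩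
  intro F hF x hx X hX n
  have hxd := hpq hx
  obtain ⟨hτ0, hPx, hΦ, hfirst⟩ := (hfl.isFirstReturn_iff hxd).1 (hτ x hx)
  rw [← hΦ] at hPx
  -- the search terminates
  obtain ⟨c, hc⟩ := Certificate.exists_isClose hfl hf.1 hF hpq hne hx hτ0 hPx hfirst n
  have hG : wedge (f (Φ x (τ x))) (q - p) ≠ 0 := by
    rw [← hfl.eq _ (hpq hPx), wedge_comm, neg_ne_zero]
    exact hne _ hPx
  have ha := c.isApproximation hc.bound (hf.1.differentiable one_ne_zero) hF hpq (hpc' c.m)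
    (hqc' c.m)
  have hv := hc.isValid hfl hf.1 ha (fun y hy => hF.abs_divergence_sub_le c.l hy) hxd
    ((hX c.m).trans (half_pow_le c.m)) hτ0.le hG
  obtain ⟨k, hk⟩ := Certificate.exists_search_eq_some hv
  obtain ⟨⟨y, d₀, d₁⟩, hout⟩ := exists_oracleOutputs hk
  -- it need not stop at the certificate `c`, but at some valid certificate
  obtain ⟨j, hj, -⟩ := id hout
  obtain ⟨c', hv', he⟩ := Certificate.isValid_of_search_eq_some hj
  obtain ⟨rfl, rfl, rfl⟩ : y = c'.y ∧ d₀ = c'.d₀ ∧ d₁ = c'.d₁ := by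
    simpa only [Certificate.output, Prod.mk.injEq] using he
  exact ⟨_, _, _, hout, hv'.sound hfl hf.1 hF hX hpq hP hne (hpc' _) (hqc' _) hx (hτ x hx)⟩
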